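/- **Setting.** Let $S_n$ be the set of permutations of $[n]=\{1,\dots,n\}$, written as vectors $\sigma=[\sigma(1),\dots,\sigma(n)]$. For $1\le i<j\le n$ let $t_{i\uparrow j}:S_n\to S_n$ move the entry in position $j$ to position $i$, shifting the entries in positions $i,\dots,j-1$ one place to the right, and let $t_{\uparrow j}=t_{1\uparrow j}$. A $G_\uparrow(n,M)$ is a cyclic sequence $(c_1,\dots,c_M)$ of distinct elements of $S_n$ in which every element, including $c_1$ as the successor of $c_M$, is obtained from its predecessor by some $t_{\uparrow j}$; the $j$'s form its transition sequence. It is a $G^{\mathrm{aux}}_\uparrow(n,M)$ if moreover no two codewords $\sigma,\tau$ satisfy $\tau=(q,n)\circ\sigma$ with $q<n$. The rank of $c_r$ is $r-1$. For $n\ge 3$ put $$\hat M_n=\frac{(n-1)!}{((n-1)/2)!^2\,2^{n-1}}\,n!\ \ (n\text{ odd}),\qquad \hat M_n=\frac{n!}{n-1}\ \ (n\text{ even}).$$ **The ingredients.** For every $n\ge 2$ take a complete code $G_\uparrow(n,n!)$ starting at $\mathrm{id}$, and for every $n\ge 3$ a $G^{\mathrm{aux}}_\uparrow(n,\hat M_n)$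 starting at $\mathrm{id}$ and with first transition $t_{\uparrow n}$, each of the two families together with a ranking and an unranking procedure (one program for all $n$) that takes at most $c\,n^2$ steps in $S_n$, where $c$ is a constant. Steps are counted on a machine with finitely many instructions operating on integer registers and arrays, where each elementary operation ($+,-,\cdot$, integer division, remainder, comparison, reading or writing a register or an array cell) on integers of any size costs one step. **The code $\hat C_1$.** Let $n=kd$ with $k\ge 2$, $d\ge 1$. Let $\sigma_0(j)=d\,(j\bmod k)+\lceil j/k\rceil$, and let $C_d$ be the code that starts at $\sigma_0$ and has transitions $t_{k(d-1)+1\uparrow k(d-1)+r}$, where $r$ runs through the transition sequence of the complete code in $S_k$. For $m=d-1,\dots,1$ let $C_m$ be the code that starts at $\sigma_0$ and whose transition sequence is obtained from that of $C_{m+1}$ by replacing each $t_{km+1\uparrow j}$ by $t_{k(m-1)+1\uparrow j}$ followed by $t_{k(m-1)+1\uparrow k(m-1)+i_2},t_{k(m-1)+1\uparrow k(m-1)+i_3},\dots$, where $k+1,i_2,i_3,\dots$ is the transition sequence of the auxiliary code in $S_{k+1}$. Then $\hat C_1$ is the code $C_1$ so obtained. **The procedures.** Let $\alpha_j(x)\in[k]$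 be the position of $x$ in the list $d+j,2d+j,\dots,(k-1)d+j,j$, with $\alpha_j(x)=k+1$ if $x$ is not in the list. Let $W_j=\{k(j-1)+2,\dots,kj+1\}\cap[n]$. $\mathtt{Rank}(\sigma)$: for $j=d,d-1,\dots,1$, form a permutation $\pi_j$ (of $[k]$ if $j=d$, of $[k+1]$ if $j<d$) by $\pi_j(i-k(j-1))=\alpha_j(\sigma(i))$ for $i\in W_j$, $\pi_j(1)$ being the remaining element; let $r_j$ be its rank in the complete code ($j=d$) or in the auxiliary code ($j<d$). Start with $m=(r_d-1)\bmod k!$, replace $m$ by $m\hat M_{k+1}+((r_j-1)\bmod\hat M_{k+1})$ for $j=d-1,\dots,1$, and return $(m+1)\bmod|\hat C_1|$. $\mathtt{Unrank}(m)$: replace $m$ by $(m-1)\bmod|\hat C_1|$; for $i=1,\dots,d-1$ put $r_i=(m+1)\bmod\hat M_{k+1}$ and replace $m$ by $\lfloor m/\hat M_{k+1}\rfloor$; put $r_d=(m+1)\bmod k!$. Let $\pi_d$ be the codeword of rank $r_d$ in the complete code, put $\sigma(i)=\alpha_d^{-1}(\pi_d(i-k(d-1)))$ for $i\in W_d$ and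 $x=\alpha_d^{-1}(\pi_d(1))$. For $j=d-1,\dots,1$ let $\pi_j$ be the codeword of rank $r_j$ in the auxiliary code; for $i\in W_j$ put $\sigma(i)=x$ if $\pi_j(i-k(j-1))=k+1$ and $\sigma(i)=\alpha_j^{-1}(\pi_j(i-k(j-1)))$ otherwise; then, if $\pi_j(1)\ne k+1$, replace $x$ by $\alpha_j^{-1}(\pi_j(1))$. Finally put $\sigma(1)=x$ and return $\sigma$. (Both procedures compute $k!$, $\hat M_{k+1}$ and $|\hat C_1|$ themselves.) **Theorem.** Ingredients as above exist, for some constant $c$. For every $c$ there is a constant $C$ such that, for all ingredients with constant $c$ and all $k\ge 2$, $d\ge 1$: $\mathtt{Rank}$, given any codeword $\sigma$ of $\hat C_1$, returns the rank of $\sigma$ in $\hat C_1$, and $\mathtt{Unrank}$, given any $m\in\{0,\dots,|\hat C_1|-1\}$, returns the codeword of rank $m$, each within $C\,k^2 d$ steps. In particular, for every $\varepsilon>0$ (and $c$) there is a constant $C'$ such that both take at most $C' n$ steps whenever $d\ge\varepsilon n$, that is, they run in linear time when $d=\Theta(n)$. -/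

import Mathlib

namespace RankMod

open Equiv

/-! ### Push-to-the-top codes

Permutations of `[n] = {1, …, n}` are permutations of `Fin n`, where the element `x` of `Fin n`
stands for `x + 1`. Indices of transitions are natural numbers and 1-based. -/

/-- The transition `t_{i↑j}`: `[a₁, …, aₙ] ↦ [a₁, …, a_{i-1}, a_j, a_i, …, a_{j-1}, a_{j+1}, …, aₙ]`,
that is `σ ↦ σ ∘ (j, j-1, …, i)`, for `1 ≤ i < j ≤ n`. (Other `i`, `j` never occur in a code.) -/
def push {n : ℕ} (i j : ℕ) (σ : Perm (Fin n)) : Perm (Fin n) :=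
  if h : 1 ≤ i ∧ i < j ∧ j ≤ n then
    σ * (Fin.cycleIcc (⟨i - 1, by omega⟩ : Fin n) ⟨j - 1, by omega⟩)⁻¹
  else σ

/-- The permutation reached from `σ` after the first `r` of the transitions `t_{i↑j}`, `j ∈ L`. -/
def codeword {n : ℕ} (i : ℕ) (σ : Perm (Fin n)) (L : List ℕ) (r : ℕ) : Perm (Fin n) :=
  (L.take r).foldl (fun τ j => push i j τ) σ

/-- The transition sequence `t_{↑j}`, `j ∈ L`, generates a `G_↑(n, M)` code starting at the
identity: a cyclic Gray code of size `M`. -/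
structure IsPushCode (n M : ℕ) (L : List ℕ) : Prop where
  size : L.length = M
  range : ∀ j ∈ L, 1 < j ∧ j ≤ n
  distinct : ∀ r r', r < r' → r' < M →
    codeword 1 (1 : Perm (Fin n)) L r ≠ codeword 1 (1 : Perm (Fin n)) L r'
  cyclic : codeword 1 (1 : Perm (Fin n)) L M = 1

/-- The transition sequence `L` generates an auxiliary code `G^aux_↑(n, M)` starting at the identity
and a `t_{↑n}` transition: no two codewords differ by a left factor `(q, n)`, `q < n`. -/
structure IsAuxCode (n M : ℕ) (L : List ℕ) : Prop extends IsPushCode n M L where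
  first : L.head? = some n
  aux : ∀ r < M, ∀ r' < M, ∀ q z : Fin n, z.val + 1 = n → q ≠ z →
    swap q z * codeword 1 (1 : Perm (Fin n)) L r ≠ codeword 1 (1 : Perm (Fin n)) L r'

/-- The size `M̂_n` of the rankable auxiliary codes in `S_n` (both quotients are exact). -/
def auxSize (n : ℕ) : ℕ :=
  if n % 2 = 1 then
    ((n - 1).factorial * n.factorial) / (((n - 1) / 2).factorial ^ 2 * 2 ^ (n - 1))
  else n.factorial / (n - 1)

/-! ### The code `Ĉ₁` of length `n = kd` -/

/-- The starting permutation `σ₀(j) = d (j mod k) + ⌈j / k⌉` (see `sigmaZero_apply`). -/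
def sigmaZero (k d : ℕ) : Perm (Fin (k * d)) :=
  (finCongr (Nat.mul_comm k d)).trans <| finProdFinEquiv.symm.trans <|
    (Equiv.prodComm (Fin d) (Fin k)).trans <|
      (Equiv.prodCongr (finRotate k) (Equiv.refl (Fin d))).trans finProdFinEquiv

/-- The transition sequence of `C_{d-e}`, whose transitions are pushes to the index `k(d-e-1)+1`.
For `m = d - (e + 1)`, the sequence of `C_m` is obtained from that of `C_{m+1}` by following each
transition with `t_{k(m-1)+1 ↑ k(m-1)+i}`, for `i` in the auxiliary sequence without its first
member. -/
def levelSeq (k d : ℕ) (comp aux : List ℕ) : ℕ → List ℕ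
  | 0 => comp.map fun r => k * (d - 1) + r
  | e + 1 => (levelSeq k d comp aux e).flatMap fun j =>
      j :: aux.tail.map fun i => k * (d - (e + 1) - 1) + i

/-- The transition sequence of `Ĉ₁`, given the complete code in `S_k` and the auxiliary code in
`S_{k+1}`. -/
def hatSeq (k d : ℕ) (comp aux : List ℕ) : List ℕ := levelSeq k d comp aux (d - 1)

/-- The codeword of rank `r` in `Ĉ₁` (ranks start at `0`). -/
def hatWord (k d : ℕ) (comp aux : List ℕ) (r : ℕ) : Perm (Fin (k * d)) :=
  codeword 1 (sigmaZero k d) (hatSeq k d comp aux) r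

/-! ### The machine model

Programs over integer registers and arrays of integers. Evaluating a constant, a register, an array
cell or one operation takes one step, and so does each assignment and each test. -/

/-- The contents of the registers and of the arrays. -/
structure State where
  reg : ℕ → ℕ
  arr : ℕ → ℕ → ℕ

/-- The elementary operations: `sub` is truncated at `0`, `div` and `mod` are Euclidean, and `lt` and
`eq` return `1` for true and `0` for false. -/
inductive Op
  | add | sub | mul | div | mod | lt | eq

def Op.eval : Op → ℕ → ℕ → ℕ
  | .add, a, b => a + b
  | .sub, a, b => a - b
  | .mul, a, b => a * b
  | .div, a, b => a / b
  | .mod, a, b => a % b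
  | .lt, a, b => if a < b then 1 else 0
  | .eq, a, b => if a = b then 1 else 0

/-- Expressions: `get a e` is the cell of index `e` of the array `a`. -/
inductive Expr
  | lit (n : ℕ)
  | reg (x : ℕ)
  | get (a : ℕ) (e : Expr)
  | bin (o : Op) (e₁ e₂ : Expr)

def Expr.eval (s : State) : Expr → ℕ
  | .lit n => n
  | .reg x => s.reg x
  | .get a e => s.arr a (e.eval s)
  | .bin o e₁ e₂ => o.eval (e₁.eval s) (e₂.eval s)

/-- The number of steps of the evaluation of an expression. -/
def Expr.cost : Expr → ℕ
  | .lit _ => 1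
  | .reg _ => 1
  | .get _ e => e.cost + 1
  | .bin _ e₁ e₂ => e₁.cost + e₂.cost + 1

instance (n : ℕ) : OfNat Expr n := ⟨.lit n⟩
instance : Add Expr := ⟨.bin .add⟩
instance : Sub Expr := ⟨.bin .sub⟩
instance : Mul Expr := ⟨.bin .mul⟩
instance : Div Expr := ⟨.bin .div⟩
instance : Mod Expr := ⟨.bin .mod⟩

/-- Programs: `set x e` is `x ← e`, `put a i e` is `a[i] ← e`, and the tests of `ite` and `loop`
(while) succeed when the value is not `0`. -/
inductive Cmd
  | skip
  | set (x : ℕ) (e : Expr)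
  | put (a : ℕ) (i e : Expr)
  | seq (p q : Cmd)
  | ite (e : Expr) (p q : Cmd)
  | loop (e : Expr) (p : Cmd)

def State.setReg (s : State) (x v : ℕ) : State := ⟨Function.update s.reg x v, s.arr⟩

def State.setArr (s : State) (a i v : ℕ) : State :=
  ⟨s.reg, Function.update s.arr a (Function.update (s.arr a) i v)⟩

/-- `Exec p s s' t`: started in `s`, the program `p` halts in `s'` after exactly `t` steps. -/
inductive Exec : Cmd → State → State → ℕ → Prop
  | skip (s : State) : Exec .skip s s 1
  | set (x : ℕ) (e : Expr) (s : State) :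
      Exec (.set x e) s (s.setReg x (e.eval s)) (e.cost + 1)
  | put (a : ℕ) (i e : Expr) (s : State) :
      Exec (.put a i e) s (s.setArr a (i.eval s) (e.eval s)) (i.cost + e.cost + 1)
  | seq {p q : Cmd} {s s₁ s₂ : State} {t₁ t₂ : ℕ} :
      Exec p s s₁ t₁ → Exec q s₁ s₂ t₂ → Exec (.seq p q) s s₂ (t₁ + t₂)
  | iteTrue {e : Expr} {p q : Cmd} {s s₁ : State} {t : ℕ} :
      e.eval s ≠ 0 → Exec p s s₁ t → Exec (.ite e p q) s s₁ (e.cost + 1 + t)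
  | iteFalse {e : Expr} {p q : Cmd} {s s₁ : State} {t : ℕ} :
      e.eval s = 0 → Exec q s s₁ t → Exec (.ite e p q) s s₁ (e.cost + 1 + t)
  | loopTrue {e : Expr} {p : Cmd} {s s₁ s₂ : State} {t₁ t₂ : ℕ} :
      e.eval s ≠ 0 → Exec p s s₁ t₁ → Exec (.loop e p) s₁ s₂ t₂ →
        Exec (.loop e p) s s₂ (e.cost + 1 + t₁ + t₂)
  | loopFalse {e : Expr} {p : Cmd} {s : State} :
      e.eval s = 0 → Exec (.loop e p) s s (e.cost + 1)

/-- Run the programs of a list one after the other. -/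
def Cmd.block : List Cmd → Cmd
  | [] => .skip
  | p :: ps => .seq p (block ps)

/-- `for x = lo, lo + 1, …, hi do p`. -/
def Cmd.forUp (x : ℕ) (lo hi : Expr) (p : Cmd) : Cmd :=
  .seq (.set x lo) (.loop (.bin .lt (.reg x) (hi + 1)) (.seq p (.set x (.reg x + 1))))

/-! ### Names of registers and arrays

Registers below `32` and arrays below `8` belong to the calling program, apart from `rSize`, `rRank`
and `aPi`, which pass the parameters of the subroutines. -/

/-- Input: `k`. -/
abbrev rK : ℕ := 0
/-- Input: `d`. -/
abbrev rD : ℕ := 1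
/-- The rank in `Ĉ₁` that is returned by `Rank` or given to `Unrank`. -/
abbrev rM : ℕ := 2
/-- Parameter of a subroutine: the size of the symmetric group. -/
abbrev rSize : ℕ := 3
/-- Parameter of a subroutine: the rank in the complete or in the auxiliary code. -/
abbrev rRank : ℕ := 4
/-- `k!`. -/
abbrev rFact : ℕ := 5
/-- `(k/2)!`. -/
abbrev rHalf : ℕ := 6
/-- `2 ^ k`. -/
abbrev rPow : ℕ := 7
/-- The size of the auxiliary code in `S_{k+1}`. -/
abbrev rAux : ℕ := 8
/-- The size of `Ĉ₁`. -/
abbrev rTotal : ℕ := 9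
/-- A loop counter. -/
abbrev rI : ℕ := 10
/-- The position in the current window. -/
abbrev rR : ℕ := 11
/-- The index of the current window. -/
abbrev rJ : ℕ := 12
/-- The sum of the entries found so far. -/
abbrev rSum : ℕ := 13
/-- The current entry. -/
abbrev rV : ℕ := 14
/-- The element that is missing from the windows treated so far. -/
abbrev rX : ℕ := 15
/-- A local copy of the rank. -/
abbrev rAcc : ℕ := 16
/-- The codeword `σ[1, …, n]` of `Ĉ₁`. -/
abbrev aSigma : ℕ := 0
/-- Parameter of a subroutine: the codeword `π` of the complete or of the auxiliary code. -/
abbrev aPi : ℕ := 1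
/-- The local ranks `R[1, …, d]`. -/
abbrev aR : ℕ := 2

/-! ### The procedures `Rank` and `Unrank` -/

/-- Compute `k!`, the size of the auxiliary code in `S_{k+1}`, and the size of `Ĉ₁`. -/
def sizes : Cmd := .block [
  .set rFact 1,
  .forUp rI 1 (.reg rK) (.set rFact (.reg rFact * .reg rI)),
  .set rHalf 1,
  .forUp rI 1 (.reg rK / 2) (.set rHalf (.reg rHalf * .reg rI)),
  .set rPow 1,
  .forUp rI 1 (.reg rK) (.set rPow (.reg rPow * 2)),
  .ite (.bin .eq (.reg rK % 2) 0)
    (.set rAux ((.reg rFact * (.reg rFact * (.reg rK + 1))) /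
      (.reg rHalf * .reg rHalf * .reg rPow)))
    (.set rAux ((.reg rFact * (.reg rK + 1)) / .reg rK)),
  .set rTotal (.reg rFact),
  .forUp rI 1 (.reg rD - 1) (.set rTotal (.reg rTotal * .reg rAux))]

/-- `v ← α_j(v)`: the position in the initial order `d + j, 2d + j, …, (k - 1)d + j, j` of the
elements of `[n]` that are congruent to `j` modulo `d`, and `k + 1` for the other elements. -/
def alpha : Cmd :=
  .ite (.bin .eq (.reg rV % .reg rD) (.reg rJ % .reg rD))
    (.ite (.bin .lt (.reg rD) (.reg rV))
      (.set rV ((.reg rV - 1) / .reg rD))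
      (.set rV (.reg rK)))
    (.set rV (.reg rK + 1))

/-- `v ← d (v mod k) + j`: the element of `[n]` at position `v` in that order. -/
def alphaInv : Cmd := .set rV (.reg rD * (.reg rV % .reg rK) + .reg rJ)

/-- Fill `π[2, …, size]` from the window `j` and let `π[1]` be the remaining element of `[size]`. -/
def readWindow : Cmd := .block [
  .set rSum 0,
  .forUp rR 2 (.reg rSize) (.block [
    .set rV (.get aSigma (.reg rK * (.reg rJ - 1) + .reg rR)),
    alpha,
    .put aPi (.reg rR) (.reg rV),
    .set rSum (.reg rSum + .reg rV)]),
  .put aPi 1 (.reg rSize * (.reg rSize + 1) / 2 - .reg rSum)]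

/-- `Rank(σ)`, with the subroutines `RankComplete` and `RankAux`. -/
def rankProg (rankComplete rankAux : Cmd) : Cmd := .block [
  sizes,
  .set rJ (.reg rD),
  .set rSize (.reg rK),
  readWindow,
  rankComplete,
  .set rAcc ((.reg rRank + .reg rFact - 1) % .reg rFact),
  .forUp rI 1 (.reg rD - 1) (.block [
    .set rJ (.reg rD - .reg rI),
    .set rSize (.reg rK + 1),
    readWindow,
    rankAux,
    .set rAcc (.reg rAcc * .reg rAux + (.reg rRank + .reg rAux - 1) % .reg rAux)]),
  .set rM ((.reg rAcc + 1) % .reg rTotal)]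

/-- `Unrank(m)`, with the subroutines `UnrankComplete` and `UnrankAux`. -/
def unrankProg (unrankComplete unrankAux : Cmd) : Cmd := .block [
  sizes,
  .set rAcc ((.reg rM + .reg rTotal - 1) % .reg rTotal),
  .forUp rI 1 (.reg rD - 1) (.block [
    .put aR (.reg rI) ((.reg rAcc + 1) % .reg rAux),
    .set rAcc (.reg rAcc / .reg rAux)]),
  .put aR (.reg rD) ((.reg rAcc + 1) % .reg rFact),
  .set rJ (.reg rD),
  .set rSize (.reg rK),
  .set rRank (.get aR (.reg rD)),
  unrankComplete,
  .forUp rR 2 (.reg rK) (.block [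
    .set rV (.get aPi (.reg rR)),
    alphaInv,
    .put aSigma (.reg rK * (.reg rD - 1) + .reg rR) (.reg rV)]),
  .set rV (.get aPi 1),
  alphaInv,
  .set rX (.reg rV),
  .forUp rI 1 (.reg rD - 1) (.block [
    .set rJ (.reg rD - .reg rI),
    .set rSize (.reg rK + 1),
    .set rRank (.get aR (.reg rJ)),
    unrankAux,
    .forUp rR 2 (.reg rK + 1) (.block [
      .set rV (.get aPi (.reg rR)),
      .ite (.bin .eq (.reg rV) (.reg rK + 1))
        (.set rV (.reg rX))
        alphaInv,
      .put aSigma (.reg rK * (.reg rJ - 1) + .reg rR) (.reg rV)]),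
    .set rV (.get aPi 1),
    .ite (.bin .eq (.reg rV) (.reg rK + 1))
      .skip
      (.seq alphaInv (.set rX (.reg rV)))]),
  .put aSigma 1 (.reg rX)]

/-! ### Specifications -/

/-- The array `a` contains the vector notation `[σ(1), …, σ(n)]` in its cells `1, …, n`. -/
def Holds {n : ℕ} (a : ℕ → ℕ) (σ : Perm (Fin n)) : Prop :=
  ∀ i : Fin n, a (i.val + 1) = (σ i).val + 1

/-- A subroutine leaves the memory of the calling program as it was. -/
def Preserved (s s' : State) : Prop :=
  (∀ x < 32, x ≠ rSize → x ≠ rRank → s'.reg x = s.reg x) ∧ ∀ a < 8, a ≠ aPi → s'.arr a = s.arr a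

/-- The subroutine `p` ranks the code of `S_n` generated by `L` within `T` steps, whatever else the
memory contains. -/
def RanksIn (p : Cmd) (n : ℕ) (L : List ℕ) (T : ℕ) : Prop :=
  ∀ (s : State) (r : ℕ), r < L.length → s.reg rSize = n →
    Holds (s.arr aPi) (codeword 1 (1 : Perm (Fin n)) L r) →
      ∃ s' t, Exec p s s' t ∧ t ≤ T ∧ s'.reg rRank = r ∧ Preserved s s'

/-- The subroutine `p` unranks the code of `S_n` generated by `L` within `T` steps, whatever else the
memory contains. -/
def UnranksIn (p : Cmd) (n : ℕ) (L : List ℕ) (T : ℕ) : Prop :=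
  ∀ (s : State) (r : ℕ), r < L.length → s.reg rSize = n → s.reg rRank = r →
    ∃ s' t, Exec p s s' t ∧ t ≤ T ∧
      Holds (s'.arr aPi) (codeword 1 (1 : Perm (Fin n)) L r) ∧ Preserved s s'

/-- Complete codes and auxiliary codes, one for each size (given by their transition sequences), with
one ranking and one unranking subroutine for each of the two families. -/
structure Ingredients where
  comp : ℕ → List ℕ
  aux : ℕ → List ℕ
  rankComplete : Cmd
  unrankComplete : Cmd
  rankAux : Cmd
  unrankAux : Cmd

/-- `comp n` is a complete `G_↑(n, n!)` for `n ≥ 2`, `aux n` is a `G^aux_↑(n, M̂_n)` starting with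
the identity and a `t_{↑n}` transition for `n ≥ 3`, and the subroutines rank and unrank these codes
in at most `c n²` steps. -/
structure Ingredients.Valid (F : Ingredients) (c : ℕ) : Prop where
  comp_code : ∀ n, 2 ≤ n → IsPushCode n n.factorial (F.comp n)
  aux_code : ∀ n, 3 ≤ n → IsAuxCode n (auxSize n) (F.aux n)
  comp_rank : ∀ n, 2 ≤ n → RanksIn F.rankComplete n (F.comp n) (c * n ^ 2)
  comp_unrank : ∀ n, 2 ≤ n → UnranksIn F.unrankComplete n (F.comp n) (c * n ^ 2)
  aux_rank : ∀ n, 3 ≤ n → RanksIn F.rankAux n (F.aux n) (c * n ^ 2)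
  aux_unrank : ∀ n, 3 ≤ n → UnranksIn F.unrankAux n (F.aux n) (c * n ^ 2)

/-- The size of `Ĉ₁`. -/
def Ingredients.hatSize (F : Ingredients) (k d : ℕ) : ℕ :=
  (hatSeq k d (F.comp k) (F.aux (k + 1))).length

/-- The codeword of rank `m` in `Ĉ₁`. -/
def Ingredients.word (F : Ingredients) (k d m : ℕ) : Perm (Fin (k * d)) :=
  hatWord k d (F.comp k) (F.aux (k + 1)) m

/-- On every codeword of `Ĉ₁`, the procedure `Rank` halts within `T` steps and returns its rank. -/
def Ingredients.RankWithin (F : Ingredients) (k d T : ℕ) : Prop :=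
  ∀ (s : State) (m : ℕ), m < F.hatSize k d → s.reg rK = k → s.reg rD = d →
    Holds (s.arr aSigma) (F.word k d m) →
      ∃ s' t, Exec (rankProg F.rankComplete F.rankAux) s s' t ∧ t ≤ T ∧ s'.reg rM = m

/-- On every rank `m` in `Ĉ₁`, the procedure `Unrank` halts within `T` steps and returns the
codeword of rank `m`. -/
def Ingredients.UnrankWithin (F : Ingredients) (k d T : ℕ) : Prop :=
  ∀ (s : State) (m : ℕ), m < F.hatSize k d → s.reg rK = k → s.reg rD = d → s.reg rM = m →
    ∃ s' t, Exec (unrankProg F.unrankComplete F.unrankAux) s s' t ∧ t ≤ T ∧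
      Holds (s'.arr aSigma) (F.word k d m)

/-- In 1-based terms, `σ₀(j) = d (j mod k) + ⌈j / k⌉` for `j ∈ [n]`. -/
theorem sigmaZero_apply (k d : ℕ) (i : Fin (k * d)) :
    (sigmaZero k d i).val + 1 = d * ((i.val + 1) % k) + (i.val + 1 + (k - 1)) / k := by
  have hk : 0 < k := Nat.pos_of_mul_pos_right (Nat.zero_lt_of_lt i.isLt)
  obtain ⟨k, rfl⟩ : ∃ l, k = l + 1 := ⟨k - 1, by omega⟩
  have h₁ : (sigmaZero (k + 1) d i).val =
      i.val / (k + 1) + d * ((i.val % (k + 1) + 1) % (k + 1)) := by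
    simp [sigmaZero, Fin.divNat, Fin.modNat, finRotate_apply, Fin.val_add]
  have h₂ : (i.val + 1 + (k + 1 - 1)) / (k + 1) = i.val / (k + 1) + 1 := by
    rw [show i.val + 1 + (k + 1 - 1) = i.val + (k + 1) by omega, Nat.add_div_right _ (by omega)]
  rw [h₁, h₂, Nat.mod_add_mod]
  omega

/-- The machine is deterministic. -/
theorem Exec.det {p : Cmd} {s s₁ s₂ : State} {t₁ t₂ : ℕ} (h₁ : Exec p s s₁ t₁)
    (h₂ : Exec p s s₂ t₂) : s₁ = s₂ ∧ t₁ = t₂ := by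
  induction h₁ generalizing s₂ t₂ with
  | skip => cases h₂; exact ⟨rfl, rfl⟩
  | set => cases h₂; exact ⟨rfl, rfl⟩
  | put => cases h₂; exact ⟨rfl, rfl⟩
  | seq _ _ ih₁ ih₂ =>
    cases h₂ with
    | seq a b =>
      obtain ⟨rfl, rfl⟩ := ih₁ a
      obtain ⟨rfl, rfl⟩ := ih₂ b
      exact ⟨rfl, rfl⟩
  | iteTrue h _ ih =>
    cases h₂ with
    | iteTrue _ a => obtain ⟨rfl, rfl⟩ := ih a; exact ⟨rfl, rfl⟩
    | iteFalse h' _ => exact absurd h' h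
  | iteFalse h _ ih =>
    cases h₂ with
    | iteTrue h' _ => exact absurd h h'
    | iteFalse _ a => obtain ⟨rfl, rfl⟩ := ih a; exact ⟨rfl, rfl⟩
  | loopTrue h _ _ ih₁ ih₂ =>
    cases h₂ with
    | loopTrue _ a b =>
      obtain ⟨rfl, rfl⟩ := ih₁ a
      obtain ⟨rfl, rfl⟩ := ih₂ b
      exact ⟨rfl, rfl⟩
    | loopFalse h' => exact absurd h' h
  | loopFalse h =>
    cases h₂ with
    | loopTrue h' _ _ => exact absurd h h'
    | loopFalse _ => exact ⟨rfl, rfl⟩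

end RankMod

/-! The theorem splits into two independent halves: ingredients exist, and arbitrary ingredients
make both procedures correct within the stated time.

Existence. Codes are built in towers. Given a cyclic code on `k < m` elements, read each word
backwards, negate its elements modulo `m`, and take all `m` rotations of the result: `t_{↑m}` passes
from one rotation to the next, and after the last one `t_{↑m+1-j}` realises the transition `t_{↑j}`
of the smaller code (`lift_rotate`, `lift_block`). Sizes 1, 2, 3, … give the complete codes. If the
last step goes from `n - 2` to `n`, there are `n (n-2)!` words, and in each of them (after a
renaming) `n` is followed cyclically by 1; no two such words differ by a swap with `n`, which
settles even `n`. For odd `n` the sizes are 1, 3, 5, …. The words built as above then form only a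
hub, in which 1 is always followed by 2, and `m - 3` copies of it, relabelled by 3-cycles, are
spliced in. At a suitable word, `t_{↑m-2}` has the effect of `t_{↑m}` followed by a 3-cycle of the
elements; using it three times leads from the hub through two copies and back (`push_junction`,
`splice_code`). All transitions are odd, so all words are even permutations, whereas `(q, n)` is
odd.

A level is undone in linear time: the position of 1 gives the rotation and the element after it
gives the copy. As there are fewer than `n` levels, ranking and unranking are quadratic. The
distinctness of the words comes for free: a deterministic machine that recovers the rank from the
word cannot meet the same word at two ranks (`isPushCode_of_ranksIn`).

The procedures. `hatVec` is a closed form of the codewords of all levels. With `M` the size of the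
auxiliary code, a word of rank `R` shows the auxiliary codeword of rank `R mod M` in its window,
where the symbol `k + 1` stands for the first entry of the window above; beyond the window it is the
word of rank `⌈R / M⌉` of the level above. The ceiling appears because an inherited transition
performs the transition of the level above and the first auxiliary transition `t_{↑k+1}` at once
(`hatVec_step`). For `R = m + 1` the ceiling is `⌊m / M⌋ + 1`, so the local ranks are, cyclically,
the mixed-radix digits of `m` plus one. Levels further down disturb only the first position of a
window (`hatVec_add`), and that entry of the local permutation is the one missing from the others;
the residue modulo `d` tells which entries belong to the window (`alphaVal_window`). Each of the `d`
windows costs `O(k²)`. Finally `d ≥ ε k d` forces `k ≤ 1/ε`, and then `k² d = O(n)`. -/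

namespace RankMod

open Equiv

/-! ### Reasoning about programs -/

/-- Started in `s`, the program `p` halts within `T` steps in a state that satisfies `Q`. -/
def Runs (p : Cmd) (s : State) (T : ℕ) (Q : State → Prop) : Prop :=
  ∃ s' t, Exec p s s' t ∧ t ≤ T ∧ Q s'

theorem Runs.mono {p : Cmd} {s : State} {T T' : ℕ} {Q Q' : State → Prop} (h : Runs p s T Q)
    (hT : T ≤ T') (hQ : ∀ s', Q s' → Q' s') : Runs p s T' Q' := by
  obtain ⟨s', t, h₁, h₂, h₃⟩ := h
  exact ⟨s', t, h₁, h₂.trans hT, hQ s' h₃⟩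

theorem Runs.imp {p : Cmd} {s : State} {T : ℕ} {Q Q' : State → Prop} (h : Runs p s T Q)
    (hQ : ∀ s', Q s' → Q' s') : Runs p s T Q' := h.mono le_rfl hQ

theorem Runs.seq {p q : Cmd} {s : State} {T₁ T₂ : ℕ} {Q R : State → Prop} (h₁ : Runs p s T₁ Q)
    (h₂ : ∀ s', Q s' → Runs q s' T₂ R) : Runs (.seq p q) s (T₁ + T₂) R := by
  obtain ⟨s', t, e, ht, hq⟩ := h₁
  obtain ⟨s'', t', e', ht', hr⟩ := h₂ s' hq
  exact ⟨s'', t + t', .seq e e', by omega, hr⟩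

theorem Runs.skip {s : State} {T : ℕ} {Q : State → Prop} (hT : 1 ≤ T) (hQ : Q s) :
    Runs .skip s T Q := ⟨s, 1, .skip s, hT, hQ⟩

theorem Runs.set {x : ℕ} {e : Expr} {s : State} {T : ℕ} {Q : State → Prop}
    (hT : e.cost + 1 ≤ T) (hQ : Q (s.setReg x (e.eval s))) : Runs (.set x e) s T Q :=
  ⟨_, _, .set x e s, hT, hQ⟩

theorem Runs.ite {e : Expr} {p q : Cmd} {s : State} {T : ℕ} {Q : State → Prop}
    (h₁ : e.eval s ≠ 0 → Runs p s T Q) (h₂ : e.eval s = 0 → Runs q s T Q) :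
    Runs (.ite e p q) s (e.cost + 1 + T) Q := by
  by_cases h : e.eval s = 0
  · obtain ⟨s', t, a, b, c⟩ := h₂ h
    exact ⟨s', _, .iteFalse h a, by omega, c⟩
  · obtain ⟨s', t, a, b, c⟩ := h₁ h
    exact ⟨s', _, .iteTrue h a, by omega, c⟩

theorem Runs.block_nil {s : State} {T : ℕ} {Q : State → Prop} (hT : 1 ≤ T) (hQ : Q s) :
    Runs (.block []) s T Q := Runs.skip hT hQ

theorem Runs.cons {p : Cmd} {ps : List Cmd} {s : State} {T T₁ T₂ : ℕ} {Q R : State → Prop}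
    (h₁ : Runs p s T₁ Q) (hT : T₁ + T₂ ≤ T) (h₂ : ∀ s', Q s' → Runs (.block ps) s' T₂ R) :
    Runs (.block (p :: ps)) s T R :=
  (Runs.seq h₁ h₂).mono hT fun _ h => h

/-- The registers that a program may change. -/
def Cmd.regs : Cmd → List ℕ
  | .skip => []
  | .set x _ => [x]
  | .put _ _ _ => []
  | .seq p q => p.regs ++ q.regs
  | .ite _ p q => p.regs ++ q.regs
  | .loop _ p => p.regs

/-- The arrays that a program may change. -/
def Cmd.arrs : Cmd → List ℕ
  | .skip => []
  | .set _ _ => []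
  | .put a _ _ => [a]
  | .seq p q => p.arrs ++ q.arrs
  | .ite _ p q => p.arrs ++ q.arrs
  | .loop _ p => p.arrs

/-- Outside the registers `R` and the arrays `A`, the states `s` and `s'` agree. -/
structure Frame (R A : List ℕ) (s s' : State) : Prop where
  reg : ∀ x, x ∉ R → s'.reg x = s.reg x
  arr : ∀ a, a ∉ A → s'.arr a = s.arr a

theorem Frame.rfl {R A : List ℕ} {s : State} : Frame R A s s := ⟨fun _ _ => .refl _, fun _ _ => .refl _⟩

theorem Frame.trans {R A : List ℕ} {s s' s'' : State} (h : Frame R A s s') (h' : Frame R A s' s'') :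
    Frame R A s s'' :=
  ⟨fun x hx => (h'.reg x hx).trans (h.reg x hx), fun a ha => (h'.arr a ha).trans (h.arr a ha)⟩

theorem Frame.mono {R A R' A' : List ℕ} {s s' : State} (h : Frame R A s s') (hR : R ⊆ R')
    (hA : A ⊆ A') : Frame R' A' s s' :=
  ⟨fun x hx => h.reg x fun h' => hx (hR h'), fun a ha => h.arr a fun h' => ha (hA h')⟩

/-- A program writes only to the registers and arrays that its text names. Preservation of the rest
of the memory thus becomes a decidable statement about syntax, which is how it is discharged
throughout. -/
theorem Exec.frame {p : Cmd} {s s' : State} {t : ℕ} (h : Exec p s s' t) :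
    Frame p.regs p.arrs s s' := by
  induction h with
  | skip => exact .rfl
  | set x e s =>
    exact ⟨fun y hy => Function.update_of_ne (by simpa [Cmd.regs] using hy) _ _, fun _ _ => .refl _⟩
  | put a i e s =>
    exact ⟨fun _ _ => .refl _, fun b hb => Function.update_of_ne (by simpa [Cmd.arrs] using hb) _ _⟩
  | seq _ _ ih₁ ih₂ =>
    exact (ih₁.mono (List.subset_append_left _ _) (List.subset_append_left _ _)).trans
      (ih₂.mono (List.subset_append_right _ _) (List.subset_append_right _ _))
  | iteTrue _ _ ih => exact ih.mono (List.subset_append_left _ _) (List.subset_append_left _ _)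
  | iteFalse _ _ ih => exact ih.mono (List.subset_append_right _ _) (List.subset_append_right _ _)
  | loopTrue _ _ _ ih₁ ih₂ => exact ih₁.trans ih₂
  | loopFalse => exact .rfl

theorem Runs.frame {p : Cmd} {s : State} {T : ℕ} {Q : State → Prop} (h : Runs p s T Q) :
    Runs p s T fun s' => Q s' ∧ Frame p.regs p.arrs s s' := by
  obtain ⟨s', t, h₁, h₂, h₃⟩ := h
  exact ⟨s', t, h₁, h₂, h₃, h₁.frame⟩

/-- The effect of a program without loops. -/
def Cmd.run : Cmd → State → State
  | .skip, s => s
  | .set x e, s => s.setReg x (e.eval s)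
  | .put a i e, s => s.setArr a (i.eval s) (e.eval s)
  | .seq p q, s => q.run (p.run s)
  | .ite e p q, s => if e.eval s = 0 then q.run s else p.run s
  | .loop _ _, s => s

def Cmd.loopFree : Cmd → Bool
  | .skip => true
  | .set _ _ => true
  | .put _ _ _ => true
  | .seq p q => p.loopFree && q.loopFree
  | .ite _ p q => p.loopFree && q.loopFree
  | .loop _ _ => false

/-- An upper bound for the number of steps of a program without loops. -/
def Cmd.bound : Cmd → ℕ
  | .skip => 1
  | .set _ e => e.cost + 1
  | .put _ i e => i.cost + e.cost + 1
  | .seq p q => p.bound + q.bound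
  | .ite e p q => e.cost + 1 + (p.bound + q.bound)
  | .loop _ _ => 0

/-- Without loops the final state and a step bound are computable from the text, so a straight-line
piece is verified by simplifying `p.run s`. The bound charges both branches of a test, which only
costs constants. -/
theorem Runs.straight {p : Cmd} {s : State} {T : ℕ} {Q : State → Prop} (hp : p.loopFree = true)
    (hT : p.bound ≤ T) (hQ : Q (p.run s)) : Runs p s T Q := by
  suffices h : ∀ p : Cmd, p.loopFree = true → ∀ s, ∃ t, Exec p s (p.run s) t ∧ t ≤ p.bound by
    obtain ⟨t, h₁, h₂⟩ := h p hp s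
    exact ⟨_, t, h₁, h₂.trans hT, hQ⟩
  clear hp hT hQ
  intro p hp
  induction p with
  | skip => exact fun s => ⟨_, .skip s, le_rfl⟩
  | set x e => exact fun s => ⟨_, .set x e s, le_rfl⟩
  | put a i e => exact fun s => ⟨_, .put a i e s, le_rfl⟩
  | seq p q ihp ihq =>
    intro s
    simp only [Cmd.loopFree, Bool.and_eq_true] at hp
    obtain ⟨t, h₁, h₂⟩ := ihp hp.1 s
    obtain ⟨t', h₁', h₂'⟩ := ihq hp.2 (p.run s)
    exact ⟨_, .seq h₁ h₁', Nat.add_le_add h₂ h₂'⟩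
  | ite e p q ihp ihq =>
    intro s
    simp only [Cmd.loopFree, Bool.and_eq_true] at hp
    simp only [Cmd.run, Cmd.bound]
    by_cases h : e.eval s = 0
    · obtain ⟨t, h₁, h₂⟩ := ihq hp.2 s
      exact ⟨_, by rw [if_pos h]; exact .iteFalse h h₁, by omega⟩
    · obtain ⟨t, h₁, h₂⟩ := ihp hp.1 s
      exact ⟨_, by rw [if_neg h]; exact .iteTrue h h₁, by omega⟩
  | loop e p => simp [Cmd.loopFree] at hp

@[simp] theorem Expr.eval_ofNat (s : State) (n : ℕ) :
    (no_index (@OfNat.ofNat Expr n (instOfNatExpr n))).eval s = @OfNat.ofNat ℕ n (instOfNatNat n) :=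
  .refl _
@[simp] theorem Expr.eval_reg (s : State) (x : ℕ) : (Expr.reg x).eval s = s.reg x := .refl _
@[simp] theorem Expr.eval_get (s : State) (a : ℕ) (e : Expr) :
    (Expr.get a e).eval s = s.arr a (e.eval s) := .refl _
@[simp] theorem Expr.eval_add (s : State) (a b : Expr) : (a + b).eval s = a.eval s + b.eval s := .refl _
@[simp] theorem Expr.eval_sub (s : State) (a b : Expr) : (a - b).eval s = a.eval s - b.eval s := .refl _
@[simp] theorem Expr.eval_mul (s : State) (a b : Expr) : (a * b).eval s = a.eval s * b.eval s := .refl _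
@[simp] theorem Expr.eval_div (s : State) (a b : Expr) : (a / b).eval s = a.eval s / b.eval s := .refl _
@[simp] theorem Expr.eval_mod (s : State) (a b : Expr) : (a % b).eval s = a.eval s % b.eval s := .refl _
@[simp] theorem Expr.eval_lt (s : State) (a b : Expr) :
    (Expr.bin .lt a b).eval s = if a.eval s < b.eval s then 1 else 0 := .refl _
@[simp] theorem Expr.eval_eq (s : State) (a b : Expr) :
    (Expr.bin .eq a b).eval s = if a.eval s = b.eval s then 1 else 0 := .refl _

@[simp] theorem State.setReg_reg (s : State) (x v y : ℕ) :
    (s.setReg x v).reg y = if y = x then v else s.reg y := by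
  simp [State.setReg, Function.update_apply]
@[simp] theorem State.setReg_arr (s : State) (x v : ℕ) : (s.setReg x v).arr = s.arr := .refl _
@[simp] theorem State.setArr_reg (s : State) (a i v : ℕ) : (s.setArr a i v).reg = s.reg := .refl _
@[simp] theorem State.setArr_arr (s : State) (a i v b j : ℕ) :
    (s.setArr a i v).arr b j = if b = a ∧ j = i then v else s.arr b j := by
  by_cases h : b = a
  · subst h; simp [State.setArr, Function.update_apply]
  · simp [State.setArr, h]

/-- The rule for `for` loops: `I i` is the invariant at the beginning of the round `i`. -/
theorem Runs.forUp {x : ℕ} {lo hi : Expr} {p : Cmd} {s : State} {T N a b : ℕ}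
    {I : ℕ → State → Prop} (hlo : lo.eval s = a) (h₀ : I a (s.setReg x a))
    (hN : b + 1 - a ≤ N) (hab : a ≤ b + 1)
    (hhi : ∀ i s', a ≤ i → i ≤ b + 1 → s'.reg x = i → I i s' → hi.eval s' = b)
    (step : ∀ i s', a ≤ i → i ≤ b → s'.reg x = i → I i s' →
      Runs p s' T fun s'' => s''.reg x = i ∧ I (i + 1) (s''.setReg x (i + 1))) :
    Runs (.forUp x lo hi p) s (N * (T + hi.cost + 9) + lo.cost + hi.cost + 6) (I (b + 1)) := by
  -- A round costs `hi.cost + 5` for the test, at most `T` for the body and `4` for the increment;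
  -- the failing test at the end costs `hi.cost + 5` once more.
  have key : ∀ n i s', n = b + 1 - i → a ≤ i → i ≤ b + 1 → s'.reg x = i → I i s' →
      Runs (.loop (.bin .lt (.reg x) (hi + 1)) (.seq p (.set x (.reg x + 1)))) s'
        (n * (T + hi.cost + 9) + hi.cost + 5) (I (b + 1)) := by
    intro n
    have hcost : (Expr.bin .lt (.reg x) (hi + 1)).cost = hi.cost + 4 := by
      change 1 + (hi.cost + 1 + 1) + 1 = _
      omega
    induction n with
    | zero =>
      intro i s' hn ha hb hx hI
      have hi' := hhi i s' ha hb hx hI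
      obtain rfl : i = b + 1 := by omega
      refine ⟨s', _, .loopFalse ?_, ?_, hI⟩
      · simp [hx, hi']
      · rw [hcost]; omega
    | succ n ih =>
      intro i s' hn ha hb hx hI
      have hi' := hhi i s' ha hb hx hI
      obtain ⟨s₁, t₁, e₁, ht₁, hx₁, hI₁⟩ := step i s' ha (by omega) hx hI
      obtain ⟨s₂, t₂, e₂, ht₂, hI₂⟩ := ih (i + 1) (s₁.setReg x (i + 1)) (by omega) (by omega)
        (by omega) (by simp) hI₁
      have e₃ : Exec (.set x (.reg x + 1)) s₁ (s₁.setReg x (i + 1)) 4 := by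
        have := Exec.set x (.reg x + 1) s₁
        simp only [Expr.eval_add, Expr.eval_reg, hx₁, Expr.eval_ofNat] at this
        exact this
      refine ⟨s₂, _, .loopTrue ?_ (.seq e₁ e₃) e₂, ?_, hI₂⟩
      · simp [hx, hi']; omega
      · rw [hcost, Nat.add_mul]; omega
  have e₀ := Exec.set x lo s
  rw [hlo] at e₀
  obtain ⟨s₂, t₂, e₂, ht₂, hI₂⟩ := key _ a (s.setReg x a) (Eq.refl _) le_rfl hab (by simp) h₀
  refine ⟨s₂, _, .seq e₀ e₂, ?_, hI₂⟩
  have := Nat.mul_le_mul_right (T + hi.cost + 9) hN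
  omega

/-- The rule for `for` loops, with what the syntax of the body guarantees. -/
theorem Runs.forUp_frame {x : ℕ} {lo hi : Expr} {p : Cmd} {s : State} {T N a b : ℕ}
    {I : ℕ → State → Prop} (hlo : lo.eval s = a) (hx : x ∉ p.regs)
    (hI : ∀ i s' v, I i s' → I i (s'.setReg x v)) (h₀ : I a s)
    (hN : b + 1 - a ≤ N) (hab : a ≤ b + 1)
    (hhi : ∀ s', Frame (x :: p.regs) p.arrs s s' → hi.eval s' = b)
    (step : ∀ i s', a ≤ i → i ≤ b → s'.reg x = i → Frame (x :: p.regs) p.arrs s s' → I i s' →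
      Runs p s' T (I (i + 1))) :
    Runs (.forUp x lo hi p) s (N * (T + hi.cost + 9) + lo.cost + hi.cost + 6)
      fun s' => I (b + 1) s' ∧ Frame (x :: p.regs) p.arrs s s' := by
  have hset : ∀ (s' : State) v, Frame (x :: p.regs) p.arrs s s' →
      Frame (x :: p.regs) p.arrs s (s'.setReg x v) := fun s' v h =>
    ⟨fun y hy => by
      rw [State.setReg_reg, if_neg fun h' : y = x => hy (h' ▸ List.mem_cons_self), h.reg y hy],
      fun a ha => h.arr a ha⟩
  refine Runs.forUp (I := fun i s' => I i s' ∧ Frame (x :: p.regs) p.arrs s s') hlo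
    ⟨hI _ _ _ h₀, hset _ _ .rfl⟩ hN hab (fun i s' _ _ _ h => hhi s' h.2) ?_
  intro i s' h₁ h₂ h₃ h₄
  refine (step i s' h₁ h₂ h₃ h₄.2 h₄.1).frame.imp fun s'' h => ⟨?_, hI _ _ _ h.1, hset _ _ ?_⟩
  · rw [h.2.reg x hx, h₃]
  · exact h₄.2.trans (h.2.mono (List.subset_cons_self _ _) (List.Subset.refl _))

/-! ### Pushes in terms of positions -/

/-- The (0-based) position from which `t_{i↑j}` takes the entry at position `p`. -/
def pushPos (i j p : ℕ) : ℕ :=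
  if p + 1 = i then j - 1 else if i ≤ p ∧ p < j then p - 1 else p

/-- Turns multiplication by an inverse cycle into a substitution of positions. Afterwards words are
plain functions on `ℕ`, and facts about pushes are case distinctions in linear arithmetic. -/
theorem push_apply {n i j : ℕ} (h : 1 ≤ i ∧ i < j ∧ j ≤ n) (σ : Perm (Fin n)) (p q : Fin n)
    (hq : q.val = pushPos i j p) : push i j σ p = σ q := by
  have : NeZero n := ⟨by omega⟩
  rw [push, dif_pos h, Perm.mul_apply]
  congr 1
  rw [Perm.inv_eq_iff_eq]
  unfold pushPos at hq
  split_ifs at hq with h₁ h₂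
  · have : q = ⟨j - 1, by omega⟩ := Fin.ext hq
    rw [this, Fin.cycleIcc_of_last (by simp only [Fin.mk_le_mk]; omega)]
    ext; simp; omega
  · rw [Fin.cycleIcc_of_ge_of_lt (by simp only [Fin.le_def]; omega) (by simp only [Fin.lt_def]; omega)]
    ext
    rw [Fin.val_add_one_of_lt' (by omega)]
    omega
  · rcases Nat.lt_or_ge p.val i with h₃ | h₃
    · rw [Fin.cycleIcc_of_lt (by simp only [Fin.lt_def]; omega)]
      exact Fin.ext hq.symm
    · rw [Fin.cycleIcc_of_gt (by simp only [Fin.lt_def]; omega)]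
      exact Fin.ext hq.symm

theorem pushPos_lt {n i j p : ℕ} (h : i < j ∧ j ≤ n) (hp : p < n) : pushPos i j p < n := by
  unfold pushPos; split_ifs <;> omega

theorem pushPos_injective {i j : ℕ} (h : 1 ≤ i ∧ i ≤ j) : Function.Injective (pushPos i j) := by
  intro a b hab
  unfold pushPos at hab
  split_ifs at hab <;> omega

/-- The vector `f` (indexed from `0`) is the permutation `σ`. -/
def IsVec {n : ℕ} (f : ℕ → ℕ) (σ : Perm (Fin n)) : Prop := ∀ p : Fin n, (σ p).val = f p

theorem IsVec.push {n i j : ℕ} (h : 1 ≤ i ∧ i < j ∧ j ≤ n) {f g : ℕ → ℕ} {σ : Perm (Fin n)}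
    (hf : IsVec f σ) (hg : ∀ p < n, g p = f (pushPos i j p)) : IsVec g (push i j σ) := fun p => by
  rw [push_apply h σ p ⟨pushPos i j p, pushPos_lt h.2 p.isLt⟩ rfl, hf, hg p p.isLt]

theorem codeword_zero {n : ℕ} (i : ℕ) (σ : Perm (Fin n)) (L : List ℕ) : codeword i σ L 0 = σ := by
  simp [codeword]

theorem codeword_succ {n : ℕ} (i : ℕ) (σ : Perm (Fin n)) (L : List ℕ) {r : ℕ} (hr : r < L.length) :
    codeword i σ L (r + 1) = push i L[r] (codeword i σ L r) := by
  rw [codeword, codeword, List.take_add_one, List.getElem?_eq_getElem hr, List.foldl_append]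
  rfl

/-- The codewords of the transition sequence `L` are the vectors `W r`. -/
theorem isVec_codeword {n i : ℕ} {σ : Perm (Fin n)} {L : List ℕ} {W : ℕ → ℕ → ℕ}
    (hi : 1 ≤ i) (hL : ∀ j ∈ L, i < j ∧ j ≤ n) (h₀ : IsVec (W 0) σ)
    (h : ∀ r (hr : r < L.length), ∀ p < n, W (r + 1) p = W r (pushPos i L[r] p)) :
    ∀ r ≤ L.length, IsVec (W r) (codeword i σ L r) := by
  intro r
  induction r with
  | zero => intro _; rwa [codeword_zero]
  | succ r ih =>
    intro hr
    rw [codeword_succ i σ L hr]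
    exact (ih (by omega)).push ⟨hi, hL _ (List.getElem_mem hr)⟩ (h r hr)

theorem holds_iff {n : ℕ} (a f : ℕ → ℕ) (σ : Perm (Fin n)) (h : IsVec f σ) :
    Holds a σ ↔ ∀ p < n, a (p + 1) = f p + 1 := by
  constructor
  · intro h' p hp
    rw [h' ⟨p, hp⟩, h]
  · intro h' p
    rw [h' p p.isLt, h]

/-- For odd `j` the push multiplies by a cycle of odd length, which is an even permutation. -/
theorem sign_push {n j : ℕ} (hj : j % 2 = 1) (σ : Perm (Fin n)) :
    Perm.sign (push 1 j σ) = Perm.sign σ := by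
  unfold push
  split_ifs with h
  · have : NeZero n := ⟨by omega⟩
    rw [Perm.sign_mul, Perm.sign_inv, Fin.sign_cycleIcc_of_le (by simp only [Fin.mk_le_mk]; omega)]
    have : Even (j - 1 - (1 - 1)) := by rw [Nat.even_iff]; omega
    simp only [this.neg_one_pow, mul_one]
  · rfl

theorem sign_codeword {n : ℕ} {L : List ℕ} (hL : ∀ j ∈ L, j % 2 = 1) :
    ∀ r ≤ L.length, Perm.sign (codeword 1 (1 : Perm (Fin n)) L r) = 1 := by
  intro r
  induction r with
  | zero => intro _; rw [codeword_zero, Perm.sign_one]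
  | succ r ih =>
    intro hr
    rw [codeword_succ _ _ L hr, sign_push (hL _ (List.getElem_mem hr)), ih (by omega)]

/-! ### One level of the construction

From a code on fewer elements with words `f`, the words `lift m f s`, `s < m`, are the rotations of
one word of length `m`; all of these form the hub. Then `μ` pairs of relabelled copies of the hub are
spliced into it. -/

/-- The word is read backwards from position `s`, cyclically, and its elements are negated modulo
`m`. The reversal makes a lower push appear at the far end, where it combines with a rotation into a
single push. -/
def lift (m : ℕ) (f : ℕ → ℕ) (s p : ℕ) : ℕ :=
  if p < m then (m - f ((m + s - p) % m)) % m else p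

/-- The `3`-cycle `2 ↦ q ↦ o ↦ 2`, or the identity if `q = o = 2`. -/
def rotThree (q o v : ℕ) : ℕ := if v = 2 then q else if v = q then o else if v = o then 2 else v

/-- The number of the copy of the hub to which the rank `r` belongs; `0` is the hub itself. -/
def copyOf (m μ L r : ℕ) : ℕ :=
  if (r + 4) / (2 * m + 2 * L) < μ ∧ 2 * m ≤ (r + 4) % (2 * m + 2 * L) then
    1 + ((r + 4) % (2 * m + 2 * L) - 2 * m) / L
  else 0

/-- The index of the pair of copies of the hub at rank `r`. -/
def pairOf (m L r : ℕ) : ℕ := (r + 4) / (2 * m + 2 * L)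

/-- The rank within the copy of the hub. -/
def hubOf (m μ L r : ℕ) : ℕ :=
  if (r + 4) / (2 * m + 2 * L) < μ ∧ 2 * m ≤ (r + 4) % (2 * m + 2 * L) then
    (2 * m * ((r + 4) / (2 * m + 2 * L)) + (r + 4) % (2 * m + 2 * L) - 4) % L
  else r - 2 * L * min ((r + 4) / (2 * m + 2 * L)) μ

/-- Does the code pass from one copy of the hub to another after rank `r`? -/
def IsJunction (m μ L r : ℕ) : Prop :=
  (r + 4) / (2 * m + 2 * L) < μ ∧ ((r + 4) % (2 * m + 2 * L) + 1 = 2 * m ∨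
    (r + 4) % (2 * m + 2 * L) + 1 = 2 * m + L ∨ (r + 4) % (2 * m + 2 * L) + 1 = 2 * m + 2 * L)

instance (m μ L r : ℕ) : Decidable (IsJunction m μ L r) := by
  unfold IsJunction; infer_instance

/-- The inverse of `copyOf`, `pairOf` and `hubOf`. -/
def rankOf (m μ L c i h : ℕ) : ℕ :=
  if c = 0 then h + 2 * L * min μ ((h + 4) / (2 * m))
  else (2 * m + 2 * L) * i + 2 * m + (c - 1) * L + (h + 4 + L - 2 * m * (i + 1)) % L - 4

def elemQ (m c i : ℕ) : ℕ := if c = 0 then 2 else if c = 1 then 4 + 2 * i else (5 + 2 * i) % m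

def elemO (m c i : ℕ) : ℕ := if c = 0 then 2 else if c = 1 then (5 + 2 * i) % m else 4 + 2 * i

theorem sub_mod_of_lt {m s p : ℕ} (hp : p < m) (hs : s < m) :
    (m + s - p) % m = if p ≤ s then s - p else m + s - p := by
  split_ifs with h
  · rw [show m + s - p = s - p + m by omega, Nat.add_mod_right, Nat.mod_eq_of_lt (by omega)]
  · rw [Nat.mod_eq_of_lt (by omega)]

/-- The value depends on `s - p` modulo `m` only, and `t_{↑m}` lowers positions cyclically by one.
-/
theorem lift_rotate {m s : ℕ} (f : ℕ → ℕ) (hs : s + 1 < m) (p : ℕ) :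
    lift m f (s + 1) p = lift m f s (pushPos 1 m p) := by
  unfold lift
  by_cases hp : p < m
  · have h : pushPos 1 m p < m := pushPos_lt ⟨by omega, le_rfl⟩ hp
    rw [if_pos hp, if_pos h, sub_mod_of_lt hp hs, sub_mod_of_lt h (by omega)]
    congr 3
    unfold pushPos
    split_ifs <;> omega
  · have h : pushPos 1 m p = p := by unfold pushPos; split_ifs <;> omega
    rw [h, if_neg hp, if_neg hp]

/-- A full rotation by `t_{↑m}` would restore the old word. Pushing from `m + 1 - j` instead leaves
the last `j - 1` entries in place; after the reversal this is exactly the effect of `t_{↑j}` on the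
lower word. -/
theorem lift_block {m j : ℕ} {f g : ℕ → ℕ} (hj : 1 ≤ j ∧ j < m)
    (hg : ∀ p, g p = f (pushPos 1 j p)) (p : ℕ) :
    lift m g 0 p = lift m f (m - 1) (pushPos 1 (m + 1 - j) p) := by
  unfold lift
  by_cases hp : p < m
  · have h : pushPos 1 (m + 1 - j) p < m := pushPos_lt ⟨by omega, by omega⟩ hp
    rw [if_pos hp, if_pos h, sub_mod_of_lt hp (by omega), sub_mod_of_lt h (by omega), hg]
    congr 3
    unfold pushPos
    split_ifs <;> omega
  · have h : pushPos 1 (m + 1 - j) p = p := by unfold pushPos; split_ifs <;> omega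
    rw [h, if_neg hp, if_neg hp]

theorem lift_id {m : ℕ} {f : ℕ → ℕ} (hf : ∀ p, f p = p) {s p : ℕ} (hs : s < m) (hp : p < m) :
    lift m f s p = (m + p - s) % m := by
  unfold lift
  rw [if_pos hp, hf, sub_mod_of_lt hp hs, sub_mod_of_lt hs hp]
  split_ifs with h₁ h₂ h₂
  · have : s = p := by omega
    simp [this]
  · rw [Nat.mod_eq_of_lt (by omega)]; omega
  · rw [Nat.mod_eq_of_lt (by omega)]; omega
  · omega

theorem rotThree_two (v : ℕ) : rotThree 2 2 v = v := by
  unfold rotThree; split_ifs <;> omega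

/-- The ranks in the hub. -/
theorem hub_facts {m μ L h i : ℕ} (hm : 0 < m) (hi : i ≤ μ) (h₁ : 2 * m * i ≤ h + 4)
    (h₂ : i < μ → h + 4 < 2 * m * (i + 1)) :
    copyOf m μ L (h + 2 * L * i) = 0 ∧ hubOf m μ L (h + 2 * L * i) = h ∧
      (IsJunction m μ L (h + 2 * L * i) ↔ i < μ ∧ h + 5 = 2 * m * (i + 1)) := by
  have e : h + 2 * L * i + 4 = (h + 4 - 2 * m * i) + (2 * m + 2 * L) * i := by
    rw [Nat.add_mul]; omega
  unfold copyOf hubOf IsJunction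
  rcases Nat.lt_or_ge i μ with hlt | hge
  · have h₃ := h₂ hlt
    rw [Nat.mul_add, Nat.mul_one] at h₃
    have e₁ : (h + 2 * L * i + 4) / (2 * m + 2 * L) = i := by
      rw [e, Nat.add_mul_div_left _ _ (by omega), Nat.div_eq_of_lt (by omega), Nat.zero_add]
    have e₂ : (h + 2 * L * i + 4) % (2 * m + 2 * L) = h + 4 - 2 * m * i := by
      rw [e, Nat.add_mul_mod_self_left, Nat.mod_eq_of_lt (by omega)]
    rw [e₁, e₂, if_neg (by omega), if_neg (by omega), min_eq_left hi, Nat.mul_add, Nat.mul_one]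
    refine ⟨rfl, by omega, ?_⟩
    rcases Nat.eq_zero_or_pos L with hL | hL <;> omega
  · obtain rfl : i = μ := by omega
    have e₁ : i ≤ (h + 2 * L * i + 4) / (2 * m + 2 * L) := by
      rw [Nat.le_div_iff_mul_le (by omega), e, Nat.mul_comm]; omega
    rw [if_neg (by omega), if_neg (by omega), min_eq_right e₁]
    refine ⟨rfl, by omega, ?_⟩
    constructor
    · intro h; omega
    · intro h; omega

/-- The ranks outside the hub. -/
theorem copy_facts {m μ L r i x : ℕ} (hi : i < μ) (hx : x < 2 * L)
    (hr : r + 4 = (2 * m + 2 * L) * i + 2 * m + x) :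
    copyOf m μ L r = 1 + x / L ∧ pairOf m L r = i ∧ hubOf m μ L r = (2 * m * (i + 1) + x - 4) % L ∧
      (IsJunction m μ L r ↔ x + 1 = L ∨ x + 1 = 2 * L) := by
  have e₁ : (r + 4) / (2 * m + 2 * L) = i := by
    rw [hr, Nat.add_assoc, Nat.mul_add_div (by omega), Nat.div_eq_of_lt (by omega), Nat.add_zero]
  have e₂ : (r + 4) % (2 * m + 2 * L) = 2 * m + x := by
    rw [hr, Nat.add_assoc, Nat.mul_add_mod, Nat.mod_eq_of_lt (by omega)]
  unfold copyOf pairOf hubOf IsJunction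
  rw [e₁, e₂, if_pos ⟨hi, by omega⟩, if_pos ⟨hi, by omega⟩, Nat.add_sub_cancel_left]
  refine ⟨rfl, rfl, ?_, ?_⟩
  · rw [Nat.mul_add, Nat.mul_one, Nat.add_assoc]
  · omega

/-- Either `i` pairs of copies have been passed and the rank lies in the hub, or the rank lies at
offset `x` in the `i`-th pair. The shift by 4 aligns the junctions with multiples of `2 * m` in the
hub. -/
theorem rank_cases {m : ℕ} (μ L r : ℕ) (hm : 2 ≤ m) :
    (∃ i h, r = h + 2 * L * i ∧ i ≤ μ ∧ 2 * m * i ≤ h + 4 ∧ (i < μ → h + 4 < 2 * m * (i + 1))) ∨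
    ∃ i x, i < μ ∧ x < 2 * L ∧ r + 4 = (2 * m + 2 * L) * i + 2 * m + x := by
  have hQ : 0 < 2 * m + 2 * L := by omega
  have hd := Nat.div_add_mod (r + 4) (2 * m + 2 * L)
  have hlt := Nat.mod_lt (r + 4) hQ
  -- Guards the truncated subtraction: the shift by 4 is harmless since either no pair has been
  -- passed or the hub part is already at least 4.
  have hge : ∀ i, 2 * m * i = 0 ∧ 2 * L * i = 0 ∨ 4 ≤ 2 * m * i := fun i => by
    rcases Nat.eq_zero_or_pos i with h | h
    · left; simp [h]
    · right
      have := Nat.mul_le_mul_left (2 * m) h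
      omega
  set i := (r + 4) / (2 * m + 2 * L)
  set ρ := (r + 4) % (2 * m + 2 * L)
  rcases Nat.lt_or_ge i μ with h | h
  · rcases Nat.lt_or_ge ρ (2 * m) with h' | h'
    · left
      rw [Nat.add_mul] at hd
      have := hge i
      refine ⟨i, r - 2 * L * i, by omega, h.le, by omega, fun _ => ?_⟩
      rw [Nat.mul_add, Nat.mul_one]
      omega
    · exact .inr ⟨i, ρ - 2 * m, h, by omega, by omega⟩
  · left
    have h₁ : (2 * m + 2 * L) * μ ≤ (2 * m + 2 * L) * i := Nat.mul_le_mul_left _ h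
    rw [Nat.add_mul] at h₁
    have := hge μ
    exact ⟨μ, r - 2 * L * μ, by omega, le_rfl, by omega, fun h => absurd h (by omega)⟩

theorem rankOf_eq {m μ L r : ℕ} (hm : 2 ≤ m) (hL : 2 * m * μ ≤ L) :
    rankOf m μ L (copyOf m μ L r) (pairOf m L r) (hubOf m μ L r) = r := by
  rcases rank_cases μ L r hm with ⟨i, h, rfl, hi, h₁, h₂⟩ | ⟨i, x, hi, hx, hr⟩
  · obtain ⟨e₁, e₂, -⟩ := hub_facts (L := L) (by omega) hi h₁ h₂
    rw [e₁, e₂, rankOf, if_pos rfl]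
    congr 2
    rcases Nat.lt_or_ge i μ with h₃ | h₃
    · have h₄ := h₂ h₃
      rw [Nat.mul_comm, ← Nat.div_lt_iff_lt_mul (by omega)] at h₄
      rw [Nat.mul_comm, ← Nat.le_div_iff_mul_le (by omega)] at h₁
      omega
    · rw [Nat.mul_comm, ← Nat.le_div_iff_mul_le (by omega)] at h₁
      omega
  · obtain ⟨e₁, e₂, e₃, -⟩ := copy_facts hi hx hr
    have h₁ : 2 * m * (i + 1) ≤ 2 * m * μ := Nat.mul_le_mul_left _ hi
    have h₂ : 4 ≤ 2 * m * (i + 1) := by rw [Nat.mul_add]; omega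
    have hL₀ : 0 < L := by omega
    rw [e₁, e₂, e₃, rankOf, if_neg (Nat.add_comm 1 _ ▸ Nat.succ_ne_zero _), Nat.add_sub_cancel_left]
    -- The summand `L` keeps the subtraction of `2 * m * (i + 1)` from truncating, because `2 * m *
    -- μ ≤ L`.
    have e₄ : ((2 * m * (i + 1) + x - 4) % L + 4 + L - 2 * m * (i + 1)) % L = x % L := by
      have h₃ := Nat.div_add_mod (2 * m * (i + 1) + x - 4) L
      set a := (2 * m * (i + 1) + x - 4) % L
      set b := (2 * m * (i + 1) + x - 4) / L
      have : a + 4 + L - 2 * m * (i + 1) + L * b = x + L * 1 := by omega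
      rw [← Nat.add_mul_mod_self_left _ L b, this, Nat.add_mul_mod_self_left]
    have e₅ := Nat.div_add_mod' x L
    rw [e₄]
    omega

theorem hubOf_lt {m μ L r : ℕ} (hm : 2 ≤ m) (hL : 2 * m * μ ≤ L) (hr : r < L * (1 + 2 * μ)) :
    hubOf m μ L r < L := by
  rw [Nat.mul_add, Nat.mul_one] at hr
  rcases rank_cases μ L r hm with ⟨i, h, rfl, hi, h₁, h₂⟩ | ⟨i, x, hi, hx, hr⟩
  · obtain ⟨-, e₂, -⟩ := hub_facts (L := L) (by omega) hi h₁ h₂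
    rw [e₂]
    rcases Nat.lt_or_ge i μ with h₃ | h₃
    · have h₄ := h₂ h₃
      have h₅ : 2 * m * (i + 1) ≤ 2 * m * μ := Nat.mul_le_mul_left _ h₃
      omega
    · obtain rfl : i = μ := by omega
      have : 2 * L * i = L * (2 * i) := by ring
      omega
  · rw [(copy_facts hi hx hr).2.2.1]
    exact Nat.mod_lt _ (by omega)

theorem copyOf_le {m μ L r : ℕ} (hm : 2 ≤ m) : copyOf m μ L r ≤ 2 := by
  rcases rank_cases μ L r hm with ⟨i, h, rfl, hi, h₁, h₂⟩ | ⟨i, x, hi, hx, hr⟩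
  · rw [(hub_facts (L := L) (by omega) hi h₁ h₂).1]; omega
  · rw [(copy_facts hi hx hr).1]
    have : x / L < 2 := Nat.div_lt_of_lt_mul (by omega)
    omega

theorem copyOf_eq_zero_or {m μ L r : ℕ} (hm : 2 ≤ m) : copyOf m μ L r = 0 ∨ pairOf m L r < μ := by
  rcases rank_cases μ L r hm with ⟨i, h, rfl, hi, h₁, h₂⟩ | ⟨i, x, hi, hx, hr⟩
  · exact .inl (hub_facts (L := L) (by omega) hi h₁ h₂).1
  · exact .inr ((copy_facts hi hx hr).2.1 ▸ hi)

/-! ### Towers of codes -/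

/-- The level `b + 1` has words of length `size (b + 1)` and consists of a hub and `pairs (b + 1)`
pairs of copies of it; the hub is built from the level `b`. -/
structure Tower where
  size : ℕ → ℕ
  pairs : ℕ → ℕ

namespace Tower

variable (t : Tower)

/-- The number of words of a level. -/
def card : ℕ → ℕ
  | 0 => 1
  | b + 1 => t.size (b + 1) * card b * (1 + 2 * t.pairs (b + 1))

/-- The number of words of the hub of the level `b + 1`. -/
def hubCard (b : ℕ) : ℕ := t.size (b + 1) * t.card b

/-- The rank in the hub that underlies the rank `r` of the level `b + 1`. -/
def hub (b r : ℕ) : ℕ := hubOf (t.size (b + 1)) (t.pairs (b + 1)) (t.hubCard b) r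

def copy (b r : ℕ) : ℕ := copyOf (t.size (b + 1)) (t.pairs (b + 1)) (t.hubCard b) r

def pair (b r : ℕ) : ℕ := pairOf (t.size (b + 1)) (t.hubCard b) r

/-- The word of rank `r` of a level, as a vector of natural numbers. -/
def word : ℕ → ℕ → ℕ → ℕ
  | 0, _, p => p
  | b + 1, r, p =>
    if p < t.size (b + 1) then
      rotThree (elemQ (t.size (b + 1)) (t.copy b r) (t.pair b r))
        (elemO (t.size (b + 1)) (t.copy b r) (t.pair b r))
        (lift (t.size (b + 1)) (word b (t.hub b r / t.size (b + 1))) (t.hub b r % t.size (b + 1)) p)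
    else p

/-- The transition after the word of rank `h` of the hub, given the transition of the level below. -/
def hubTrans (m j h : ℕ) : ℕ := if h % m + 1 < m then m else m + 1 - j

/-- The transition after the word of rank `r`. -/
def trans : ℕ → ℕ → ℕ
  | 0, _ => 1
  | b + 1, r =>
    if IsJunction (t.size (b + 1)) (t.pairs (b + 1)) (t.hubCard b) r then t.size (b + 1) - 2
    else hubTrans (t.size (b + 1)) (trans b (t.hub b r / t.size (b + 1))) (t.hub b r)

/-- The conditions under which the first `n` levels are cyclic codes. -/
structure Valid (n : ℕ) : Prop where
  size_zero : t.size 0 = 1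
  size_lt : ∀ b < n, t.size b < t.size (b + 1)
  pairs : ∀ b < n, t.pairs (b + 1) = 0 ∨
    t.size (b + 1) = 2 * t.pairs (b + 1) + 3 ∧ t.size (b + 1) = t.size b + 2

/-- A cyclic code of length `N` with words `w` and transitions `j` of the elements below `m`. -/
structure IsCode (m N : ℕ) (w : ℕ → ℕ → ℕ) (j : ℕ → ℕ) : Prop where
  one_le : 1 ≤ m
  le : m ≤ N
  zero : ∀ p, w 0 p = p
  last : ∀ p, w N p = p
  fix : ∀ r p, m ≤ p → w r p = p
  lt : ∀ r p, p < m → w r p < m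
  rot : ∀ r < m, ∀ p < m, w r p = (m + p - r) % m
  range : ∀ r, 1 ≤ j r ∧ j r ≤ m
  step : ∀ r < N, ∀ p, w (r + 1) p = w r (pushPos 1 (j r) p)

theorem IsCode.injective {m N : ℕ} {w : ℕ → ℕ → ℕ} {j : ℕ → ℕ} (h : IsCode m N w j) :
    ∀ r ≤ N, Function.Injective (w r) := by
  intro r
  induction r with
  | zero => intro _ a b hab; rwa [h.zero, h.zero] at hab
  | succ r ih =>
    intro hr a b hab
    rw [h.step r hr, h.step r hr] at hab
    exact pushPos_injective ⟨le_rfl, (h.range r).1⟩ (ih (by omega) hab)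

/-! ### The hub: all rotations of the words of the level below -/

section Hub

variable {m k N : ℕ} {w : ℕ → ℕ → ℕ} {j : ℕ → ℕ}

theorem lift_lt {f : ℕ → ℕ} {s p : ℕ} (hp : p < m) : lift m f s p < m := by
  unfold lift
  rw [if_pos hp]
  exact Nat.mod_lt _ (by omega)

/-- The hub consists of blocks of `m` ranks: a block rotates one word, and the passage to the next
block advances the lower code by one step. -/
theorem hub_step (h : IsCode k N w j) (hk : k < m) {r : ℕ} (hr : r < m * N) (p : ℕ) :
    lift m (w ((r + 1) / m)) ((r + 1) % m) p =
      lift m (w (r / m)) (r % m) (pushPos 1 (hubTrans m (j (r / m)) r) p) := by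
  have hd := Nat.div_add_mod r m
  have hlt := Nat.mod_lt r (show m > 0 by omega)
  have hq : r / m < N := Nat.div_lt_of_lt_mul hr
  unfold hubTrans
  set q := r / m
  set s := r % m
  split_ifs with hs
  · rw [← hd, Nat.add_assoc, Nat.mul_add_div (by omega), Nat.mul_add_mod, Nat.div_eq_of_lt hs,
      Nat.mod_eq_of_lt hs]
    exact lift_rotate _ hs p
  · have hs' : s = m - 1 := by omega
    have e : r + 1 = m * (q + 1) := by rw [Nat.mul_add]; omega
    rw [e, Nat.mul_mod_right, Nat.mul_div_cancel_left _ (by omega), hs']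
    exact lift_block ⟨(h.range q).1, by have := (h.range q).2; omega⟩ (h.step q hq) p

theorem hub_code (h : IsCode k N w j) (hk : k < m) :
    IsCode m (m * N) (fun r => lift m (w (r / m)) (r % m))
      (fun r => hubTrans m (j (r / m)) r) where
  one_le := by omega
  le := Nat.le_mul_of_pos_right _ (by have := h.one_le; have := h.le; omega)
  zero p := by
    by_cases hp : p < m
    · rw [Nat.zero_div, Nat.zero_mod, lift_id h.zero (by omega) hp, Nat.sub_zero,
        Nat.add_mod_left, Nat.mod_eq_of_lt hp]
    · rw [lift, if_neg hp]
  last p := by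
    by_cases hp : p < m
    · rw [Nat.mul_mod_right, Nat.mul_div_cancel_left _ (by omega), lift_id h.last (by omega) hp,
        Nat.sub_zero, Nat.add_mod_left, Nat.mod_eq_of_lt hp]
    · rw [lift, if_neg hp]
  fix r p hp := by simp only [lift]; rw [if_neg (by omega)]
  lt r p hp := lift_lt hp
  rot r hr p hp := by
    rw [Nat.div_eq_of_lt hr, Nat.mod_eq_of_lt hr, lift_id h.zero hr hp]
  range r := by
    have := h.range (r / m)
    simp only [hubTrans]
    split_ifs <;> omega
  step r hr p := hub_step h hk hr p

/-- The word of the hub before the `i`-th junction. -/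
theorem hub_junction (h : IsCode k N w j) (hk : m = k + 2) {i : ℕ} (hi : 2 * i + 5 ≤ m) :
    let a := lift m (w (2 * i + 1)) (m - 5)
    a (m - 3) = 2 ∧ a (m - 2) = 4 + 2 * i ∧ a (m - 1) = (5 + 2 * i) % m := by
  have key : ∀ p < m, lift m (w (2 * i + 1)) (m - 5) p =
      (m - w (2 * i + 1) (if p ≤ m - 5 then m - 5 - p else m + (m - 5) - p)) % m := fun p hp => by
    rw [lift, if_pos hp, sub_mod_of_lt hp (by omega)]
  -- The lower rank `2 * i + 1` is below `k`, where the lower code is still merely rotating the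
  -- identity. This is why its entries are known explicitly.
  have hrot : ∀ p < k, w (2 * i + 1) p = if 2 * i + 1 ≤ p then p - (2 * i + 1) else
      k + p - (2 * i + 1) := fun p hp => by
    rw [h.rot _ (by omega) p hp, sub_mod_of_lt (by omega) hp]
  refine ⟨?_, ?_, ?_⟩
  · rw [key _ (by omega), if_neg (by omega), h.fix _ _ (by omega), Nat.mod_eq_of_lt (by omega)]
    omega
  · rw [key _ (by omega), if_neg (by omega), hrot _ (by omega), if_pos (by omega),
      Nat.mod_eq_of_lt (by omega)]
    omega
  · rw [key _ (by omega), if_neg (by omega), hrot _ (by omega), if_pos (by omega)]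
    congr 1
    omega

/-- At a junction, `t_{↑m-2}` does the same as `t_{↑m}` up to a `3`-cycle of the elements. -/
theorem push_junction {a : ℕ → ℕ} {q o : ℕ} (hm : 5 ≤ m) (ha : Function.Injective a)
    (h₃ : a (m - 3) = 2) (h₂ : a (m - 2) = q) (h₁ : a (m - 1) = o) (p : ℕ) (hp : p < m) :
    a (pushPos 1 (m - 2) p) = rotThree q o (a (pushPos 1 m p)) := by
  have hne : ∀ x y, x ≠ y → a x ≠ a y := fun x y h h' => h (ha h')
  have e₁ := hne (m - 3) (m - 2) (by omega)
  have e₂ := hne (m - 3) (m - 1) (by omega)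
  have e₃ := hne (m - 2) (m - 1) (by omega)
  unfold rotThree
  rcases (by omega : p = 0 ∨ p = m - 2 ∨ p = m - 1 ∨ 0 < p ∧ p < m - 2) with h | h | h | h
  · rw [show pushPos 1 (m - 2) p = m - 3 by unfold pushPos; split_ifs <;> omega,
      show pushPos 1 m p = m - 1 by unfold pushPos; split_ifs <;> omega, h₁, h₃]
    split_ifs <;> omega
  · rw [show pushPos 1 (m - 2) p = m - 2 by unfold pushPos; split_ifs <;> omega,
      show pushPos 1 m p = m - 3 by unfold pushPos; split_ifs <;> omega, h₂, h₃]
    split_ifs <;> omega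
  · rw [show pushPos 1 (m - 2) p = m - 1 by unfold pushPos; split_ifs <;> omega,
      show pushPos 1 m p = m - 2 by unfold pushPos; split_ifs <;> omega, h₂, h₁]
    split_ifs <;> omega
  · have hp' : pushPos 1 (m - 2) p = p - 1 := by unfold pushPos; split_ifs <;> omega
    rw [hp', show pushPos 1 m p = p - 1 by unfold pushPos; split_ifs <;> omega]
    have e₄ := hne (p - 1) (m - 3) (by omega)
    have e₅ := hne (p - 1) (m - 2) (by omega)
    have e₆ := hne (p - 1) (m - 1) (by omega)
    split_ifs <;> omega

end Hub

/-- The square of a 3-cycle is its inverse, obtained by exchanging `q` and `o`; hence the second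
copy of a pair swaps the roles of the two elements. -/
theorem rotThree_rotThree {q o : ℕ} (hq : q ≠ 2) (ho : o ≠ 2) (hqo : q ≠ o) (v : ℕ) :
    rotThree q o (rotThree q o v) = rotThree o q v := by
  unfold rotThree; split_ifs <;> omega

theorem rotThree_inverse {q o : ℕ} (hq : q ≠ 2) (ho : o ≠ 2) (hqo : q ≠ o) (v : ℕ) :
    rotThree o q (rotThree q o v) = v := by
  unfold rotThree; split_ifs <;> omega

end Tower

namespace Tower

/-! ### Splicing pairs of relabelled copies into the hub -/

section Splice

variable {m k N μ : ℕ} {w : ℕ → ℕ → ℕ} {j : ℕ → ℕ}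

/-- The words of the hub and of its relabelled copies. -/
def spliceWord (m μ L : ℕ) (u : ℕ → ℕ → ℕ) (r p : ℕ) : ℕ :=
  if p < m then
    rotThree (elemQ m (copyOf m μ L r) (pairOf m L r)) (elemO m (copyOf m μ L r) (pairOf m L r))
      (u (hubOf m μ L r) p)
  else p

theorem pushPos_of_le {j p : ℕ} (hj : 1 ≤ j) (h : j ≤ p) : pushPos 1 j p = p := by
  unfold pushPos; split_ifs <;> omega

theorem IsCode.step_mod {L : ℕ} {u : ℕ → ℕ → ℕ} {ju : ℕ → ℕ} (h : IsCode m L u ju) (y p : ℕ) :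
    u ((y + 1) % L) p = u (y % L) (pushPos 1 (ju (y % L)) p) := by
  have hL : 0 < L := lt_of_lt_of_le h.one_le h.le
  have hlt := Nat.mod_lt y hL
  rw [← h.step _ hlt, Nat.add_mod]
  rcases Nat.eq_or_lt_of_le (show 1 ≤ L from hL) with h₁ | h₁
  · subst h₁
    have h1 := h.last p
    rw [Nat.mod_one, Nat.mod_one, h.zero]
    exact h1.symm
  · rw [Nat.mod_eq_of_lt h₁]
    rcases Nat.lt_or_ge (y % L + 1) L with h₂ | h₂
    · rw [Nat.mod_eq_of_lt h₂]
    · have h₃ : y % L + 1 = L := by omega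
      rw [h₃, Nat.mod_self, h.zero, h.last]

theorem elem_lt {c i : ℕ} (hm : c = 0 ∧ 3 ≤ m ∨ 2 * i + 5 ≤ m) :
    elemQ m c i < m ∧ elemO m c i < m := by
  have : (5 + 2 * i) % m < m := Nat.mod_lt _ (by omega)
  unfold elemQ elemO
  constructor <;> split_ifs <;> omega

theorem rotThree_lt {q o v : ℕ} (hm : 2 < m) (hq : q < m) (ho : o < m) (hv : v < m) :
    rotThree q o v < m := by
  unfold rotThree; split_ifs <;> omega

theorem five_add_mod {i : ℕ} (hi : 2 * i + 5 ≤ m) :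
    (5 + 2 * i) % m = if 2 * i + 5 = m then 0 else 5 + 2 * i := by
  split_ifs with h
  · rw [show 5 + 2 * i = m by omega, Nat.mod_self]
  · exact Nat.mod_eq_of_lt (by omega)

/-- At hub rank `2 * m * (i + 1) - 5` the last three entries are `2`, `q`, `o`, and `t_{↑m-2}`
replaces `t_{↑m}`. This lands in the hub relabelled by the 3-cycle on these elements. After all `L`
words of that copy the same underlying word recurs, and the next junction applies the 3-cycle again;
the third one closes the detour and returns to the hub at the following word. -/
theorem splice_code (h : IsCode k N w j) (hk : k < m) (hμ : μ = 0 ∨ m = 2 * μ + 3 ∧ m = k + 2) :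
    IsCode m (m * N * (1 + 2 * μ))
      (spliceWord m μ (m * N) fun r => lift m (w (r / m)) (r % m))
      (fun r => if IsJunction m μ (m * N) r then m - 2
        else hubTrans m (j (hubOf m μ (m * N) r / m)) (hubOf m μ (m * N) r)) := by
  have H := hub_code h hk
  set u : ℕ → ℕ → ℕ := fun r => lift m (w (r / m)) (r % m) with hu
  set ju : ℕ → ℕ := fun r => hubTrans m (j (r / m)) r with hju
  have hk1 := h.one_le
  have hN := h.le
  -- With pairs present, `2 * μ = k - 1`, and the lower code has at least `k` words.
  have hL : 2 * m * μ ≤ m * N := by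
    rcases hμ with rfl | ⟨h₁, h₂⟩
    · simp
    · calc 2 * m * μ = m * (2 * μ) := by ring
        _ ≤ m * N := Nat.mul_le_mul_left _ (by omega)
  have hmL : m ≤ m * N := H.le
  set L := m * N with hLdef
  have hpos : 0 < L := by omega
  have hub0 : ∀ r, copyOf m μ L r = 0 → ∀ p, spliceWord m μ L u r p = u (hubOf m μ L r) p := by
    intro r hc p
    unfold spliceWord
    rw [hc]
    simp only [elemQ, elemO, if_true, rotThree_two]
    split_ifs with hp
    · rfl
    · rw [H.fix _ _ (by omega)]
  have small : ∀ r < m, copyOf m μ L r = 0 ∧ hubOf m μ L r = r := by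
    intro r hr
    have := hub_facts (m := m) (L := L) (i := 0) (h := r) (μ := μ) (by omega) (Nat.zero_le _)
      (by omega) (by omega)
    simpa using ⟨this.1, this.2.1⟩
  -- The junction rank is `m * (2 * i + 1) + (m - 5)`: block `2 * i + 1`, rotation `m - 5`. It is
  -- not the end of a block, so the transition being replaced is `t_{↑m}`.
  have junction : ∀ i < μ, let e := 2 * m * (i + 1) - 5
      5 ≤ 2 * m * (i + 1) ∧ e + 1 < L ∧ ju e = m ∧ Function.Injective (u e) ∧ u e (m - 3) = 2 ∧
        u e (m - 2) = 4 + 2 * i ∧ u e (m - 1) = (5 + 2 * i) % m := by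
    intro i hi e
    obtain ⟨hm, hmk⟩ : m = 2 * μ + 3 ∧ m = k + 2 := by omega
    have h₁ : 2 * m * (i + 1) ≤ 2 * m * μ := Nat.mul_le_mul_left _ hi
    have h₂ : 2 * m * (i + 1) = m * (2 * i + 1) + m := by ring
    have he : e = m * (2 * i + 1) + (m - 5) := by omega
    have hd : e / m = 2 * i + 1 := by
      rw [he, Nat.mul_add_div (by omega), Nat.div_eq_of_lt (by omega), Nat.add_zero]
    have hr : e % m = m - 5 := by rw [he, Nat.mul_add_mod, Nat.mod_eq_of_lt (by omega)]
    have := hub_junction h hmk (i := i) (by omega)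
    refine ⟨by omega, by omega, ?_, H.injective e (by omega), ?_⟩
    · simp only [hju, hubTrans]
      rw [hr, if_pos (by omega)]
    · simp only [hu]
      rw [hd, hr]
      exact this
  refine ⟨by omega, ?_, ?_, ?_, ?_, ?_, ?_, ?_, ?_⟩
  · exact hmL.trans (Nat.le_mul_of_pos_right _ (by omega))
  · intro p
    obtain ⟨h₁, h₂⟩ := small 0 (by omega)
    rw [hub0 _ h₁, h₂]
    exact H.zero p
  · intro p
    have e : L * (1 + 2 * μ) = L + 2 * L * μ := by ring
    obtain ⟨h₁, h₂, -⟩ := hub_facts (m := m) (L := L) (i := μ) (h := L) (μ := μ) (by omega) le_rfl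
      (by omega) (by omega)
    rw [e, hub0 _ h₁, h₂]
    exact H.last p
  · intro r p hp
    rw [spliceWord, if_neg (by omega)]
  · intro r p hp
    rcases copyOf_eq_zero_or (m := m) (μ := μ) (L := L) (r := r) (by omega) with hc | hc
    · rw [hub0 _ hc]
      exact H.lt _ _ hp
    · obtain ⟨h₁, h₂⟩ := elem_lt (m := m) (c := copyOf m μ L r) (i := pairOf m L r) (by omega)
      rw [spliceWord, if_pos hp]
      exact rotThree_lt (by omega) h₁ h₂ (H.lt _ _ hp)
  · intro r hr p hp
    obtain ⟨h₁, h₂⟩ := small r hr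
    rw [hub0 _ h₁, h₂]
    exact H.rot r hr p hp
  · intro r
    split_ifs with hj
    · have : 0 < μ := Nat.zero_lt_of_lt hj.1
      omega
    · exact H.range _
  · intro r hr p
    rcases Nat.lt_or_ge p m with hp | hp
    swap
    · have hjr : 1 ≤ (if IsJunction m μ L r then m - 2 else ju (hubOf m μ L r)) ∧
          (if IsJunction m μ L r then m - 2 else ju (hubOf m μ L r)) ≤ m := by
        split_ifs with hj
        · have : 0 < μ := Nat.zero_lt_of_lt hj.1
          omega
        · exact H.range _
      rw [pushPos_of_le hjr.1 (hjr.2.trans hp), spliceWord, spliceWord, if_neg (by omega),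
        if_neg (by omega)]
    have hp' : ∀ j ≤ m, pushPos 1 j p < m := fun j hj => by unfold pushPos; split_ifs <;> omega
    rcases rank_cases μ L r (show 2 ≤ m by omega) with ⟨i, h', rfl, hi, h₁, h₂⟩ | ⟨i, x, hi, hx, hr'⟩
    · obtain ⟨e₁, e₂, e₃⟩ := hub_facts (L := L) (by omega) hi h₁ h₂
      have hh : h' < L := e₂ ▸ hubOf_lt (by omega) hL hr
      rw [hub0 _ e₁, e₂]
      by_cases hj : i < μ ∧ h' + 5 = 2 * m * (i + 1)
      -- First junction of a pair: from the hub into the first copy, whose traversal starts at the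
      -- hub word of rank `h' + 1`.
      · rw [if_pos (e₃.2 hj)]
        obtain ⟨hi, h₃⟩ := hj
        obtain ⟨-, j₁, j₂, j₃, j₄, j₅, j₆⟩ := junction i hi
        have e : 2 * m * (i + 1) - 5 = h' := by omega
        rw [e] at j₁ j₂ j₃ j₄ j₅ j₆
        have h₄ : h' + 2 * L * i + 1 + 4 = (2 * m + 2 * L) * i + 2 * m + 0 := by
          rw [Nat.mul_add] at h₃
          rw [Nat.add_mul]
          omega
        obtain ⟨f₁, f₂, f₃, -⟩ := copy_facts (μ := μ) hi (by omega) h₄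
        rw [spliceWord, if_pos hp, f₁, f₂, f₃, Nat.zero_div,
          show 2 * m * (i + 1) + 0 - 4 = h' + 1 by omega, Nat.mod_eq_of_lt j₁, H.step _ hh, j₂,
          push_junction (by omega) j₃ j₄ j₅ j₆ p hp]
        rfl
      · rw [if_neg fun h => hj (e₃.1 h)]
        have e : h' + 2 * L * i + 1 = (h' + 1) + 2 * L * i := by omega
        obtain ⟨f₁, f₂, -⟩ := hub_facts (m := m) (L := L) (i := i) (h := h' + 1) (μ := μ) (by omega)
          hi (by omega) (fun h => by have := h₂ h; omega)
        rw [e, hub0 _ f₁, f₂]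
        exact H.step h' hh p
    · obtain ⟨e₁, e₂, e₃, e₄⟩ := copy_facts hi hx hr'
      obtain ⟨j₀, j₁, j₂, j₃, j₄, j₅, j₆⟩ := junction i hi
      have hne : 4 + 2 * i ≠ 2 ∧ (5 + 2 * i) % m ≠ 2 ∧ 4 + 2 * i ≠ (5 + 2 * i) % m := by
        rw [five_add_mod (by omega)]
        split_ifs <;> omega
      by_cases hj : x + 1 = L ∨ x + 1 = 2 * L
      · rw [if_pos (e₄.2 hj), spliceWord, spliceWord, if_pos hp, if_pos (hp' _ (by omega)), e₁, e₂, e₃]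
        -- The last word visited in either copy underlies the same hub word as the junction. One
        -- more 3-cycle gives the second copy in the first case, and cancels the relabelling in the
        -- second.
        rcases hj with hj | hj
        · have e₅ : (2 * m * (i + 1) + x - 4) % L = 2 * m * (i + 1) - 5 := by
            rw [show 2 * m * (i + 1) + x - 4 = 2 * m * (i + 1) - 5 + L by omega, Nat.add_mod_right,
              Nat.mod_eq_of_lt (by omega)]
          obtain ⟨f₁, f₂, f₃, -⟩ := copy_facts (m := m) (μ := μ) (L := L) (r := r + 1) (x := L) hi
            (by omega) (by omega)
          rw [f₁, f₂, f₃, e₅, Nat.div_self hpos, Nat.div_eq_of_lt (show x < L by omega),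
            show 2 * m * (i + 1) + L - 4 = 2 * m * (i + 1) - 5 + 1 + L by omega, Nat.add_mod_right,
            Nat.mod_eq_of_lt j₁, H.step _ (by omega), j₂,
            push_junction (by omega) j₃ j₄ j₅ j₆ p hp]
          exact (rotThree_rotThree hne.1 hne.2.1 hne.2.2 _).symm
        · have e₅ : (2 * m * (i + 1) + x - 4) % L = 2 * m * (i + 1) - 5 := by
            rw [show 2 * m * (i + 1) + x - 4 = 2 * m * (i + 1) - 5 + L * 2 by omega,
              Nat.add_mul_mod_self_left, Nat.mod_eq_of_lt (by omega)]
          have e₆ : x / L = 1 := by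
            rw [show x = L - 1 + L by omega, Nat.add_div_right _ hpos, Nat.div_eq_of_lt (by omega)]
          have e₇ : r + 1 = 2 * m * (i + 1) - 5 + 1 + 2 * L * (i + 1) := by
            rw [Nat.add_mul] at hr'
            rw [Nat.mul_add] at j₀
            rw [Nat.mul_add, Nat.mul_add]
            omega
          obtain ⟨f₁, f₂, -⟩ := hub_facts (m := m) (L := L) (i := i + 1)
            (h := 2 * m * (i + 1) - 5 + 1) (μ := μ) (by omega) hi (by omega)
            (fun _ => by rw [Nat.mul_add _ (i + 1)]; omega)
          have := hub0 _ f₁ p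
          rw [spliceWord, if_pos hp] at this
          rw [e₇, this, f₂, e₅, e₆, H.step _ (by omega), j₂,
            push_junction (by omega) j₃ j₄ j₅ j₆ p hp]
          exact (rotThree_inverse hne.1 hne.2.1 hne.2.2 _).symm
      · rw [if_neg fun h => hj (e₄.1 h), spliceWord, spliceWord, if_pos hp,
          if_pos (hp' _ (H.range _).2), e₁, e₂, e₃]
        obtain ⟨f₁, f₂, f₃, -⟩ := copy_facts (m := m) (μ := μ) (L := L) (r := r + 1) (x := x + 1) hi
          (by omega) (by omega)
        have e₅ : (x + 1) / L = x / L := by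
          rcases Nat.lt_or_ge x L with hx' | hx'
          · rw [Nat.div_eq_of_lt hx', Nat.div_eq_of_lt (by omega)]
          · rw [show x + 1 = x - L + 1 + L by omega, Nat.add_div_right _ hpos,
              Nat.div_eq_of_lt (by omega), show x / L = (x - L + L) / L by congr 1; omega,
              Nat.add_div_right _ hpos, Nat.div_eq_of_lt (by omega)]
        rw [f₁, f₂, f₃, e₅, show 2 * m * (i + 1) + (x + 1) - 4 = 2 * m * (i + 1) + x - 4 + 1 by omega,
          H.step_mod]

end Splice

theorem isCode {t : Tower} {n : ℕ} (h : t.Valid n) :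
    ∀ b ≤ n, IsCode (t.size b) (t.card b) (t.word b) (t.trans b) := by
  intro b
  induction b with
  | zero =>
    intro _
    rw [h.size_zero]
    exact ⟨le_rfl, le_rfl, fun _ => rfl, fun _ => rfl, fun _ _ _ => rfl, fun _ _ h => h,
      fun r hr p hp => by
        obtain rfl : r = 0 := by omega
        obtain rfl : p = 0 := by omega
        rfl, fun _ => ⟨le_rfl, le_rfl⟩, fun r _ p => by
        change p = pushPos 1 1 p
        unfold pushPos; split_ifs <;> omega⟩
  | succ b ih =>
    intro hb
    exact splice_code (ih (by omega)) (h.size_lt b (by omega)) (by have := h.pairs b (by omega); omega)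

end Tower

namespace Tower

/-! ### The codes of the towers -/

section Shift

variable {n M : ℕ} {w : ℕ → ℕ → ℕ} {j : ℕ → ℕ}

/-- The cyclic code `w`, started at its word of rank `n - 2`, with the elements renamed. -/
def shiftWord (n M : ℕ) (w : ℕ → ℕ → ℕ) (r p : ℕ) : ℕ := (w ((r + (n - 2)) % M) p + (n - 2)) % n

def shiftSeq (n M : ℕ) (j : ℕ → ℕ) : List ℕ := (List.range M).map fun r => j ((r + (n - 2)) % M)

/-- At rank `n - 2` the code is still rotating the identity, so adding `n - 2` to all elements
modulo `n` turns that word into the identity. Renaming elements acts on the left and commutes with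
pushes. -/
theorem IsCode.shift_isVec (h : IsCode n M w j) (hn : 2 ≤ n) (hj : ∀ r, 2 ≤ j r) :
    ∀ r ≤ M, IsVec (shiftWord n M w r) (codeword 1 (1 : Perm (Fin n)) (shiftSeq n M j) r) := by
  have hle := h.le
  have hlen : (shiftSeq n M j).length = M := by simp [shiftSeq]
  intro r hr
  refine isVec_codeword le_rfl ?_ ?_ ?_ r (by rwa [hlen])
  · intro i hi
    obtain ⟨r, -, rfl⟩ := List.mem_map.1 hi
    exact ⟨hj _, (h.range _).2⟩
  · intro p
    rw [shiftWord, Nat.zero_add, Nat.mod_eq_of_lt (show n - 2 < M by omega),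
      h.rot _ (by omega) _ p.isLt, Nat.mod_add_mod,
      show n + p.val - (n - 2) + (n - 2) = n + p.val by omega, Nat.add_mod_left,
      Nat.mod_eq_of_lt p.isLt]
    rfl
  · intro r hr p hp
    simp only [shiftSeq, List.getElem_map, List.getElem_range, shiftWord]
    rw [Nat.add_right_comm, h.step_mod]

/-- If two ranks had the same codeword, one initial state would be a legal input for both, and the
deterministic ranking program would have to return both ranks. -/
theorem isPushCode_of_ranksIn {L : List ℕ} {p : Cmd} {T : ℕ} (hM : L.length = M)
    (hL : ∀ j ∈ L, 1 < j ∧ j ≤ n) (hc : codeword 1 (1 : Perm (Fin n)) L M = 1)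
    (hp : RanksIn p n L T) : IsPushCode n M L := by
  refine ⟨hM, hL, fun r r' hr hr' he => ?_, hc⟩
  -- Every register holds `n`, in particular the size parameter; every array holds the common
  -- codeword.
  let s : State := ⟨fun _ => n, fun _ i =>
    if h : 1 ≤ i ∧ i ≤ n then (codeword 1 (1 : Perm (Fin n)) L r ⟨i - 1, by omega⟩).val + 1 else 0⟩
  have hs : Holds (s.arr aPi) (codeword 1 (1 : Perm (Fin n)) L r) := fun i => by
    have hi := i.isLt
    simp only [s]
    rw [dif_pos ⟨by omega, by omega⟩]
    rfl
  obtain ⟨s₁, t₁, e₁, -, h₁, -⟩ := hp s r (by omega) rfl hs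
  obtain ⟨s₂, t₂, e₂, -, h₂, -⟩ := hp s r' (by omega) rfl (he ▸ hs)
  obtain ⟨rfl, -⟩ := e₁.det e₂
  omega

theorem IsCode.shift_isPushCode (h : IsCode n M w j) (hn : 2 ≤ n) (hj : ∀ r, 2 ≤ j r)
    {p : Cmd} {T : ℕ} (hp : RanksIn p n (shiftSeq n M j) T) : IsPushCode n M (shiftSeq n M j) := by
  refine isPushCode_of_ranksIn (by simp [shiftSeq]) ?_ ?_ hp
  · intro i hi
    obtain ⟨r, -, rfl⟩ := List.mem_map.1 hi
    exact ⟨hj _, (h.range _).2⟩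
  · ext q
    have h₀ := h.shift_isVec hn hj 0 (Nat.zero_le _) q
    rw [h.shift_isVec hn hj M le_rfl q, ← codeword_zero 1 1 (shiftSeq n M j), h₀]
    simp [shiftWord]

end Shift

theorem Valid.two_le_size {t : Tower} {n : ℕ} (h : t.Valid n) {b : ℕ} (hb : b < n) :
    2 ≤ t.size (b + 1) := by
  have := h.size_lt b hb
  have := (isCode h b hb.le).one_le
  omega

theorem Valid.two_le_trans {t : Tower} {n : ℕ} (h : t.Valid n) {b : ℕ} (hb : b < n) (r : ℕ) :
    2 ≤ t.trans (b + 1) r := by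
  have h₁ := h.size_lt b hb
  have h₂ := (isCode h b hb.le).range (t.hub b r / t.size (b + 1))
  rw [trans]
  split_ifs with hj
  · have : 0 < t.pairs (b + 1) := Nat.zero_lt_of_lt hj.1
    have := h.pairs b hb
    omega
  · unfold hubTrans
    split_ifs <;> omega

/-- For odd `m` and odd `j` the three possible transitions `m`, `m + 1 - j` and `m - 2` are all odd.
-/
theorem Valid.trans_odd {t : Tower} {n : ℕ} (h : t.Valid n) (hodd : ∀ b ≤ n, t.size b % 2 = 1) :
    ∀ b ≤ n, ∀ r, t.trans b r % 2 = 1 := by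
  intro b
  induction b with
  | zero => intro _ _; rfl
  | succ b ih =>
    intro hb r
    have h₁ := ih (by omega) (t.hub b r / t.size (b + 1))
    have h₂ := hodd (b + 1) hb
    have h₃ := h.size_lt b hb
    have h₄ := (isCode h b (by omega)).range (t.hub b r / t.size (b + 1))
    rw [trans]
    split_ifs with hj
    · have : 0 < t.pairs (b + 1) := Nat.zero_lt_of_lt hj.1
      have := h.pairs b hb
      omega
    · unfold hubTrans
      split_ifs <;> omega

/-- The transition after the word of rank `n - 2` is `t_{↑n}`. -/
theorem Valid.trans_first {t : Tower} {n : ℕ} (h : t.Valid n) {b : ℕ} (hb : b < n) :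
    t.trans (b + 1) (t.size (b + 1) - 2) = t.size (b + 1) := by
  have h₁ := h.two_le_size hb
  have h₂ := h.pairs b hb
  obtain ⟨-, e₂, e₃⟩ := hub_facts (m := t.size (b + 1)) (L := t.hubCard b) (i := 0)
    (h := t.size (b + 1) - 2) (μ := t.pairs (b + 1)) (by omega) (Nat.zero_le _) (by omega) (by omega)
  simp only [Nat.mul_zero, Nat.add_zero] at e₂ e₃
  have : t.hub b (t.size (b + 1) - 2) = t.size (b + 1) - 2 := e₂
  rw [trans, if_neg (by rw [e₃]; omega), this, hubTrans, Nat.mod_eq_of_lt (by omega),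
    if_pos (by omega)]

def seq (t : Tower) (b : ℕ) : List ℕ := shiftSeq (t.size b) (t.card b) (t.trans b)

def vec (t : Tower) (b : ℕ) : ℕ → ℕ → ℕ := shiftWord (t.size b) (t.card b) (t.word b)

theorem length_seq (t : Tower) (b : ℕ) : (t.seq b).length = t.card b := by simp [seq, shiftSeq]

theorem Valid.isVec {t : Tower} {n : ℕ} (h : t.Valid n) {b : ℕ} (hb : b < n) {r : ℕ}
    (hr : r ≤ t.card (b + 1)) :
    IsVec (t.vec (b + 1) r) (codeword 1 (1 : Perm (Fin (t.size (b + 1)))) (t.seq (b + 1)) r) :=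
  (isCode h (b + 1) hb).shift_isVec (h.two_le_size hb) (h.two_le_trans hb) r hr

theorem Valid.isPushCode {t : Tower} {n : ℕ} (h : t.Valid n) {b : ℕ} (hb : b < n) {p : Cmd}
    {T : ℕ} (hp : RanksIn p (t.size (b + 1)) (t.seq (b + 1)) T) :
    IsPushCode (t.size (b + 1)) (t.card (b + 1)) (t.seq (b + 1)) :=
  (isCode h (b + 1) hb).shift_isPushCode (h.two_le_size hb) (h.two_le_trans hb) hp

theorem Valid.head_seq {t : Tower} {n : ℕ} (h : t.Valid n) {b : ℕ} (hb : b < n) :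
    (t.seq (b + 1)).head? = some (t.size (b + 1)) := by
  have h₁ := (isCode h (b + 1) hb).le
  have h₂ := h.two_le_size hb
  rw [List.head?_eq_getElem?, List.getElem?_eq_getElem (by rw [length_seq]; omega)]
  simp only [seq, shiftSeq, List.getElem_map, List.getElem_range, Nat.zero_add]
  rw [Nat.mod_eq_of_lt (by omega), h.trans_first hb]

/-- Odd pushes preserve the sign, so every codeword is even, while a left factor `(q, n)` would
change the sign. -/
theorem Valid.isAuxCode_of_odd {t : Tower} {n : ℕ} (h : t.Valid n)
    (hodd : ∀ b ≤ n, t.size b % 2 = 1) {b : ℕ} (hb : b < n)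
    (hp : IsPushCode (t.size (b + 1)) (t.card (b + 1)) (t.seq (b + 1))) :
    IsAuxCode (t.size (b + 1)) (t.card (b + 1)) (t.seq (b + 1)) := by
  refine ⟨hp, h.head_seq hb, fun r hr r' hr' q z hz hq he => ?_⟩
  have hL : ∀ j ∈ t.seq (b + 1), j % 2 = 1 := fun i hi => by
    obtain ⟨r, -, rfl⟩ := List.mem_map.1 hi
    exact h.trans_odd hodd _ hb _
  have hs := congrArg Perm.sign he
  rw [Perm.sign_mul, sign_codeword hL _ (by rw [length_seq]; omega),
    sign_codeword hL _ (by rw [length_seq]; omega), Perm.sign_swap hq] at hs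
  exact absurd hs (by decide)

theorem add_one_mod_eq {n a : ℕ} (ha : a < n) :
    (a + 1) % n = if a + 1 = n then 0 else a + 1 := by
  split_ifs with h
  · rw [h, Nat.mod_self]
  · exact Nat.mod_eq_of_lt (by omega)

/-- In the words of a tower without pairs at the top, the last element is followed by the first. -/
theorem Valid.vec_adjacent {t : Tower} {n : ℕ} (h : t.Valid n) {b : ℕ} (hb : b < n)
    (hpairs : t.pairs (b + 1) = 0) (hsize : t.size b + 2 ≤ t.size (b + 1)) (r : ℕ) :
    ∃ p < t.size (b + 1), t.vec (b + 1) r p = t.size (b + 1) - 1 ∧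
      t.vec (b + 1) r ((p + 1) % t.size (b + 1)) = 0 := by
  have H := isCode h b hb.le
  have h1 := H.one_le
  set m := t.size (b + 1) with hm
  set r' := (r + (m - 2)) % t.card (b + 1) with hr'
  have hc : t.copy b r' = 0 := by
    rcases copyOf_eq_zero_or (m := m) (μ := t.pairs (b + 1)) (L := t.hubCard b) (r := r')
      (by omega) with hc | hc
    · exact hc
    · omega
  have key : ∀ p < m, t.vec (b + 1) r p =
      ((m - t.word b (t.hub b r' / m) ((m + t.hub b r' % m - p) % m)) % m + (m - 2)) % m := by
    intro p hp
    simp only [vec, shiftWord]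
    rw [← hm, ← hr', word, ← hm, if_pos hp, hc, elemQ, elemO, if_pos rfl, if_pos rfl, rotThree_two,
      lift, if_pos hp]
  set s := t.hub b r' % m
  have hs : s < m := Nat.mod_lt _ (by omega)
  have hp : (s + 1) % m < m := Nat.mod_lt _ (by omega)
  have hp' : ((s + 1) % m + 1) % m < m := Nat.mod_lt _ (by omega)
  have e₁ : (m + s - (s + 1) % m) % m = m - 1 := by
    rw [sub_mod_of_lt hp hs, add_one_mod_eq hs]
    split_ifs <;> omega
  have e₂ : (m + s - ((s + 1) % m + 1) % m) % m = m - 2 := by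
    rw [sub_mod_of_lt hp' hs, add_one_mod_eq hp, add_one_mod_eq hs]
    split_ifs <;> omega
  -- The lower word fixes `m - 1` and `m - 2`; after reversal and negation these are the elements
  -- `1` and `2` at positions `s + 1` and `s + 2`, renamed to `m - 1` and `0`.
  refine ⟨(s + 1) % m, hp, ?_, ?_⟩
  · rw [key _ hp, e₁, H.fix _ _ (by omega), show m - (m - 1) = 1 by omega,
      Nat.mod_eq_of_lt (show 1 < m by omega), show 1 + (m - 2) = m - 1 by omega,
      Nat.mod_eq_of_lt (by omega)]
  · rw [key _ hp', e₂, H.fix _ _ (by omega), Nat.mod_add_mod,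
      show m - (m - 2) + (m - 2) = m by omega, Nat.mod_self]

/-- In every word the last element `z` is followed cyclically by the first element `o`. A swap of
`q` and `z` moves `z` to another position; if `q ≠ o` it leaves `o` where it was and destroys the
adjacency, and `q = o` would require `z` and `o` to follow each other both ways round, impossible
for at least three elements. -/
theorem Valid.isAuxCode_of_adjacent {t : Tower} {n : ℕ} (h : t.Valid n) {b : ℕ} (hb : b < n)
    (hpairs : t.pairs (b + 1) = 0) (hsize : t.size b + 2 ≤ t.size (b + 1)) (h4 : 4 ≤ t.size (b + 1))
    (hp : IsPushCode (t.size (b + 1)) (t.card (b + 1)) (t.seq (b + 1))) :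
    IsAuxCode (t.size (b + 1)) (t.card (b + 1)) (t.seq (b + 1)) := by
  refine ⟨hp, h.head_seq hb, fun r hr r' hr' q z hz hq he => ?_⟩
  have hadj : ∀ r < t.card (b + 1), ∃ p p' : Fin (t.size (b + 1)), ∃ o : Fin (t.size (b + 1)),
      p'.val = (p.val + 1) % t.size (b + 1) ∧ o.val = 0 ∧
      codeword 1 1 (t.seq (b + 1)) r p = z ∧ codeword 1 1 (t.seq (b + 1)) r p' = o := by
    intro r hr
    obtain ⟨p, hp, h₁, h₂⟩ := h.vec_adjacent hb hpairs hsize r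
    refine ⟨⟨p, hp⟩, ⟨(p + 1) % t.size (b + 1), Nat.mod_lt _ (by omega)⟩, ⟨0, by omega⟩, rfl, rfl,
      Fin.ext ?_, Fin.ext ?_⟩
    · rw [h.isVec hb hr.le, h₁]; omega
    · rw [h.isVec hb hr.le, h₂]
  obtain ⟨p₀, p₁, o, e₁, ho, e₂, e₃⟩ := hadj r hr
  obtain ⟨p₀', p₁', o', e₁', ho', e₂', e₃'⟩ := hadj r' hr'
  obtain rfl : o = o' := Fin.ext (by omega)
  rw [← he, Perm.mul_apply] at e₂' e₃'
  have e₄ : codeword 1 1 (t.seq (b + 1)) r p₀' = q := by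
    rw [← Equiv.apply_eq_iff_eq (swap q z), e₂', swap_apply_left]
  have hz0 : o ≠ z := fun h => by rw [h] at ho; omega
  have h₀ := p₀.isLt
  have h₀' := p₀'.isLt
  -- If `q = o`, each of the two positions is the cyclic successor of the other. Otherwise `o`, and
  -- hence its predecessor `z`, has not moved, which forces `q = z`.
  by_cases hq0 : q = o
  · have e₅ : codeword 1 1 (t.seq (b + 1)) r p₁' = z := by
      rw [← Equiv.apply_eq_iff_eq (swap q z), e₃', swap_apply_right, hq0]
    have e₆ : p₁' = p₀ := (codeword 1 1 (t.seq (b + 1)) r).injective (e₅.trans e₂.symm)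
    have e₇ : p₀' = p₁ := (codeword 1 1 (t.seq (b + 1)) r).injective (e₄.trans (hq0.trans e₃.symm))
    rw [e₆, add_one_mod_eq h₀'] at e₁'
    rw [← e₇, add_one_mod_eq h₀] at e₁
    split_ifs at e₁ e₁' <;> omega
  · have e₅ : codeword 1 1 (t.seq (b + 1)) r p₁' = o := by
      rw [← Equiv.apply_eq_iff_eq (swap q z), e₃', swap_apply_of_ne_of_ne (Ne.symm hq0) hz0]
    have e₆ : p₁' = p₁ := (codeword 1 1 (t.seq (b + 1)) r).injective (e₅.trans e₃.symm)
    have e₇ : p₀' = p₀ := by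
      rw [e₆, e₁, add_one_mod_eq h₀, add_one_mod_eq h₀'] at e₁'
      ext
      split_ifs at e₁' <;> omega
    rw [e₇, e₂] at e₄
    exact hq e₄.symm

/-! ### The towers -/

/-- The tower of the complete codes. -/
def complete : Tower := ⟨fun b => b + 1, fun _ => 0⟩

/-- The tower of the auxiliary codes of odd length. -/
def odd : Tower := ⟨fun b => 2 * b + 1, fun b => b - 1⟩

/-- The tower of the auxiliary code of even length `n`. -/
def even (n : ℕ) : Tower := ⟨fun b => if b = n - 2 then n else b + 1, fun _ => 0⟩

theorem complete_valid (n : ℕ) : complete.Valid n := ⟨rfl, fun _ _ => by simp [complete], fun _ _ => .inl rfl⟩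

theorem odd_valid (n : ℕ) : odd.Valid n :=
  ⟨rfl, fun _ _ => by simp [odd], fun b _ => .inr (by simp only [odd]; omega)⟩

theorem even_valid {n : ℕ} (hn : 4 ≤ n) : (even n).Valid (n - 2) :=
  ⟨by simp only [even]; split_ifs <;> omega, fun _ _ => by simp only [even]; split_ifs <;> omega,
    fun _ _ => .inl rfl⟩

theorem complete_card (b : ℕ) : complete.card b = (b + 1).factorial := by
  induction b with
  | zero => rfl
  | succ b ih => rw [card, ih, Nat.factorial_succ (b + 1)]; simp [complete]

/-- Stated without division: a new level multiplies both sides by `(2b+3)(2b+1)` times the factor `4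
(b+1)²` from the denominator. -/
theorem odd_card (b : ℕ) :
    odd.card b * (b.factorial ^ 2 * 2 ^ (2 * b)) = (2 * b).factorial * (2 * b + 1).factorial := by
  induction b with
  | zero => rfl
  | succ b ih =>
    have e₁ : (2 * (b + 1)).factorial = (2 * b + 2) * (2 * b + 1) * (2 * b).factorial := by
      rw [show 2 * (b + 1) = 2 * b + 1 + 1 by ring, Nat.factorial_succ, Nat.factorial_succ]; ring
    have e₂ : (2 * (b + 1) + 1).factorial =
        (2 * b + 3) * (2 * b + 2) * (2 * b + 1).factorial := by
      rw [show 2 * (b + 1) + 1 = 2 * b + 1 + 1 + 1 by ring, Nat.factorial_succ, Nat.factorial_succ]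
      ring
    have e₃ : odd.card (b + 1) = (2 * b + 3) * odd.card b * (1 + 2 * b) := by
      rw [card, show odd.size (b + 1) = 2 * b + 3 from rfl, show odd.pairs (b + 1) = b from rfl]
    rw [e₁, e₂, e₃, Nat.factorial_succ, show 2 * (b + 1) = 2 * b + 2 by ring, pow_add]
    calc _ = (odd.card b * (b.factorial ^ 2 * 2 ^ (2 * b))) *
          ((2 * b + 3) * (1 + 2 * b) * (b + 1) ^ 2 * 4) := by ring
      _ = _ := by rw [ih]; ring

/-- Below the last level the tower agrees with the complete one; the last level then skips the size
`n - 1`, and with it the factor `n - 1`. -/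
theorem even_card {n : ℕ} (hn : 4 ≤ n) : (even n).card (n - 2) = n * (n - 2).factorial := by
  have : ∀ b < n - 2, (even n).card b = (b + 1).factorial := by
    intro b
    induction b with
    | zero => intro _; rfl
    | succ b ih =>
      intro hb
      rw [card, ih (by omega), Nat.factorial_succ (b + 1)]
      have : b + 1 ≠ n - 2 := by omega
      simp [even, this]
  obtain ⟨b, rfl⟩ : ∃ b, n = b + 3 := ⟨n - 3, by omega⟩
  rw [show b + 3 - 2 = b + 1 by omega, card, this b (by omega)]
  simp [even]

/-- The tower of the auxiliary code of length `n`, and the number of its levels. -/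
def auxiliary (n : ℕ) : Tower := if n % 2 = 1 then odd else even n

def auxLevels (n : ℕ) : ℕ := if n % 2 = 1 then (n - 1) / 2 else n - 2

theorem auxiliary_valid {n : ℕ} (hn : 3 ≤ n) : (auxiliary n).Valid (auxLevels n) := by
  unfold auxiliary auxLevels
  split_ifs
  · exact odd_valid _
  · exact even_valid (by omega)

theorem auxiliary_size {n : ℕ} (hn : 3 ≤ n) : (auxiliary n).size (auxLevels n) = n := by
  unfold auxiliary auxLevels
  split_ifs
  · simp only [odd]; omega
  · simp [even]

theorem auxiliary_card {n : ℕ} (hn : 3 ≤ n) : (auxiliary n).card (auxLevels n) = auxSize n := by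
  unfold auxiliary auxLevels auxSize
  split_ifs with h
  · obtain ⟨b, rfl⟩ : ∃ b, n = 2 * b + 1 := ⟨n / 2, by omega⟩
    rw [Nat.add_sub_cancel, Nat.mul_div_cancel_left _ (by omega), ← odd_card,
      Nat.mul_div_cancel _ (by positivity)]
  · rw [even_card (by omega)]
    obtain ⟨b, rfl⟩ : ∃ b, n = b + 2 := ⟨n - 2, by omega⟩
    rw [Nat.factorial_succ, Nat.factorial_succ, show b + 2 - 1 = b + 1 by omega,
      show (b + 1 + 1) * ((b + 1) * b.factorial) = (b + 1) * ((b + 2) * b.factorial) by ring,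
      Nat.mul_div_cancel_left _ (by omega)]
    rfl

theorem auxLevels_pos {n : ℕ} (hn : 3 ≤ n) : 0 < auxLevels n := by
  unfold auxLevels; split_ifs <;> omega

theorem auxiliary_isAuxCode {n : ℕ} (hn : 3 ≤ n) {p : Cmd} {T : ℕ}
    (hp : RanksIn p n ((auxiliary n).seq (auxLevels n)) T) :
    IsAuxCode n (auxSize n) ((auxiliary n).seq (auxLevels n)) := by
  obtain ⟨b, hb⟩ : ∃ b, auxLevels n = b + 1 := ⟨auxLevels n - 1, by have := auxLevels_pos hn; omega⟩
  have hv := auxiliary_valid hn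
  have hs := auxiliary_size hn
  have hc := auxiliary_card hn
  rw [hb] at hv hs hc hp ⊢
  rw [← hc]
  have key : IsAuxCode ((auxiliary n).size (b + 1)) ((auxiliary n).card (b + 1))
      ((auxiliary n).seq (b + 1)) := by
    by_cases h : n % 2 = 1
    · refine hv.isAuxCode_of_odd (fun b _ => ?_) (by omega) (hv.isPushCode (by omega) (by simpa [hs] using hp))
      rw [auxiliary, if_pos h]
      simp only [odd]
      omega
    · have hbn : b + 1 = n - 2 := by rw [← hb, auxLevels, if_neg h]
      refine hv.isAuxCode_of_adjacent (by omega) ?_ ?_ (by omega)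
        (hv.isPushCode (by omega) (by simpa [hs] using hp))
      · rw [auxiliary, if_neg h]; rfl
      · rw [hs, auxiliary, if_neg h]
        simp only [even]
        split_ifs <;> omega
  rwa [hs] at key

end Tower

/-! ### Straight-line commands inside blocks -/

theorem Runs.cons_run {p : Cmd} {ps : List Cmd} {s : State} {T T₁ T₂ : ℕ} {R : State → Prop}
    (hp : p.loopFree = true) (hT₁ : p.bound ≤ T₁) (hT : T₁ + T₂ ≤ T)
    (h : Runs (.block ps) (p.run s) T₂ R) : Runs (.block (p :: ps)) s T R :=
  Runs.cons (Runs.straight hp hT₁ (Q := fun s' => s' = p.run s) (.refl _)) hT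
    (by rintro _ rfl; exact h)

@[simp] theorem State.ite_reg (c : Prop) [Decidable c] (s s' : State) (x : ℕ) :
    (if c then s else s').reg x = if c then s.reg x else s'.reg x := by split_ifs <;> rfl

@[simp] theorem State.ite_arr (c : Prop) [Decidable c] (s s' : State) (a i : ℕ) :
    (if c then s else s').arr a i = if c then s.arr a i else s'.arr a i := by split_ifs <;> rfl

attribute [simp] Cmd.run Cmd.block

/-! ### Subroutines for towers -/

abbrev xLen : ℕ := 32
abbrev xB : ℕ := 33
abbrev xT : ℕ := 34
abbrev xP : ℕ := 35
abbrev xM : ℕ := 36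
abbrev xL : ℕ := 37
abbrev xS : ℕ := 38
abbrev xQ : ℕ := 39
abbrev xO : ℕ := 40
abbrev xC : ℕ := 41
abbrev xI : ℕ := 42
abbrev xV : ℕ := 43
abbrev xA : ℕ := 44
abbrev xH : ℕ := 45
abbrev xG : ℕ := 46
abbrev xMu : ℕ := 47
abbrev yW : ℕ := 8
abbrev yZ : ℕ := 9
abbrev yC : ℕ := 10
abbrev yI : ℕ := 11
abbrev yS : ℕ := 12
abbrev ySz : ℕ := 13
abbrev yM : ℕ := 14
abbrev yMu : ℕ := 15

/-- The sizes of the codes of all levels. -/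
def cardsProg : Cmd := .block [
  .put ySz 0 1,
  .forUp xB 1 (.reg xLen) (.put ySz (.reg xB) (.get yM (.reg xB) * .get ySz (.reg xB - 1) *
    (1 + 2 * .get yMu (.reg xB))))]

/-- `v ← rotThree o q v` if `x = o` and `x' = q`. -/
def rotProg (v x x' : ℕ) : Cmd :=
  .ite (.bin .eq (.reg v) 2) (.set v (.reg x'))
    (.ite (.bin .eq (.reg v) (.reg x')) (.set v (.reg x))
      (.ite (.bin .eq (.reg v) (.reg x)) (.set v 2) .skip))

/-- Determine the copy of the hub that contains the word `W`. -/
def classifyProg : Cmd := .block [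
  .ite (.get yMu (.reg xB)) (.set xQ (.get yW ((.reg xS + 2) % .reg xM))) (.set xQ 2),
  .ite (.bin .eq (.reg xQ) 2) (.block [.set xC 0, .set xI 0, .set xO 2])
    (.ite (.bin .eq (.reg xQ) 0)
      (.block [.set xC 2, .set xI ((.reg xM - 5) / 2), .set xO (.reg xM - 1)])
      (.ite (.bin .eq (.reg xQ % 2) 0)
        (.block [.set xC 1, .set xI ((.reg xQ - 4) / 2), .set xO ((.reg xQ + 1) % .reg xM)])
        (.block [.set xC 2, .set xI ((.reg xQ - 5) / 2), .set xO (.reg xQ - 1)])))]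

/-- Go down one level from the word `W`. -/
def peelProg : Cmd := .block [
  .set xB (.reg xLen + 1 - .reg xT),
  .set xM (.get yM (.reg xB)),
  .forUp xP 0 (.reg xM - 1) (.ite (.bin .eq (.get yW (.reg xP)) 1)
    (.set xS ((.reg xP + .reg xM - 1) % .reg xM)) .skip),
  classifyProg,
  .put yC (.reg xB) (.reg xC),
  .put yI (.reg xB) (.reg xI),
  .put yS (.reg xB) (.reg xS),
  .forUp xP 0 (.reg xM - 1) (.block [
    .set xV (.get yW ((.reg xM + .reg xS - .reg xP) % .reg xM)),
    rotProg xV xQ xO,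
    .put yZ (.reg xP) ((.reg xM - .reg xV) % .reg xM)]),
  .forUp xP 0 (.reg xM - 1) (.put yW (.reg xP) (.get yZ (.reg xP)))]

/-- Go up one level with the rank `A`. -/
def collectProg : Cmd := .block [
  .set xM (.get yM (.reg xB)),
  .set xL (.reg xM * .get ySz (.reg xB - 1)),
  .set xH (.reg xM * .reg xA + .get yS (.reg xB)),
  .set xI (.get yI (.reg xB)),
  .set xG ((.reg xH + 4) / (2 * .reg xM)),
  .ite (.bin .lt (.get yMu (.reg xB)) (.reg xG)) (.set xG (.get yMu (.reg xB))) .skip,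
  .ite (.get yC (.reg xB))
    (.set xA ((2 * .reg xM + 2 * .reg xL) * .reg xI + 2 * .reg xM +
      (.get yC (.reg xB) - 1) * .reg xL +
      (.reg xH + 4 + .reg xL - 2 * .reg xM * (.reg xI + 1)) % .reg xL - 4))
    (.set xA (.reg xH + 2 * .reg xL * .reg xG))]

/-- Rank the code of the tower that has been loaded. -/
def towerRank : Cmd := .block [
  cardsProg,
  .forUp xP 0 (.reg rSize - 1)
    (.put yW (.reg xP) ((.get aPi (.reg xP + 1) + 1) % .reg rSize)),
  .forUp xT 1 (.reg xLen) peelProg,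
  .set xA 0,
  .forUp xB 1 (.reg xLen) collectProg,
  .set rRank ((.reg xA + .get ySz (.reg xLen) - (.reg rSize - 2)) % .get ySz (.reg xLen))]

/-- Go down one level with the rank `A`. -/
def splitProg : Cmd := .block [
  .set xB (.reg xLen + 1 - .reg xT),
  .set xM (.get yM (.reg xB)),
  .set xMu (.get yMu (.reg xB)),
  .set xL (.reg xM * .get ySz (.reg xB - 1)),
  .set xI ((.reg xA + 4) / (2 * .reg xM + 2 * .reg xL)),
  .set xG ((.reg xA + 4) % (2 * .reg xM + 2 * .reg xL)),
  .ite (.bin .lt (.reg xI) (.reg xMu) * .bin .lt (2 * .reg xM) (.reg xG + 1))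
    (.block [
      .set xC (1 + (.reg xG - 2 * .reg xM) / .reg xL),
      .set xH ((2 * .reg xM * .reg xI + .reg xG - 4) % .reg xL)])
    (.block [
      .set xC 0,
      .ite (.bin .lt (.reg xMu) (.reg xI)) (.set xI (.reg xMu)) .skip,
      .set xH (.reg xA - 2 * .reg xL * .reg xI)]),
  .put yC (.reg xB) (.reg xC),
  .put yI (.reg xB) (.reg xI),
  .put yS (.reg xB) (.reg xH % .reg xM),
  .set xA (.reg xH / .reg xM)]

/-- Go up one level with the word `W`. -/
def buildProg : Cmd := .block [
  .set xM (.get yM (.reg xB)),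
  .set xS (.get yS (.reg xB)),
  .set xI (.get yI (.reg xB)),
  .ite (.get yC (.reg xB))
    (.ite (.bin .eq (.get yC (.reg xB)) 1)
      (.block [.set xQ (4 + 2 * .reg xI), .set xO ((5 + 2 * .reg xI) % .reg xM)])
      (.block [.set xO (4 + 2 * .reg xI), .set xQ ((5 + 2 * .reg xI) % .reg xM)]))
    (.block [.set xQ 2, .set xO 2]),
  .forUp xP 0 (.reg rSize - 1) (.ite (.bin .lt (.reg xP) (.reg xM))
    (.block [
      .set xV ((.reg xM - .get yW ((.reg xM + .reg xS - .reg xP) % .reg xM)) % .reg xM),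
      rotProg xV xO xQ,
      .put yZ (.reg xP) (.reg xV)])
    (.put yZ (.reg xP) (.reg xP))),
  .forUp xP 0 (.reg rSize - 1) (.put yW (.reg xP) (.get yZ (.reg xP)))]

/-- Unrank the code of the tower that has been loaded. -/
def towerUnrank : Cmd := .block [
  cardsProg,
  .set xA ((.reg rRank + (.reg rSize - 2)) % .get ySz (.reg xLen)),
  .forUp xT 1 (.reg xLen) splitProg,
  .forUp xP 0 (.reg rSize - 1) (.put yW (.reg xP) (.reg xP)),
  .forUp xB 1 (.reg xLen) buildProg,
  .forUp xP 0 (.reg rSize - 1) (.put aPi (.reg xP + 1)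
    ((.get yW (.reg xP) + (.reg rSize - 2)) % .reg rSize + 1))]

/-- The tower `t` with `len` levels is stored in the memory. -/
structure Loaded (t : Tower) (len : ℕ) (s : State) : Prop where
  levels : s.reg xLen = len
  size : s.reg rSize = t.size len
  sizes : ∀ b, 1 ≤ b → b ≤ len → s.arr yM b = t.size b
  pairs : ∀ b, 1 ≤ b → b ≤ len → s.arr yMu b = t.pairs b

theorem Loaded.frame {t : Tower} {len : ℕ} {s s' : State} {R A : List ℕ} (h : Loaded t len s)
    (hf : Frame R A s s') (h₁ : xLen ∉ R := by decide) (h₂ : rSize ∉ R := by decide)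
    (h₃ : yM ∉ A := by decide) (h₄ : yMu ∉ A := by decide) : Loaded t len s' :=
  ⟨by rw [hf.reg _ h₁, h.levels], by rw [hf.reg _ h₂, h.size], by rw [hf.arr _ h₃]; exact h.sizes,
    by rw [hf.arr _ h₄]; exact h.pairs⟩

theorem cardsProg_runs {t : Tower} {len N : ℕ} {s : State} (h : Loaded t len s) (hN : len ≤ N) :
    Runs cardsProg s (N * 60 + 60) fun s' => ∀ b ≤ len, s'.arr ySz b = t.card b := by
  refine Runs.cons_run rfl (T₁ := 10) (T₂ := N * 60 + 50) (by decide) (by omega) ?_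
  refine Runs.cons (T₁ := N * 60 + 40) (T₂ := 1) ?_ (by omega) fun s' h => Runs.block_nil le_rfl h
  refine (Runs.forUp_frame (T := 30) (N := N) (a := 1) (b := len)
    (I := fun i s' => ∀ b < i, s'.arr ySz b = t.card b) rfl (by decide) (fun _ _ _ h => h) ?_ (by omega)
    (by omega) ?_ ?_).mono ?_ fun s' h b hb => h.1 b (by omega)
  · intro b hb
    obtain rfl : b = 0 := by omega
    simp [Tower.card]
  · intro s' hf
    have := hf.reg xLen (by decide)
    simpa [h.levels] using this
  · intro i s' h₁ h₂ hx hf hI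
    have e₁ := hf.arr yM (by decide)
    have e₂ := hf.arr yMu (by decide)
    refine Runs.straight rfl (by decide) fun b hb => ?_
    obtain ⟨i, rfl⟩ : ∃ j, i = j + 1 := ⟨i - 1, by omega⟩
    rcases Nat.lt_or_ge b (i + 1) with hb' | hb'
    · have : b ≠ i + 1 := by omega
      simp [hx, this, hI b hb']
    · obtain rfl : b = i + 1 := by omega
      have e₃ : s'.arr yM (i + 1) = t.size (i + 1) := by
        rw [e₁]; simpa using h.sizes (i + 1) h₁ h₂
      have e₄ : s'.arr yMu (i + 1) = t.pairs (i + 1) := by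
        rw [e₂]; simpa using h.pairs (i + 1) h₁ h₂
      simp [hx, e₃, e₄, hI i (by omega), Tower.card]
  · change N * (30 + 1 + 9) + 1 + 1 + 6 ≤ _
    omega

/-- A loop that fills the cells `off, off + 1, …` of an array. -/
theorem Runs.fill {x : ℕ} {hi : Expr} {p : Cmd} {s : State} {T n : ℕ} (A off : ℕ) (f : ℕ → ℕ)
    (hn : 0 < n) (hx : x ∉ p.regs)
    (hhi : ∀ s', Frame (x :: p.regs) p.arrs s s' → hi.eval s' = n - 1)
    (step : ∀ i < n, ∀ s', s'.reg x = i → Frame (x :: p.regs) p.arrs s s' →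
      Runs p s' T fun s'' => s''.arr A (i + off) = f i ∧
        ∀ j < i, s''.arr A (j + off) = s'.arr A (j + off)) :
    Runs (.forUp x 0 hi p) s (n * (T + hi.cost + 9) + hi.cost + 7)
      fun s' => (∀ i < n, s'.arr A (i + off) = f i) ∧ Frame (x :: p.regs) p.arrs s s' := by
  refine (Runs.forUp_frame (T := T) (N := n) (a := 0) (b := n - 1)
    (I := fun i s' => ∀ j < i, s'.arr A (j + off) = f j) rfl hx (fun _ _ _ h => h)
    (fun _ h => absurd h (Nat.not_lt_zero _)) (by omega) (by omega) hhi ?_).mono ?_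
    fun s' h => ⟨fun i hi => h.1 i (by omega), h.2⟩
  · intro i s' _ h₂ h₃ hf hI
    refine (step i (by omega) s' h₃ hf).imp fun s'' h j hj => ?_
    rcases Nat.lt_or_ge j i with h' | h'
    · rw [h.2 j h', hI j h']
    · obtain rfl : j = i := by omega
      exact h.1
  · change n * (T + hi.cost + 9) + 1 + hi.cost + 6 ≤ _
    omega

/-! ### Recovering rotation, copy and lower word from a word -/

namespace Tower

variable {t : Tower} {n : ℕ}

theorem Valid.hub_bound (h : t.Valid n) {b : ℕ} (hb : b < n) :
    2 * t.size (b + 1) * t.pairs (b + 1) ≤ t.hubCard b := by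
  have h₁ := (isCode h b hb.le).le
  rcases h.pairs b hb with h₂ | ⟨h₂, h₃⟩
  · simp [h₂]
  · calc 2 * t.size (b + 1) * t.pairs (b + 1) = t.size (b + 1) * (2 * t.pairs (b + 1)) := by ring
      _ ≤ t.size (b + 1) * t.card b := Nat.mul_le_mul_left _ (by omega)

theorem Valid.hub_lt (h : t.Valid n) {b r : ℕ} (hb : b < n) (hr : r < t.card (b + 1)) :
    t.hub b r < t.hubCard b :=
  hubOf_lt (h.two_le_size hb) (h.hub_bound hb) hr

theorem Valid.below_lt (h : t.Valid n) {b r : ℕ} (hb : b < n) (hr : r < t.card (b + 1)) :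
    t.hub b r / t.size (b + 1) < t.card b :=
  Nat.div_lt_of_lt_mul (h.hub_lt hb hr)

theorem Valid.rankOf_eq (h : t.Valid n) {b : ℕ} (hb : b < n) (r : ℕ) :
    rankOf (t.size (b + 1)) (t.pairs (b + 1)) (t.hubCard b) (t.copy b r) (t.pair b r)
      (t.hub b r) = r :=
  RankMod.rankOf_eq (h.two_le_size hb) (h.hub_bound hb)

theorem Valid.pair_lt (h : t.Valid n) {b r : ℕ} (hb : b < n) :
    t.copy b r = 0 ∨ 2 * t.pair b r + 5 ≤ t.size (b + 1) := by
  rcases copyOf_eq_zero_or (m := t.size (b + 1)) (μ := t.pairs (b + 1)) (L := t.hubCard b) (r := r)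
    (h.two_le_size hb) with hc | hc
  · exact .inl hc
  · right
    have h₁ := h.pairs b hb
    have h₂ : t.pair b r < t.pairs (b + 1) := hc
    omega

theorem Valid.copy_le (h : t.Valid n) {b r : ℕ} (hb : b < n) : t.copy b r ≤ 2 :=
  copyOf_le (h.two_le_size hb)

/-- The relabellings never touch the element 1, so its position marks the rotation in the hub and in
all copies alike. -/
theorem elem_ne_one {m c i : ℕ} (h : c = 0 ∨ 2 * i + 5 ≤ m) :
    elemQ m c i ≠ 1 ∧ elemO m c i ≠ 1 := by
  unfold elemQ elemO
  rcases h with h | h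
  · simp [h]
  · rw [five_add_mod h]
    constructor <;> split_ifs <;> omega

theorem rotThree_elem_inverse {m c i : ℕ} (h : c = 0 ∨ 2 * i + 5 ≤ m) (v : ℕ) :
    rotThree (elemO m c i) (elemQ m c i) (rotThree (elemQ m c i) (elemO m c i) v) = v := by
  by_cases h0 : c = 0
  · simp [elemQ, elemO, h0, rotThree_two]
  · have h1 : elemQ m c i ≠ 2 ∧ elemO m c i ≠ 2 ∧ elemQ m c i ≠ elemO m c i := by
      unfold elemQ elemO
      rw [five_add_mod (by omega)]
      refine ⟨?_, ?_, ?_⟩ <;> split_ifs <;> omega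
    exact rotThree_inverse h1.1 h1.2.1 h1.2.2 v

/-- The element `1` and the element after it determine the rotation and the copy of the hub. -/
theorem Valid.word_one (h : t.Valid n) {b : ℕ} (hb : b < n) (r : ℕ) {p : ℕ}
    (hp : p < t.size (b + 1)) :
    (t.word (b + 1) r p = 1 ↔
      t.hub b r % t.size (b + 1) = (p + t.size (b + 1) - 1) % t.size (b + 1)) := by
  have hsize := h.two_le_size hb
  have H := isCode h b hb.le
  have hlt := h.size_lt b hb
  have hc := h.pair_lt (r := r) hb
  have hle := h.copy_le (r := r) hb
  set m := t.size (b + 1) with hm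
  set s := t.hub b r % m with hs
  set c := t.copy b r
  set i := t.pair b r
  set z := t.word b (t.hub b r / m)
  have hs' : s < m := Nat.mod_lt _ (by omega)
  have e : t.word (b + 1) r p = rotThree (elemQ m c i) (elemO m c i)
      ((m - z ((m + s - p) % m)) % m) := by
    rw [word, ← hm, if_pos hp, lift, if_pos hp]
  have hrot : ∀ v, rotThree (elemQ m c i) (elemO m c i) v = 1 ↔ v = 1 := by
    intro v
    obtain ⟨h1, h2⟩ := elem_ne_one hc
    unfold rotThree
    split_ifs <;> omega
  rw [e, hrot]
  have hp1 : (p + m - 1) % m = if p = 0 then m - 1 else p - 1 := by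
    split_ifs with h0
    · rw [h0, Nat.mod_eq_of_lt (by omega)]; omega
    · rw [show p + m - 1 = p - 1 + m by omega, Nat.add_mod_right, Nat.mod_eq_of_lt (by omega)]
  rw [hp1]
  have hx : (m + s - p) % m < m := Nat.mod_lt _ (by omega)
  -- The element 1 comes from the lower value `m - 1`, which lies outside the smaller code and is
  -- therefore attained only at the fixed point `m - 1`.
  have key : (m - z ((m + s - p) % m)) % m = 1 ↔ (m + s - p) % m = m - 1 := by
    constructor
    · intro h1
      have hz : z ((m + s - p) % m) = m - 1 := by
        have hzlt : z ((m + s - p) % m) < m := by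
          rcases Nat.lt_or_ge ((m + s - p) % m) (t.size b) with h2 | h2
          · exact (H.lt _ _ h2).trans hlt
          · rw [show z ((m + s - p) % m) = _ from H.fix _ _ h2]; exact hx
        rcases Nat.eq_zero_or_pos (z ((m + s - p) % m)) with h0 | h0
        · rw [h0, Nat.sub_zero, Nat.mod_self] at h1; omega
        · rw [Nat.mod_eq_of_lt (by omega)] at h1; omega
      rcases Nat.lt_or_ge ((m + s - p) % m) (t.size b) with h2 | h2
      · have h3 : z ((m + s - p) % m) < _ := H.lt _ _ h2
        omega
      · rw [show z ((m + s - p) % m) = _ from H.fix _ _ h2] at hz; exact hz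
    · intro h1
      rw [h1, show z (m - 1) = _ from H.fix _ _ (by omega), show m - (m - 1) = 1 by omega,
        Nat.mod_eq_of_lt (by omega)]
  rw [key, sub_mod_of_lt hp hs']
  split_ifs <;> omega

/-- With pairs present the lower word also fixes `m - 2`, so in the hub 2 comes right after 1; a
copy replaces this 2 by its `q`, which identifies the copy. -/
theorem Valid.word_two (h : t.Valid n) {b : ℕ} (hb : b < n) (r : ℕ)
    (hpairs : t.pairs (b + 1) ≠ 0) :
    t.word (b + 1) r ((t.hub b r % t.size (b + 1) + 2) % t.size (b + 1)) =
      elemQ (t.size (b + 1)) (t.copy b r) (t.pair b r) := by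
  have hsize := h.pairs b hb
  have H := isCode h b hb.le
  set m := t.size (b + 1) with hm
  set s := t.hub b r % m with hs
  have hs' : s < m := Nat.mod_lt _ (by omega)
  have e₁ : (s + 2) % m = if s + 2 < m then s + 2 else s + 2 - m := by
    split_ifs with h0
    · exact Nat.mod_eq_of_lt h0
    · rw [Nat.mod_eq_sub_mod (by omega), Nat.mod_eq_of_lt (by omega)]
  have hlt : (s + 2) % m < m := Nat.mod_lt _ (by omega)
  have e₂ : (m + s - (s + 2) % m) % m = m - 2 := by
    rw [sub_mod_of_lt hlt hs', e₁]
    split_ifs <;> omega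
  rw [word, ← hm, if_pos hlt, lift, if_pos hlt, e₂, H.fix _ _ (by omega),
    show m - (m - 2) = 2 by omega, Nat.mod_eq_of_lt (by omega), rotThree, if_pos rfl]

/-- The word one level below, from the word. -/
theorem Valid.word_below (h : t.Valid n) {b : ℕ} (hb : b < n) (r : ℕ) {p : ℕ}
    (hp : p < t.size (b + 1)) :
    (t.size (b + 1) - rotThree (elemO (t.size (b + 1)) (t.copy b r) (t.pair b r))
      (elemQ (t.size (b + 1)) (t.copy b r) (t.pair b r))
      (t.word (b + 1) r ((t.size (b + 1) + t.hub b r % t.size (b + 1) - p) % t.size (b + 1)))) %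
        t.size (b + 1) = t.word b (t.hub b r / t.size (b + 1)) p := by
  have hsize := h.two_le_size hb
  have H := isCode h b hb.le
  have hlt := h.size_lt b hb
  have hc := h.pair_lt (r := r) hb
  have hle := h.copy_le (r := r) hb
  set m := t.size (b + 1) with hm
  set s := t.hub b r % m with hs
  set c := t.copy b r with hcdef
  set i := t.pair b r with hidef
  have hs' : s < m := Nat.mod_lt _ (by omega)
  have hx : (m + s - p) % m < m := Nat.mod_lt _ (by omega)
  rw [word, ← hm, if_pos hx, ← hcdef, ← hidef, rotThree_elem_inverse hc, lift, if_pos hx, ← hs]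
  have e : (m + s - (m + s - p) % m) % m = p := by
    rw [sub_mod_of_lt hx hs', sub_mod_of_lt hp hs']
    split_ifs <;> omega
  rw [e]
  have hz : t.word b (t.hub b r / m) p < m := by
    rcases Nat.lt_or_ge p (t.size b) with h2 | h2
    · exact (H.lt _ _ h2).trans hlt
    · rw [H.fix _ _ h2]; exact hp
  set z := t.word b (t.hub b r / m) p
  rcases Nat.eq_zero_or_pos z with h0 | h0
  · rw [h0, Nat.sub_zero, Nat.mod_self, Nat.sub_zero, Nat.mod_self]
  · rw [Nat.mod_eq_of_lt (show m - z < m by omega), show m - (m - z) = z by omega, Nat.mod_eq_of_lt hz]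

end Tower

/-! ### Correctness of the subroutines for towers -/

@[simp] theorem rotProg_reg (v x x' y : ℕ) (s : State) :
    ((rotProg v x x').run s).reg y =
      if y = v then rotThree (s.reg x') (s.reg x) (s.reg v) else s.reg y := by
  simp only [rotProg, Cmd.run, Expr.eval_eq, Expr.eval_reg, Expr.eval_ofNat, rotThree]
  split_ifs <;> simp_all

@[simp] theorem rotProg_arr (v x x' : ℕ) (s : State) : ((rotProg v x x').run s).arr = s.arr := by
  simp only [rotProg, Cmd.run, Expr.eval_eq, Expr.eval_reg, Expr.eval_ofNat]
  split_ifs <;> rfl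

/-- The elements that can follow 1 separate the copies: 2 is the hub, the even numbers from 4 on are
the first copies, the odd ones from 5 on the second copies. The value 0 is the wrapped case `5 + 2 *
i = m`. On a level without pairs only the hub exists and no entry is inspected. -/
theorem classifyProg_runs {m μ c i b : ℕ} {s : State} (hB : s.reg xB = b) (hM : s.reg xM = m)
    (hMu : s.arr yMu b = μ) (hμ : μ = 0 → c = 0)
    (hW : μ ≠ 0 → s.arr yW ((s.reg xS + 2) % m) = elemQ m c i) (hc : c ≤ 2)
    (hci : c = 0 ∨ 2 * i + 5 ≤ m ∧ m % 2 = 1) :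
    Runs classifyProg s 100 fun s' => s'.reg xQ = elemQ m c i ∧ s'.reg xO = elemO m c i ∧
      s'.reg xC = c ∧ (c ≠ 0 → s'.reg xI = i) := by
  have hmod : 2 * i + 5 ≤ m → _ := Tower.five_add_mod (m := m) (i := i)
  refine Runs.cons (T₁ := 20) (T₂ := 80) (Runs.straight rfl (by decide)
    (Q := fun s' => s'.reg xQ = elemQ m c i) ?_).frame le_rfl ?_
  · by_cases h : μ = 0
    · simp [hB, hMu, h, hμ h, elemQ]
    · simp [hB, hMu, h, hM, hW h]
  · rintro s' ⟨hQ, hf⟩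
    have hM' : s'.reg xM = m := (hf.reg _ (by decide)).trans hM
    refine Runs.straight rfl (by decide) ?_
    have e₂ : elemO m c i = if c = 0 then 2 else if c = 1 then (5 + 2 * i) % m else 4 + 2 * i := rfl
    have e₁ : elemQ m c i = if c = 0 then 2 else if c = 1 then 4 + 2 * i else (5 + 2 * i) % m := rfl
    have hc' : c = 0 ∨ c = 1 ∨ c = 2 := by omega
    rcases hc' with rfl | rfl | rfl
    · simp only [if_true] at e₁ e₂
      rw [e₁] at hQ
      simp [hQ, e₁, e₂]
    · simp only [if_true, one_ne_zero, if_false] at e₁ e₂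
      rw [e₁] at hQ
      have h1 : 4 + 2 * i ≠ 2 := by omega
      have h2 : (4 + 2 * i) % 2 = 0 := by omega
      have h3 : 4 + 2 * i + 1 = 5 + 2 * i := by omega
      simp [hQ, e₁, e₂, hM', h1, h2, h3]
    · have h5 : 2 * i + 5 ≤ m := by omega
      have e₄ := hmod h5
      simp only [OfNat.ofNat_ne_zero, OfNat.ofNat_ne_one, if_false] at e₁ e₂
      rw [e₄] at e₁
      rw [e₁] at hQ
      split_ifs at e₁ hQ with h6
      · have h7 : m - 1 = 4 + 2 * i := by omega
        have h8 : (m - 5) / 2 = i := by omega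
        simp [hQ, e₁, e₂, hM', h7, h8]
      · have h1 : 5 + 2 * i ≠ 2 := by omega
        have h2 : (5 + 2 * i) % 2 = 1 := by omega
        have h3 : 5 + 2 * i - 1 = 4 + 2 * i := by omega
        simp [hQ, e₁, e₂, h1, h2, h3]

/-- The data that `peelProg` and `splitProg` store about the rank `r` of the level `b + 1`. -/
structure Stored (t : Tower) (b r : ℕ) (s : State) : Prop where
  rotation : s.arr yS (b + 1) = t.hub b r % t.size (b + 1)
  copy : s.arr yC (b + 1) = t.copy b r
  pair : t.copy b r ≠ 0 → s.arr yI (b + 1) = t.pair b r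

theorem Stored.congr {t : Tower} {b r : ℕ} {s s' : State} (h : Stored t b r s)
    (h₁ : s'.arr yS (b + 1) = s.arr yS (b + 1)) (h₂ : s'.arr yC (b + 1) = s.arr yC (b + 1))
    (h₃ : s'.arr yI (b + 1) = s.arr yI (b + 1)) : Stored t b r s' :=
  ⟨h₁.trans h.rotation, h₂.trans h.copy, fun hc => h₃.trans (h.pair hc)⟩

/-- One pass finds the rotation, constant work finds the copy, and a second pass undoes relabelling
and lift. Two arrays are needed because the lift permutes the positions; a final pass copies back.
-/
theorem peelProg_runs {t : Tower} {len b r N : ℕ} {s : State} (h : Loaded t len s)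
    (hv : t.Valid len) (hb : b < len) (hT : s.reg xT = len - b) (hN : t.size (b + 1) ≤ N)
    (hW : ∀ p < t.size (b + 1), s.arr yW p = t.word (b + 1) r p) :
    Runs peelProg s (N * 200 + 300) fun s' =>
      (∀ p < t.size (b + 1), s'.arr yW p = t.word b (t.hub b r / t.size (b + 1)) p) ∧
      Stored t b r s' ∧
      ∀ b', b' ≠ b + 1 → s'.arr yS b' = s.arr yS b' ∧ s'.arr yC b' = s.arr yC b' ∧
        s'.arr yI b' = s.arr yI b' := by
  have hsize := hv.two_le_size hb
  have hpairs := hv.pairs b hb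
  have hci := hv.pair_lt (r := r) hb
  have hcle := hv.copy_le (r := r) hb
  have hodd : t.copy b r = 0 ∨ 2 * t.pair b r + 5 ≤ t.size (b + 1) ∧ t.size (b + 1) % 2 = 1 := by
    rcases copyOf_eq_zero_or (m := t.size (b + 1)) (μ := t.pairs (b + 1)) (L := t.hubCard b) (r := r)
      hsize with hc | hc
    · exact .inl hc
    · omega
  have hzero : t.pairs (b + 1) = 0 → t.copy b r = 0 := fun h0 => by
    rcases copyOf_eq_zero_or (m := t.size (b + 1)) (μ := t.pairs (b + 1)) (L := t.hubCard b) (r := r)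
      hsize with hc | hc
    · exact hc
    · rw [h0] at hc; exact absurd hc (Nat.not_lt_zero _)
  have hone := fun p hp => hv.word_one hb r (p := p) hp
  have htwo := hv.word_two hb r
  have hbelow := fun p hp => hv.word_below hb r (p := p) hp
  set m := t.size (b + 1) with hm
  set σ := t.hub b r % m with hσ
  have hσm : σ < m := Nat.mod_lt _ (by omega)
  refine Runs.cons (T₁ := 10) (T₂ := N * 200 + 290) (Runs.straight rfl (by decide)
    (Q := fun s' => s'.reg xB = b + 1) ?_).frame (by omega) ?_
  · simp [h.levels, hT]; omega
  rintro s₁ ⟨hB₁, f₁⟩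
  have l₁ := h.frame f₁
  refine Runs.cons (T₁ := 10) (T₂ := N * 200 + 280) (Runs.straight rfl (by decide)
    (Q := fun s' => s'.reg xM = m) ?_).frame (by omega) ?_
  · simp [hB₁, l₁.sizes (b + 1) (by omega) (by omega), hm]
  rintro s₂ ⟨hM₂, f₂⟩
  have f₂' := (f₁.mono (R' := [xB, xM]) (A' := []) (by decide) (by decide)).trans
    (f₂.mono (R' := [xB, xM]) (A' := []) (by decide) (by decide))
  have hB₂ : s₂.reg xB = b + 1 := (f₂.reg _ (by decide)).trans hB₁
  have hW₂ : s₂.arr yW = s.arr yW := f₂'.arr _ (by decide)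
  refine Runs.cons (T₁ := N * 42 + 20) (T₂ := N * 150 + 260)
    (Q := fun s' => s'.reg xS = σ ∧ Frame [xP, xS] [] s₂ s') ?_ (by omega) ?_
  -- The register is only meaningful once the entry 1 has been met, hence the conditional invariant;
  -- the position `(σ + 1) % m` witnesses that it is met.
  · refine (Runs.forUp_frame (T := 30) (N := N) (a := 0) (b := m - 1)
      (I := fun i s' => ∀ p < i, s.arr yW p = 1 → s'.reg xS = σ) rfl (by decide)
      (fun i s' v h => by simpa using h) (fun _ h => absurd h (Nat.not_lt_zero _)) (by omega)
      (by omega) ?_ ?_).mono ?_ ?_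
    · intro s' hf
      simp [(hf.reg xM (by decide)).trans hM₂]
    · intro i s' _ h₂ h₃ hf hI
      refine Runs.straight rfl (by decide) fun p hp hp1 => ?_
      have e₁ : s'.arr yW = s.arr yW := (hf.arr _ (by decide)).trans hW₂
      have e₂ : s'.reg xM = m := (hf.reg _ (by decide)).trans hM₂
      by_cases hi : s.arr yW i = 1
      · rw [hW i (by omega), hone i (by omega)] at hi
        simp [h₃, e₁, hi, e₂, hW i (show i < m by omega), hone i (show i < m by omega)]
      · have : p ≠ i := fun h => hi (h ▸ hp1)
        simp [h₃, e₁, hi, hI p (by omega) hp1]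
    · change N * (30 + 3 + 9) + 1 + 3 + 6 ≤ _
      omega
    · rintro s' ⟨h₁, h₂⟩
      refine ⟨h₁ ((σ + 1) % m) (by have := Nat.mod_lt (σ + 1) (show m > 0 by omega); omega) ?_, h₂⟩
      have hlt := Nat.mod_lt (σ + 1) (show m > 0 by omega)
      rw [hW _ hlt, hone _ hlt, Tower.add_one_mod_eq hσm]
      split_ifs with h0
      · rw [Nat.mod_eq_of_lt (by omega)]; omega
      · rw [show σ + 1 + m - 1 = σ + m by omega, Nat.add_mod_right, Nat.mod_eq_of_lt hσm]
  rintro s₃ ⟨hS₃, f₃⟩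
  have f₃' := (f₂'.mono (R' := [xB, xM, xP, xS]) (A' := []) (by decide) (by decide)).trans
    (f₃.mono (by decide) (by decide))
  have hB₃ : s₃.reg xB = b + 1 := (f₃.reg _ (by decide)).trans hB₂
  have hM₃ : s₃.reg xM = m := (f₃.reg _ (by decide)).trans hM₂
  have hW₃ : s₃.arr yW = s.arr yW := f₃'.arr _ (by decide)
  refine Runs.cons (T₁ := 100) (T₂ := N * 150 + 160) (classifyProg_runs (c := t.copy b r)
    (i := t.pair b r) hB₃ hM₃ ((congrFun (f₃'.arr yMu (by decide)) _).trans
      (h.pairs (b + 1) (by omega) (by omega))) hzero ?_ hcle hodd).frame (by omega) ?_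
  · intro h0
    rw [hS₃, hW₃, hW _ (Nat.mod_lt _ (by omega))]
    exact htwo h0
  rintro s₄ ⟨⟨hQ₄, hO₄, hC₄, hI₄⟩, f₄⟩
  have f₄' := (f₃'.mono (R' := [xB, xM, xP, xS, xQ, xO, xC, xI]) (A' := []) (by decide) (by decide)).trans
    (f₄.mono (by decide) (by decide))
  have hB₄ : s₄.reg xB = b + 1 := (f₄.reg _ (by decide)).trans hB₃
  have hM₄ : s₄.reg xM = m := (f₄.reg _ (by decide)).trans hM₃
  have hS₄ : s₄.reg xS = σ := (f₄.reg _ (by decide)).trans hS₃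
  have hW₄ : s₄.arr yW = s.arr yW := f₄'.arr _ (by decide)
  refine Runs.cons_run rfl (T₁ := 10) (T₂ := N * 150 + 150) (by decide) (by omega) ?_
  refine Runs.cons_run rfl (T₁ := 10) (T₂ := N * 150 + 140) (by decide) (by omega) ?_
  refine Runs.cons (T₁ := 10) (T₂ := N * 150 + 130) (Runs.straight rfl (by decide)
    (Q := fun s' => Stored t b r s' ∧ (∀ b', b' ≠ b + 1 → s'.arr yS b' = s.arr yS b' ∧
      s'.arr yC b' = s.arr yC b' ∧ s'.arr yI b' = s.arr yI b') ∧ Frame [] [yS, yC, yI] s₄ s') ?_)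
    (by omega) ?_
  · refine ⟨⟨?_, ?_, fun hc => ?_⟩, fun b' hb' => ?_, fun _ _ => rfl, fun a ha => ?_⟩
    · simp [hB₄, hS₄, hσ, hm]
    · simp [hB₄, hC₄]
    · simp [hB₄, hI₄ hc]
    · have e₁ := f₄'.arr yS (by decide)
      have e₂ := f₄'.arr yC (by decide)
      have e₃ := f₄'.arr yI (by decide)
      simp [hB₄, hb', e₁, e₂, e₃]
    · simp only [List.mem_cons, List.not_mem_nil, or_false, not_or] at ha
      funext j
      simp [ha.1, ha.2.1, ha.2.2]
  rintro s₅ ⟨hst₅, hk₅, f₅⟩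
  have hW₅ : s₅.arr yW = s.arr yW := (f₅.arr _ (by decide)).trans hW₄
  have hM₅ : s₅.reg xM = m := (f₅.reg _ (by decide)).trans hM₄
  have hS₅ : s₅.reg xS = σ := (f₅.reg _ (by decide)).trans hS₄
  have hQ₅ := (f₅.reg xQ (by decide)).trans hQ₄
  have hO₅ := (f₅.reg xO (by decide)).trans hO₄
  refine Runs.cons (T₁ := m * (60 + 3 + 9) + 3 + 7) (T₂ := N * 50 + 50) (Runs.fill (T := 60) yZ 0
    (fun p => t.word b (t.hub b r / m) p) (n := m) (by omega) (by decide) ?_ ?_) ?_ ?_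
  · intro s' hf
    simp [(hf.reg xM (by decide)).trans hM₅]
  · intro i hi s' hx hf
    have e₁ := (hf.reg xM (by decide)).trans hM₅
    have e₂ := (hf.reg xS (by decide)).trans hS₅
    have e₃ := (hf.reg xQ (by decide)).trans hQ₅
    have e₄ := (hf.reg xO (by decide)).trans hO₅
    have e₅ : s'.arr yW = s.arr yW := (hf.arr yW (by decide)).trans hW₅
    refine Runs.straight rfl (by decide) ⟨?_, fun j hj => ?_⟩
    · simp [hx, e₁, e₂, e₃, e₄, e₅, hW _ (Nat.mod_lt (m + σ - i) (show m > 0 by omega)), hbelow i hi]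
    · have : j ≠ i := by omega
      simp [hx, this]
  · omega
  rintro s₆ ⟨hZ₆, f₆⟩
  have hM₆ : s₆.reg xM = m := (f₆.reg _ (by decide)).trans hM₅
  refine Runs.cons (T₁ := m * (20 + 3 + 9) + 3 + 7) (T₂ := 10) (Runs.fill (T := 20) yW 0
    (fun p => t.word b (t.hub b r / m) p) (n := m) (by omega) (by decide) ?_ ?_) ?_ ?_
  · intro s' hf
    simp [(hf.reg xM (by decide)).trans hM₆]
  · intro i hi s' hx hf
    have e₁ := hf.arr yZ (by decide)
    refine Runs.straight rfl (by decide) ⟨?_, fun j hj => ?_⟩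
    · have := hZ₆ i hi
      simp only [Nat.add_zero] at this
      simp [hx, e₁, this]
    · have : j ≠ i := by omega
      simp [hx, this]
  · omega
  rintro s₇ ⟨hW₇, f₇⟩
  have e₁ : s₇.arr yS = s₅.arr yS := (f₇.arr _ (by decide)).trans (f₆.arr _ (by decide))
  have e₂ : s₇.arr yC = s₅.arr yC := (f₇.arr _ (by decide)).trans (f₆.arr _ (by decide))
  have e₃ : s₇.arr yI = s₅.arr yI := (f₇.arr _ (by decide)).trans (f₆.arr _ (by decide))
  refine Runs.block_nil (by omega) ⟨hW₇, hst₅.congr (by rw [e₁]) (by rw [e₂]) (by rw [e₃]), ?_⟩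
  intro b' hb'
  rw [e₁, e₂, e₃]
  exact hk₅ b' hb'

/-! ### Sequences of ranks along the levels -/

namespace Tower

/-- The ranks of the words that underlie a word, level by level. -/
def Trace (t : Tower) (len : ℕ) (ρ : ℕ → ℕ) : Prop :=
  ∀ b < len, ρ b = t.hub b (ρ (b + 1)) / t.size (b + 1)

/-- The recursion runs from the top level downwards, so it is carried out in the distance from the
top and then reindexed. -/
theorem exists_trace (t : Tower) (len R : ℕ) : ∃ ρ, ρ len = R ∧ t.Trace len ρ := by
  let f : ℕ → ℕ := fun k => Nat.rec R (fun k r => t.hub (len - (k + 1)) r / t.size (len - k)) k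
  refine ⟨fun b => f (len - b), by simp [f], fun b hb => ?_⟩
  simp only []
  obtain ⟨k, hk⟩ : ∃ k, len - b = k + 1 := ⟨len - b - 1, by omega⟩
  rw [hk, show len - (b + 1) = k by omega]
  change t.hub (len - (k + 1)) (f k) / t.size (len - k) = _
  rw [show len - (k + 1) = b by omega, show len - k = b + 1 by omega]

theorem Valid.trace_lt {t : Tower} {len : ℕ} {ρ : ℕ → ℕ} (h : t.Valid len) (hρ : t.Trace len ρ)
    (h₀ : ρ len < t.card len) : ∀ b ≤ len, ρ b < t.card b := by
  intro b hb
  induction hb using Nat.decreasingInduction with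
  | self => exact h₀
  | of_succ b hb ih =>
    rw [hρ b hb]
    exact h.below_lt hb ih

/-- There are fewer levels than positions; linear work per level thus gives quadratic work in all.
-/
theorem Valid.lt_size {t : Tower} {len : ℕ} (h : t.Valid len) : ∀ b ≤ len, b < t.size b := by
  intro b
  induction b with
  | zero => intro _; rw [h.size_zero]; omega
  | succ b ih =>
    intro hb
    have := ih (by omega)
    have := h.size_lt b (by omega)
    omega

theorem Valid.size_le {t : Tower} {len : ℕ} (h : t.Valid len) : ∀ b ≤ len, t.size b ≤ t.size len := by
  intro b hb
  induction hb using Nat.decreasingInduction with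
  | self => exact le_rfl
  | of_succ b hb ih => exact (h.size_lt b hb).le.trans ih

end Tower

/-- The program evaluates the formula of `rankOf` on the stored rotation, copy and pair, so the
claim is `Valid.rankOf_eq`. In the hub the pair index is not stored but computed from the hub rank.
-/
theorem collectProg_runs {t : Tower} {len b r : ℕ} {s : State} (h : Loaded t len s)
    (hv : t.Valid len) (hb : b < len) (hB : s.reg xB = b + 1) (hst : Stored t b r s)
    (hSz : s.arr ySz b = t.card b) (hA : s.reg xA = t.hub b r / t.size (b + 1)) :
    Runs collectProg s 200 fun s' => s'.reg xA = r := by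
  have hr := hv.rankOf_eq hb r
  have e₁ := h.sizes (b + 1) (by omega) (by omega)
  have e₂ := h.pairs (b + 1) (by omega) (by omega)
  have e₃ := Nat.div_add_mod (t.hub b r) (t.size (b + 1))
  have e₄ := hst.rotation
  have e₅ := hst.copy
  refine Runs.straight rfl (by decide) ?_
  unfold rankOf at hr
  by_cases hc : t.copy b r = 0
  · rw [if_pos hc] at hr
    have e : ∀ x y : ℕ, min x y = if y ≤ x then y else x := fun x y => by
      rw [Nat.min_def]; split_ifs <;> omega
    rw [e] at hr
    unfold Tower.hubCard at hr
    simp [collectProg, hB, e₁, e₂, hA, e₄, e₅, hc, hSz, e₃]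
    split_ifs at hr ⊢ <;> exact hr
  · rw [if_neg hc] at hr
    have e₆ := hst.pair hc
    simp [collectProg, hB, e₁, e₂, hA, e₄, e₅, e₆, hc, hSz, e₃]
    exact hr

/-- Undoes the change of the starting word of a cyclic code. -/
theorem mod_shift {M a r : ℕ} (ha : a ≤ M) (hr : r < M) : ((r + a) % M + M - a) % M = r := by
  rcases Nat.lt_or_ge (r + a) M with h | h
  · rw [Nat.mod_eq_of_lt h, show r + a + M - a = r + M by omega, Nat.add_mod_right,
      Nat.mod_eq_of_lt hr]
  · rw [Nat.mod_eq_sub_mod h]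
    rcases Nat.lt_or_ge (r + a - M) M with h' | h'
    · rw [Nat.mod_eq_of_lt h', show r + a - M + M - a = r by omega, Nat.mod_eq_of_lt hr]
    · omega

/-- Peeling from the top records the data of every level and discovers the trace of ranks
implicitly; collecting from the bottom rebuilds that trace, ending with the rank before the cyclic
shift by `n - 2`. -/
theorem towerRank_runs {t : Tower} {len r : ℕ} {s : State} (h : Loaded t len s)
    (hv : t.Valid len) (hlen : 0 < len) (hr : r < t.card len)
    (hpi : ∀ p < t.size len, s.arr aPi (p + 1) = t.vec len r p + 1) :
    Runs towerRank s (t.size len * (t.size len * 200 + 700) + 500) fun s' => s'.reg rRank = r := by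
  have hcode := Tower.isCode hv len le_rfl
  have hle := hcode.le
  have hn2 : 2 ≤ t.size len := by
    obtain ⟨b, rfl⟩ : ∃ b, len = b + 1 := ⟨len - 1, by omega⟩
    exact hv.two_le_size (by omega)
  have hlt := hv.lt_size len le_rfl
  set n := t.size len with hn
  have hrank : (r + (n - 2)) % t.card len < t.card len := Nat.mod_lt _ (by omega)
  obtain ⟨ρ, hρ₀, hρ⟩ := t.exists_trace len ((r + (n - 2)) % t.card len)
  have hρlt := hv.trace_lt hρ (by rw [hρ₀]; exact hrank)
  refine Runs.cons (T₁ := n * 60 + 60) (T₂ := n * (n * 200 + 640) + 440)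
    (cardsProg_runs h hlt.le).frame (by simp only [Nat.mul_add]; omega) ?_
  rintro s₁ ⟨hSz₁, f₁⟩
  have l₁ := h.frame f₁
  have hpi₁ := f₁.arr aPi (by decide)
  refine Runs.cons (T₁ := n * (30 + 3 + 9) + 3 + 7) (T₂ := n * (n * 200 + 590) + 420)
    (Runs.fill (T := 30) yW 0 (fun p => t.word len (ρ len) p) (n := n) (by omega) (by decide) ?_ ?_)
    (by simp only [Nat.mul_add]; omega) ?_
  · intro s' hf
    simp [(hf.reg rSize (by decide)).trans l₁.size, hn]
  · intro i hi s' hx hf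
    have e₁ := (hf.reg rSize (by decide)).trans l₁.size
    have e₂ : s'.arr aPi = s.arr aPi := (hf.arr aPi (by decide)).trans hpi₁
    refine Runs.straight rfl (by decide) ⟨?_, fun j hj => ?_⟩
    · have hw := hcode.lt (ρ len) i hi
      simp only [Cmd.run, State.setArr_arr, Expr.eval_reg, Expr.eval_mod, Expr.eval_add,
        Expr.eval_get, Expr.eval_ofNat, hx, e₁, e₂, hpi i hi, Tower.vec, Tower.shiftWord, ← hn]
      -- Undoes the renaming by `n - 2`: one unit comes from the 1-based array and one from the
      -- program, and together they complete `n`.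
      rw [if_pos (by simp), Nat.add_assoc, Nat.mod_add_mod, ← hρ₀,
        show t.word len (ρ len) i + (n - 2) + (1 + 1) = t.word len (ρ len) i + n by omega,
        Nat.add_mod_right, Nat.mod_eq_of_lt hw]
    · have : j ≠ i := by omega
      simp [hx, this]
  rintro s₂ ⟨hW₂, f₂⟩
  simp only [Nat.add_zero] at hW₂
  have l₂ := l₁.frame f₂
  have hSz₂ : s₂.arr ySz = s₁.arr ySz := f₂.arr _ (by decide)
  refine Runs.cons (T₁ := n * (n * 200 + 300 + 1 + 9) + 8) (T₂ := n * 270 + 400)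
    (Q := fun s' => (∀ b < len, Stored t b (ρ (b + 1)) s') ∧
      Frame (xT :: peelProg.regs) peelProg.arrs s₂ s') ?_
    (by simp only [Nat.mul_add]; omega) ?_
  · refine (Runs.forUp_frame (T := n * 200 + 300) (N := n) (a := 1) (b := len)
      (I := fun i s' => (∀ p < t.size (len + 1 - i), s'.arr yW p = t.word (len + 1 - i) (ρ (len + 1 - i)) p) ∧
        ∀ b < len, len + 1 - i ≤ b → Stored t b (ρ (b + 1)) s') rfl (by decide)
      (fun i s' v h => ⟨h.1, fun b hb hb' => (h.2 b hb hb').congr rfl rfl rfl⟩) ?_ (by omega) (by omega)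
      ?_ ?_).mono ?_ fun s' h => ⟨fun b hb => h.1.2 b hb (by omega), h.2⟩
    · rw [Nat.add_sub_cancel]
      exact ⟨hW₂, fun b _ _ => by omega⟩
    · intro s' hf
      simp [(hf.reg xLen (by decide)).trans l₂.levels]
    · intro i s' h₁ h₂ hx hf hI
      obtain ⟨b, hb⟩ : ∃ b, len + 1 - i = b + 1 := ⟨len - i, by omega⟩
      rw [hb] at hI
      refine (peelProg_runs (b := b) (l₂.frame hf) hv (by omega) (by omega)
        (hv.size_le (b + 1) (by omega)) hI.1).imp fun s'' h => ?_
      rw [show len + 1 - (i + 1) = b by omega, hρ b (by omega)]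
      refine ⟨fun p hp => h.1 p (hp.trans (hv.size_lt b (by omega))), fun b' hb' hbb' => ?_⟩
      rcases Nat.eq_or_lt_of_le hbb' with rfl | hlt'
      · exact h.2.1
      · obtain ⟨e₁, e₂, e₃⟩ := h.2.2 (b' + 1) (by omega)
        exact (hI.2 b' hb' (by omega)).congr e₁ e₂ e₃
    · rw [show (Expr.reg xLen).cost = 1 from rfl, show (1 : Expr).cost = 1 from rfl]
  rintro s₃ ⟨hst₃, f₃⟩
  have l₃ := l₂.frame f₃
  have hSz₃ : s₃.arr ySz = s₁.arr ySz := (f₃.arr _ (by decide)).trans hSz₂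
  refine Runs.cons (T₁ := 10) (T₂ := n * 270 + 390) (Runs.straight rfl (by decide)
    (Q := fun s' => s'.reg xA = 0) ?_).frame (by omega) ?_
  · simp
  rintro s₄ ⟨hA₄, f₄⟩
  have l₄ := l₃.frame f₄
  have hSz₄ : s₄.arr ySz = s₁.arr ySz := (f₄.arr _ (by decide)).trans hSz₃
  refine Runs.cons (T₁ := n * (200 + 1 + 9) + 8) (T₂ := 100)
    (Q := fun s' => s'.reg xA = ρ len ∧ Frame (xB :: collectProg.regs) collectProg.arrs s₄ s') ?_
    (by omega) ?_
  · refine (Runs.forUp_frame (T := 200) (N := n) (a := 1) (b := len)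
      (I := fun i s' => s'.reg xA = ρ (i - 1)) rfl (by decide)
      (fun i s' v h => by simpa using h) ?_ (by omega) (by omega)
      ?_ ?_).mono ?_ fun s' h => ⟨by simpa using h.1, h.2⟩
    -- The lowest level has a single word, so its rank is the initial value 0.
    · have := hρlt 0 (by omega)
      rw [Tower.card] at this
      rw [hA₄, Nat.sub_self]
      omega
    · intro s' hf
      simp [(hf.reg xLen (by decide)).trans l₄.levels]
    · intro i s' h₁ h₂ hx hf hI
      obtain ⟨b, rfl⟩ : ∃ b, i = b + 1 := ⟨i - 1, by omega⟩
      have hSz' : s'.arr ySz = s₁.arr ySz := (hf.arr _ (by decide)).trans hSz₄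
      have hst' : Stored t b (ρ (b + 1)) s' := (hst₃ b (by omega)).congr
        (by rw [hf.arr _ (by decide), f₄.arr _ (by decide)])
        (by rw [hf.arr _ (by decide), f₄.arr _ (by decide)])
        (by rw [hf.arr _ (by decide), f₄.arr _ (by decide)])
      have hA' : s'.reg xA = t.hub b (ρ (b + 1)) / t.size (b + 1) := by
        rw [← hρ b (by omega)]; simpa using hI
      exact (collectProg_runs (l₄.frame hf) hv (by omega) hx hst'
        (by rw [hSz', hSz₁ b (by omega)]) hA').imp fun _ h => by simpa using h
    · change n * (200 + 1 + 9) + 1 + 1 + 6 ≤ _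
      omega
  rintro s₅ ⟨hA₅, f₅⟩
  have l₅ := l₄.frame f₅
  have hSz₅ : s₅.arr ySz = s₁.arr ySz := (f₅.arr _ (by decide)).trans hSz₄
  refine Runs.straight rfl (by decide) ?_
  simp [hA₅, l₅.size, l₅.levels, hSz₅, hSz₁ len le_rfl, ← hn]
  rw [hρ₀, mod_shift (by omega) hr]

/-- Evaluates `copyOf`, `pairOf` and `hubOf` by division with remainder. In the hub the pair index
is capped at the number of pairs, which is the minimum occurring in `hubOf`; the stored index
matters only in a copy. -/
theorem splitProg_runs {t : Tower} {len b r : ℕ} {s : State} (h : Loaded t len s)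
    (hb : b < len) (hT : s.reg xT = len - b) (hA : s.reg xA = r)
    (hSz : s.arr ySz b = t.card b) :
    Runs splitProg s 200 fun s' => s'.reg xA = t.hub b r / t.size (b + 1) ∧ Stored t b r s' ∧
      ∀ b', b' ≠ b + 1 → s'.arr yS b' = s.arr yS b' ∧ s'.arr yC b' = s.arr yC b' ∧
        s'.arr yI b' = s.arr yI b' := by
  have e₁ := h.sizes (b + 1) (by omega) (by omega)
  have e₂ := h.pairs (b + 1) (by omega) (by omega)
  have eB : len + 1 - (len - b) = b + 1 := by omega
  have eC : t.copy b r = copyOf (t.size (b + 1)) (t.pairs (b + 1)) (t.size (b + 1) * t.card b) r := rfl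
  have eP : t.pair b r = pairOf (t.size (b + 1)) (t.size (b + 1) * t.card b) r := rfl
  have eH : t.hub b r = hubOf (t.size (b + 1)) (t.pairs (b + 1)) (t.size (b + 1) * t.card b) r := rfl
  unfold copyOf at eC
  unfold pairOf at eP
  unfold hubOf at eH
  rw [← eP] at eC eH
  refine Runs.straight rfl (by decide) ?_
  by_cases hc : t.pair b r < t.pairs (b + 1) ∧
      2 * t.size (b + 1) ≤ (r + 4) % (2 * t.size (b + 1) + 2 * (t.size (b + 1) * t.card b))
  · rw [if_pos hc] at eC eH
    have hc₂ : 2 * t.size (b + 1) <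
        (r + 4) % (2 * t.size (b + 1) + 2 * (t.size (b + 1) * t.card b)) + 1 := by omega
    refine ⟨?_, ⟨?_, ?_, fun _ => ?_⟩, fun b' hb' => ?_⟩
    · simp [splitProg, h.levels, hT, eB, e₁, e₂, hA, hSz, ← eP, hc.1, hc.2, eH]
    · simp [splitProg, h.levels, hT, eB, e₁, e₂, hA, hSz, ← eP, hc.1, hc.2, eH]
    · simp [splitProg, h.levels, hT, eB, e₁, e₂, hA, hSz, ← eP, hc.1, hc.2, eC]
    · simp [splitProg, h.levels, hT, eB, e₁, e₂, hA, hSz, ← eP, hc.1, hc.2]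
    · simp [splitProg, h.levels, hT, eB, hb']
  · rw [if_neg hc] at eC eH
    have hmin : min (t.pair b r) (t.pairs (b + 1)) =
        if t.pair b r ≤ t.pairs (b + 1) then t.pair b r else t.pairs (b + 1) := rfl
    have hc' : 2 * t.size (b + 1) ≤
        (r + 4) % (2 * t.size (b + 1) + 2 * (t.size (b + 1) * t.card b)) →
          t.pairs (b + 1) ≤ t.pair b r := fun h => by
      by_contra h'
      exact hc ⟨by omega, h⟩
    rw [hmin] at eH
    refine ⟨?_, ⟨?_, ?_, fun h0 => absurd eC h0⟩, fun b' hb' => ?_⟩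
    · simp [splitProg, h.levels, hT, eB, e₁, e₂, hA, hSz, ← eP, eH]
      rw [if_pos hc']
    · simp [splitProg, h.levels, hT, eB, e₁, e₂, hA, hSz, ← eP, eH]
      rw [if_pos hc']
    · simp [splitProg, h.levels, hT, eB, e₁, e₂, hA, hSz, ← eP, eC]
      exact hc'
    · simp [splitProg, h.levels, hT, eB, hb']

/-- The array always covers the full final length: words fix the positions beyond their size, and
the next level reads those fixed entries. -/
theorem buildProg_runs {t : Tower} {len b r : ℕ} {s : State} (h : Loaded t len s)
    (hv : t.Valid len) (hb : b < len) (hB : s.reg xB = b + 1) (hst : Stored t b r s)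
    (hW : ∀ p < t.size len, s.arr yW p = t.word b (t.hub b r / t.size (b + 1)) p) :
    Runs buildProg s (t.size len * 150 + 200) fun s' =>
      ∀ p < t.size len, s'.arr yW p = t.word (b + 1) r p := by
  have hsize := hv.two_le_size hb
  have hmn := hv.size_le (b + 1) (by omega)
  have hcle := hv.copy_le (r := r) hb
  have e₁ := h.sizes (b + 1) (by omega) (by omega)
  set n := t.size len with hn
  set m := t.size (b + 1) with hm
  refine Runs.cons (T₁ := 10) (T₂ := n * 150 + 190) (Runs.straight rfl (by decide)
    (Q := fun s' => s'.reg xM = m) ?_).frame (by omega) ?_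
  · simp [hB, e₁]
  rintro s₁ ⟨hM₁, f₁⟩
  refine Runs.cons (T₁ := 10) (T₂ := n * 150 + 180) (Runs.straight rfl (by decide)
    (Q := fun s' => s'.reg xS = t.hub b r % m) ?_).frame (by omega) ?_
  · simp [hB, f₁.reg xB (by decide), f₁.arr yS (by decide), hst.rotation, hm]
  rintro s₂ ⟨hS₂, f₂⟩
  have f₂' := (f₁.mono (R' := [xM, xS]) (A' := []) (by decide) (by decide)).trans
    (f₂.mono (R' := [xM, xS]) (A' := []) (by decide) (by decide))
  have hM₂ := (f₂.reg xM (by decide)).trans hM₁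
  refine Runs.cons_run rfl (T₁ := 10) (T₂ := n * 150 + 170) (by decide) (by omega) ?_
  refine Runs.cons (T₁ := 60) (T₂ := n * 150 + 110) (Runs.straight rfl (by decide)
    (Q := fun s' => s'.reg xQ = elemQ m (t.copy b r) (t.pair b r) ∧
      s'.reg xO = elemO m (t.copy b r) (t.pair b r) ∧ Frame [xQ, xO, xI] [] s₂ s') ?_) (by omega) ?_
  · have hB₂ := (f₂'.reg xB (by decide)).trans hB
    have hC₂ : s₂.arr yC (b + 1) = t.copy b r := by rw [f₂'.arr yC (by decide), hst.copy]
    have hI₂ : t.copy b r ≠ 0 → s₂.arr yI (b + 1) = t.pair b r := fun hc => by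
      rw [f₂'.arr yI (by decide), hst.pair hc]
    refine ⟨?_, ?_, fun x hx => ?_, fun a _ => ?_⟩
    · rcases (by omega : t.copy b r = 0 ∨ t.copy b r = 1 ∨ t.copy b r = 2) with hc | hc | hc
      · simp [hB₂, hC₂, hc, elemQ]
      · have := hI₂ (by omega)
        simp [hB₂, hC₂, hc, this, elemQ]
      · have := hI₂ (by omega)
        simp [hB₂, hC₂, hc, this, elemQ, hM₂]
    · rcases (by omega : t.copy b r = 0 ∨ t.copy b r = 1 ∨ t.copy b r = 2) with hc | hc | hc
      · simp [hB₂, hC₂, hc, elemO]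
      · have := hI₂ (by omega)
        simp [hB₂, hC₂, hc, this, elemO, hM₂]
      · have := hI₂ (by omega)
        simp [hB₂, hC₂, hc, this, elemO]
    · simp only [List.mem_cons, List.not_mem_nil, or_false, not_or] at hx
      simp [hx.1, hx.2.1, hx.2.2]
    · funext j
      simp
  rintro s₃ ⟨hQ₃, hO₃, f₃⟩
  have f₃' := (f₂'.mono (R' := [xM, xS, xQ, xO, xI]) (A' := []) (by decide) (by decide)).trans
    (f₃.mono (R' := [xM, xS, xQ, xO, xI]) (A' := []) (by decide) (by decide))
  have l₃ := h.frame f₃'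
  have hM₃ := (f₃.reg xM (by decide)).trans hM₂
  have hS₃ := (f₃.reg xS (by decide)).trans hS₂
  have hW₃ : s₃.arr yW = s.arr yW := f₃'.arr _ (by decide)
  refine Runs.cons (T₁ := n * (80 + 3 + 9) + 3 + 7) (T₂ := n * 50 + 50) (Runs.fill (T := 80) yZ 0
    (fun p => t.word (b + 1) r p) (n := n) (by omega) (by decide) ?_ ?_) (by omega) ?_
  · intro s' hf
    simp [(hf.reg rSize (by decide)).trans l₃.size, hn]
  · intro i hi s' hx hf
    have e₁ := (hf.reg xM (by decide)).trans hM₃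
    have e₂ := (hf.reg xS (by decide)).trans hS₃
    have e₃ := (hf.reg xQ (by decide)).trans hQ₃
    have e₄ := (hf.reg xO (by decide)).trans hO₃
    have e₅ : s'.arr yW = s.arr yW := (hf.arr yW (by decide)).trans hW₃
    refine Runs.straight rfl (by decide) ⟨?_, fun j hj => ?_⟩
    · rw [Tower.word, ← hm]
      by_cases him : i < m
      · have hlt : (m + t.hub b r % m - i) % m < m := Nat.mod_lt _ (by omega)
        simp [hx, e₁, e₂, e₃, e₄, e₅, him, hW _ (hlt.trans_le hmn), lift]
      · simp [hx, e₁, him]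
    · have : j ≠ i := by omega
      by_cases him : i < m
      · simp [hx, e₁, him, this]
      · simp [hx, e₁, him, this]
  rintro s₄ ⟨hZ₄, f₄⟩
  have l₄ := l₃.frame f₄
  refine Runs.cons (T₁ := n * (20 + 3 + 9) + 3 + 7) (T₂ := 10) (Runs.fill (T := 20) yW 0
    (fun p => t.word (b + 1) r p) (n := n) (by omega) (by decide) ?_ ?_) (by omega) ?_
  · intro s' hf
    simp [(hf.reg rSize (by decide)).trans l₄.size, hn]
  · intro i hi s' hx hf
    have e₁ := hf.arr yZ (by decide)
    refine Runs.straight rfl (by decide) ⟨?_, fun j hj => ?_⟩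
    · have := hZ₄ i hi
      simp only [Nat.add_zero] at this
      simp [hx, e₁, this]
    · have : j ≠ i := by omega
      simp [hx, this]
  exact fun s₅ h₅ => Runs.block_nil (by omega) h₅.1

theorem towerUnrank_runs {t : Tower} {len r : ℕ} {s : State} (h : Loaded t len s)
    (hv : t.Valid len) (hlen : 0 < len) (hr : s.reg rRank = r) :
    Runs towerUnrank s (t.size len * (t.size len * 150 + 800) + 500) fun s' =>
      ∀ p < t.size len, s'.arr aPi (p + 1) = t.vec len r p + 1 := by
  have hcode := Tower.isCode hv len le_rfl
  have hle := hcode.le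
  have hlt := hv.lt_size len le_rfl
  set n := t.size len with hn
  have hrank : (r + (n - 2)) % t.card len < t.card len := Nat.mod_lt _ (by omega)
  obtain ⟨ρ, hρ₀, hρ⟩ := t.exists_trace len ((r + (n - 2)) % t.card len)
  have hρlt := hv.trace_lt hρ (by rw [hρ₀]; exact hrank)
  refine Runs.cons (T₁ := n * 60 + 60) (T₂ := n * (n * 150 + 740) + 440)
    (cardsProg_runs h hlt.le).frame (by simp only [Nat.mul_add]; omega) ?_
  rintro s₁ ⟨hSz₁, f₁⟩
  have l₁ := h.frame f₁
  refine Runs.cons (T₁ := 20) (T₂ := n * (n * 150 + 740) + 420) (Runs.straight rfl (by decide)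
    (Q := fun s' => s'.reg xA = ρ len) ?_).frame (by simp only [Nat.mul_add]; omega) ?_
  · simp [f₁.reg rRank (by decide), hr, l₁.size, l₁.levels, hSz₁ len le_rfl, ← hn, hρ₀]
  rintro s₂ ⟨hA₂, f₂⟩
  have l₂ := l₁.frame f₂
  have hSz₂ : s₂.arr ySz = s₁.arr ySz := f₂.arr _ (by decide)
  refine Runs.cons (T₁ := n * (200 + 1 + 9) + 8) (T₂ := n * (n * 150 + 530) + 400)
    (Q := fun s' => (∀ b < len, Stored t b (ρ (b + 1)) s') ∧
      Frame (xT :: splitProg.regs) splitProg.arrs s₂ s') ?_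
    (by simp only [Nat.mul_add]; omega) ?_
  · refine (Runs.forUp_frame (T := 200) (N := n) (a := 1) (b := len)
      (I := fun i s' => s'.reg xA = ρ (len + 1 - i) ∧
        ∀ b < len, len + 1 - i ≤ b → Stored t b (ρ (b + 1)) s') rfl (by decide)
      (fun i s' v h => ⟨by simpa using h.1, fun b hb hb' => (h.2 b hb hb').congr rfl rfl rfl⟩) ?_
      (by omega) (by omega) ?_ ?_).mono ?_ fun s' h => ⟨fun b hb => h.1.2 b hb (by omega), h.2⟩
    · rw [Nat.add_sub_cancel]
      exact ⟨hA₂, fun b _ _ => by omega⟩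
    · intro s' hf
      simp [(hf.reg xLen (by decide)).trans l₂.levels]
    · intro i s' h₁ h₂ hx hf hI
      obtain ⟨b, hb⟩ : ∃ b, len + 1 - i = b + 1 := ⟨len - i, by omega⟩
      rw [hb] at hI
      have hSz' : s'.arr ySz = s₁.arr ySz := (hf.arr _ (by decide)).trans hSz₂
      refine (splitProg_runs (b := b) (l₂.frame hf) (by omega) (by omega) hI.1
        (by rw [hSz', hSz₁ b (by omega)])).imp fun s'' h => ?_
      rw [show len + 1 - (i + 1) = b by omega, hρ b (by omega)]
      refine ⟨h.1, fun b' hb' hbb' => ?_⟩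
      rcases Nat.eq_or_lt_of_le hbb' with rfl | hlt'
      · exact h.2.1
      · obtain ⟨e₁, e₂, e₃⟩ := h.2.2 (b' + 1) (by omega)
        exact (hI.2 b' hb' (by omega)).congr e₁ e₂ e₃
    · rw [show (Expr.reg xLen).cost = 1 from rfl, show (1 : Expr).cost = 1 from rfl]
  rintro s₃ ⟨hst₃, f₃⟩
  have l₃ := l₂.frame f₃
  refine Runs.cons (T₁ := n * (20 + 3 + 9) + 3 + 7) (T₂ := n * (n * 150 + 490) + 390)
    (Runs.fill (T := 20) yW 0 (fun p => p) (n := n) (by omega) (by decide) ?_ ?_)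
    (by simp only [Nat.mul_add]; omega) ?_
  · intro s' hf
    simp [(hf.reg rSize (by decide)).trans l₃.size, hn]
  · intro i hi s' hx hf
    refine Runs.straight rfl (by decide) ⟨by simp [hx], fun j hj => ?_⟩
    have : j ≠ i := by omega
    simp [hx, this]
  rintro s₄ ⟨hW₄, f₄⟩
  have l₄ := l₃.frame f₄
  refine Runs.cons (T₁ := n * (n * 150 + 200 + 1 + 9) + 8) (T₂ := n * 100 + 100)
    (Q := fun s' => (∀ p < n, s'.arr yW p = t.word len (ρ len) p) ∧
      Frame (xB :: buildProg.regs) buildProg.arrs s₄ s') ?_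
    (by simp only [Nat.mul_add]; omega) ?_
  · refine (Runs.forUp_frame (T := n * 150 + 200) (N := n) (a := 1) (b := len)
      (I := fun i s' => ∀ p < n, s'.arr yW p = t.word (i - 1) (ρ (i - 1)) p) rfl (by decide)
      (fun i s' v h => h) ?_ (by omega) (by omega) ?_ ?_).mono ?_ fun s' h => ⟨h.1, h.2⟩
    · exact fun p hp => hW₄ p hp
    · intro s' hf
      simp [(hf.reg xLen (by decide)).trans l₄.levels]
    · intro i s' h₁ h₂ hx hf hI
      obtain ⟨b, rfl⟩ : ∃ b, i = b + 1 := ⟨i - 1, by omega⟩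
      have hst' : Stored t b (ρ (b + 1)) s' := (hst₃ b (by omega)).congr
        (by rw [hf.arr _ (by decide), f₄.arr _ (by decide)])
        (by rw [hf.arr _ (by decide), f₄.arr _ (by decide)])
        (by rw [hf.arr _ (by decide), f₄.arr _ (by decide)])
      have hW' : ∀ p < n, s'.arr yW p = t.word b (t.hub b (ρ (b + 1)) / t.size (b + 1)) p := by
        rw [← hρ b (by omega)]; exact hI
      exact buildProg_runs (l₄.frame hf) hv (by omega) hx hst' hW'
    · rw [show (Expr.reg xLen).cost = 1 from rfl, show (1 : Expr).cost = 1 from rfl]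
  rintro s₅ ⟨hW₅, f₅⟩
  have l₅ := l₄.frame f₅
  refine Runs.cons (T₁ := n * (40 + 3 + 9) + 3 + 7) (T₂ := 10)
    (Runs.fill (T := 40) aPi 1 (fun p => t.vec len r p + 1) (n := n) (by omega) (by decide) ?_ ?_)
    (by omega) fun s' h => Runs.block_nil (by omega) h.1
  · intro s' hf
    simp [(hf.reg rSize (by decide)).trans l₅.size, hn]
  · intro i hi s' hx hf
    have e₁ := (hf.reg rSize (by decide)).trans l₅.size
    have e₂ := hf.arr yW (by decide)
    refine Runs.straight rfl (by decide) ⟨?_, fun j hj => ?_⟩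
    · simp [hx, e₁, e₂, hW₅ i hi, Tower.vec, Tower.shiftWord, ← hn, ← hρ₀]
    · have : j ≠ i := by omega
      simp [hx, this]

/-- Store the sizes `e` and the numbers of pairs `f` of the levels. -/
def levelsProg (e f : Expr) : Cmd :=
  .forUp xB 1 (.reg xLen) (.block [.put yM (.reg xB) e, .put yMu (.reg xB) f])

theorem levelsProg_runs {e f : Expr} {g g' : ℕ → ℕ} {len N : ℕ} {s : State}
    (he : ∀ s', e.eval s' = g (s'.reg xB)) (hf : ∀ s', f.eval s' = g' (s'.reg xB))
    (hcost : e.cost + f.cost ≤ 20) (hlen : s.reg xLen = len) (hN : len ≤ N) :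
    Runs (levelsProg e f) s (N * 60 + 10) fun s' =>
      ∀ b, 1 ≤ b → b ≤ len → s'.arr yM b = g b ∧ s'.arr yMu b = g' b := by
  refine (Runs.forUp_frame (T := 40) (N := N) (a := 1) (b := len)
    (I := fun i s' => ∀ b, 1 ≤ b → b < i → s'.arr yM b = g b ∧ s'.arr yMu b = g' b) rfl
    (by simp [Cmd.regs]) (fun _ _ _ h => h) (fun b h₁ h₂ => absurd h₁ (by omega)) (by omega)
    (by omega) ?_ ?_).mono ?_ fun s' h b h₁ h₂ => h.1 b h₁ (by omega)
  · intro s' hf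
    rw [Expr.eval_reg, hf.reg xLen (by simp [Cmd.regs]), hlen]
  · intro i s' h₁ h₂ hx hf' hI
    refine Runs.straight rfl ?_ fun b hb hb' => ?_
    · simp only [Cmd.block, Cmd.bound, Expr.cost]
      omega
    · rcases Nat.lt_or_ge b i with h | h
      · have : b ≠ i := by omega
        simp [hx, this, hI b hb h]
      · obtain rfl : b = i := by omega
        simp [hx, he, hf]
  · rw [show (Expr.reg xLen).cost = 1 from rfl, show (1 : Expr).cost = 1 from rfl]
    omega

/-- Load the tower of the complete codes. -/
def loadComplete : Cmd := .block [
  .set xLen (.reg rSize - 1),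
  levelsProg (.reg xB + 1) 0]

/-- Load the tower of the auxiliary code. -/
def loadAux : Cmd := .ite (.reg rSize % 2)
  (.block [
    .set xLen ((.reg rSize - 1) / 2),
    levelsProg (2 * .reg xB + 1) (.reg xB - 1)])
  (.block [
    .set xLen (.reg rSize - 2),
    levelsProg (.reg xB + 1) 0,
    .put yM (.reg xLen) (.reg rSize)])

theorem loadComplete_runs {n : ℕ} {s : State} (hn : 2 ≤ n) (hs : s.reg rSize = n) :
    Runs loadComplete s (n * 60 + 60) (Loaded Tower.complete (n - 1)) := by
  refine Runs.cons (T₁ := 10) (T₂ := n * 60 + 40) (Runs.straight rfl (by decide)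
    (Q := fun s' => s'.reg xLen = n - 1) (by simp [hs])).frame (by omega) ?_
  rintro s₁ ⟨hL₁, f₁⟩
  refine Runs.cons (T₁ := n * 60 + 10) (T₂ := 10) (levelsProg_runs (g := fun b => b + 1)
    (g' := fun _ => 0) (by simp) (by simp) (by decide) hL₁ (by omega)).frame (by omega) ?_
  rintro s₂ ⟨h₂, f₂⟩
  refine Runs.block_nil (by omega) ⟨?_, ?_, fun b h h' => (h₂ b h h').1, fun b h h' => (h₂ b h h').2⟩
  · rw [f₂.reg _ (by decide), hL₁]
  · rw [f₂.reg _ (by decide), f₁.reg _ (by decide), hs]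
    simp only [Tower.complete]
    omega

theorem loadAux_runs {n : ℕ} {s : State} (hn : 3 ≤ n) (hs : s.reg rSize = n) :
    Runs loadAux s (n * 60 + 60) (Loaded (Tower.auxiliary n) (Tower.auxLevels n)) := by
  refine (Runs.ite (T := n * 60 + 50) (fun h => ?_) fun h => ?_).mono
    (by rw [show (Expr.reg rSize % 2).cost = 3 from rfl]; omega) fun _ h => h
  · have hodd : n % 2 = 1 := by simp [hs] at h; omega
    rw [Tower.auxiliary, if_pos hodd, Tower.auxLevels, if_pos hodd]
    refine Runs.cons (T₁ := 10) (T₂ := n * 60 + 40) (Runs.straight rfl (by decide)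
      (Q := fun s' => s'.reg xLen = (n - 1) / 2) (by simp [hs])).frame (by omega) ?_
    rintro s₁ ⟨hL₁, f₁⟩
    refine Runs.cons (T₁ := n * 60 + 10) (T₂ := 10) (levelsProg_runs (g := fun b => 2 * b + 1)
      (g' := fun b => b - 1) (by simp) (by simp) (by decide) hL₁ (by omega)).frame (by omega) ?_
    rintro s₂ ⟨h₂, f₂⟩
    refine Runs.block_nil (by omega)
      ⟨?_, ?_, fun b h h' => (h₂ b h h').1, fun b h h' => (h₂ b h h').2⟩
    · rw [f₂.reg _ (by decide), hL₁]
    · rw [f₂.reg _ (by decide), f₁.reg _ (by decide), hs]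
      simp only [Tower.odd]
      omega
  · have heven : ¬ n % 2 = 1 := by simp [hs] at h; omega
    rw [Tower.auxiliary, if_neg heven, Tower.auxLevels, if_neg heven]
    refine Runs.cons (T₁ := 10) (T₂ := n * 60 + 40) (Runs.straight rfl (by decide)
      (Q := fun s' => s'.reg xLen = n - 2) (by simp [hs])).frame (by omega) ?_
    rintro s₁ ⟨hL₁, f₁⟩
    refine Runs.cons (T₁ := n * 60 + 10) (T₂ := 30) (levelsProg_runs (g := fun b => b + 1)
      (g' := fun _ => 0) (by simp) (by simp) (by decide) hL₁ (by omega)).frame (by omega) ?_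
    rintro s₂ ⟨h₂, f₂⟩
    have hL₂ : s₂.reg xLen = n - 2 := by rw [f₂.reg _ (by decide), hL₁]
    have hs₂ : s₂.reg rSize = n := by rw [f₂.reg _ (by decide), f₁.reg _ (by decide), hs]
    refine Runs.straight rfl (by decide) ⟨?_, ?_, fun b h h' => ?_, fun b h h' => ?_⟩
    · simp [hL₂]
    · simp [hs₂, Tower.even]
    · by_cases hb : b = n - 2
      · simp [hb, hL₂, hs₂, Tower.even]
      · simp [hb, hL₂, Tower.even, (h₂ b h h').1]
    · simp [(h₂ b h h').2, Tower.even]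

/-- The tower is loaded from the size parameter, which gives one program for all `n`. Everything is
stored in registers from 32 on and arrays from 8 on, so the caller's memory survives. -/
theorem ranksIn_of_load {t : Tower} {len n T : ℕ} {load : Cmd} (hn : t.size len = n)
    (hv : t.Valid len) (hlen : 0 < len)
    (hload : ∀ s : State, s.reg rSize = n → Runs load s T (Loaded t len))
    (hregs : ∀ x ∈ load.regs, 32 ≤ x) (harrs : ∀ a ∈ load.arrs, 8 ≤ a) :
    RanksIn (.seq load towerRank) n (t.seq len) (T + (n * (n * 200 + 700) + 500)) := by
  subst hn
  intro s r hr hs hholds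
  rw [Tower.length_seq] at hr
  obtain ⟨b, rfl⟩ : ∃ b, len = b + 1 := ⟨len - 1, by omega⟩
  rw [holds_iff _ _ _ (hv.isVec (by omega) hr.le)] at hholds
  obtain ⟨s', t', h₁, h₂, h₃, h₄⟩ := (Runs.seq (hload s hs).frame fun s₁ h₁ =>
    (towerRank_runs h₁.1 hv hlen hr (by
      rw [h₁.2.arr aPi fun h => absurd (harrs _ h) (by decide)]
      exact hholds))).frame
  refine ⟨s', t', h₁, h₂, h₃, fun x hx hx₁ hx₂ => h₄.reg x ?_, fun a ha ha₁ => h₄.arr a ?_⟩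
  · have key : ∀ x ∈ towerRank.regs, 32 ≤ x ∨ x = rRank := by decide
    simp only [Cmd.regs, List.mem_append]
    rintro (h | h)
    · have := hregs x h; omega
    · have := key x h; omega
  · have key : ∀ x ∈ towerRank.arrs, 8 ≤ x := by decide
    simp only [Cmd.arrs, List.mem_append]
    rintro (h | h)
    · have := harrs a h; omega
    · have := key a h; omega

theorem unranksIn_of_load {t : Tower} {len n T : ℕ} {load : Cmd} (hn : t.size len = n)
    (hv : t.Valid len) (hlen : 0 < len)
    (hload : ∀ s : State, s.reg rSize = n → Runs load s T (Loaded t len))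
    (hregs : ∀ x ∈ load.regs, 32 ≤ x) (harrs : ∀ a ∈ load.arrs, 8 ≤ a) :
    UnranksIn (.seq load towerUnrank) n (t.seq len) (T + (n * (n * 150 + 800) + 500)) := by
  subst hn
  intro s r hr hs hrank
  rw [Tower.length_seq] at hr
  obtain ⟨b, rfl⟩ : ∃ b, len = b + 1 := ⟨len - 1, by omega⟩
  obtain ⟨s', t', h₁, h₂, h₃, h₄⟩ := (Runs.seq (hload s hs).frame fun s₁ h₁ =>
    (towerUnrank_runs h₁.1 hv hlen ((h₁.2.reg rRank fun h => absurd (hregs _ h) (by decide)).trans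
      hrank))).frame
  refine ⟨s', t', h₁, h₂, (holds_iff _ _ _ (hv.isVec (by omega) hr.le)).2 h₃,
    fun x hx hx₁ hx₂ => h₄.reg x ?_, fun a ha ha₁ => h₄.arr a ?_⟩
  · have key : ∀ x ∈ towerUnrank.regs, 32 ≤ x := by decide
    simp only [Cmd.regs, List.mem_append]
    rintro (h | h)
    · have := hregs x h; omega
    · have := key x h; omega
  · have key : ∀ x ∈ towerUnrank.arrs, 8 ≤ x ∨ x = aPi := by decide
    simp only [Cmd.arrs, List.mem_append]
    rintro (h | h)
    · have := harrs a h; omega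
    · have := key a h; omega

/-- The complete and the auxiliary codes of the towers. -/
def towerIngredients : Ingredients where
  comp n := Tower.complete.seq (n - 1)
  aux n := (Tower.auxiliary n).seq (Tower.auxLevels n)
  rankComplete := .seq loadComplete towerRank
  unrankComplete := .seq loadComplete towerUnrank
  rankAux := .seq loadAux towerRank
  unrankAux := .seq loadAux towerUnrank

theorem RanksIn.mono {p : Cmd} {n T T' : ℕ} {L : List ℕ} (h : RanksIn p n L T) (hT : T ≤ T') :
    RanksIn p n L T' := fun s r h₁ h₂ h₃ => by
  obtain ⟨s', t, a, b, c⟩ := h s r h₁ h₂ h₃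
  exact ⟨s', t, a, b.trans hT, c⟩

theorem UnranksIn.mono {p : Cmd} {n T T' : ℕ} {L : List ℕ} (h : UnranksIn p n L T) (hT : T ≤ T') :
    UnranksIn p n L T' := fun s r h₁ h₂ h₃ => by
  obtain ⟨s', t, a, b, c⟩ := h s r h₁ h₂ h₃
  exact ⟨s', t, a, b.trans hT, c⟩

theorem towerIngredients_valid : towerIngredients.Valid 2000 := by
  -- Loading and ranking together take a quadratic polynomial in `n`; for `n ≥ 2` its lower terms
  -- fit into the generous constant 2000.
  have bound : ∀ n : ℕ, 2 ≤ n → n * 60 + 60 + (n * (n * 200 + 700) + 500) ≤ 2000 * n ^ 2 :=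
    fun n hn => by nlinarith
  have bound' : ∀ n : ℕ, 2 ≤ n → n * 60 + 60 + (n * (n * 150 + 800) + 500) ≤ 2000 * n ^ 2 :=
    fun n hn => by nlinarith
  have hc : ∀ n, 2 ≤ n → Tower.complete.size (n - 1) = n := fun n hn => by
    simp only [Tower.complete]; omega
  have h₁ : ∀ n, 2 ≤ n → RanksIn towerIngredients.rankComplete n (towerIngredients.comp n)
      (2000 * n ^ 2) := fun n hn =>
    (ranksIn_of_load (hc n hn) (Tower.complete_valid _) (by omega)
      (fun s hs => loadComplete_runs hn hs) (by decide) (by decide)).mono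
      (bound n hn)
  have h₂ : ∀ n, 3 ≤ n → RanksIn towerIngredients.rankAux n (towerIngredients.aux n)
      (2000 * n ^ 2) := fun n hn =>
    (ranksIn_of_load (Tower.auxiliary_size hn) (Tower.auxiliary_valid hn) (Tower.auxLevels_pos hn)
      (fun s hs => loadAux_runs hn hs) (by decide) (by decide)).mono
      (bound n (by omega))
  refine ⟨fun n hn => ?_, fun n hn => Tower.auxiliary_isAuxCode hn (h₂ n hn), h₁, fun n hn => ?_, h₂,
    fun n hn => ?_⟩
  · obtain ⟨b, rfl⟩ : ∃ b, n = b + 1 + 1 := ⟨n - 2, by omega⟩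
    have := (Tower.complete_valid (b + 1)).isPushCode (b := b) (by omega) (h₁ (b + 1 + 1) hn)
    rwa [Tower.complete_card] at this
  · exact (unranksIn_of_load (hc n hn) (Tower.complete_valid _) (by omega)
      (fun s hs => loadComplete_runs hn hs) (by decide) (by decide)).mono
      (bound' n hn)
  · exact (unranksIn_of_load (Tower.auxiliary_size hn) (Tower.auxiliary_valid hn)
      (Tower.auxLevels_pos hn) (fun s hs => loadAux_runs hn hs) (by decide) (by decide)).mono
      (bound' n (by omega))

/-! ### The codewords of `Ĉ₁` -/

/-- The values of a permutation as a vector. -/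
def vals {n : ℕ} (σ : Perm (Fin n)) (q : ℕ) : ℕ := if h : q < n then (σ ⟨q, h⟩).val else q

theorem isVec_vals {n : ℕ} (σ : Perm (Fin n)) : IsVec (vals σ) σ := fun p => by
  rw [vals, dif_pos p.isLt]

theorem vals_lt {n q : ℕ} (σ : Perm (Fin n)) (hq : q < n) : vals σ q < n := by
  rw [vals, dif_pos hq]
  exact (σ ⟨q, hq⟩).isLt

theorem vals_one {n : ℕ} (q : ℕ) : vals (1 : Perm (Fin n)) q = q := by
  unfold vals
  split_ifs <;> rfl

theorem vals_push {n j q : ℕ} (σ : Perm (Fin n)) (hj : 1 < j ∧ j ≤ n) (hq : q < n) :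
    vals (push 1 j σ) q = vals σ (pushPos 1 j q) := by
  have := (isVec_vals σ).push (g := fun q => vals σ (pushPos 1 j q)) ⟨le_rfl, hj⟩
    (fun _ _ => rfl) ⟨q, hq⟩
  rw [vals, dif_pos hq, this]

/-- Reducing the rank modulo `M` makes the step valid also after the last codeword, by cyclicity.
Blocks of the auxiliary code in `Ĉ₁` need exactly this wrap-around. -/
theorem IsPushCode.vals_step {n M : ℕ} {L : List ℕ} (h : IsPushCode n M L) {b q : ℕ}
    (hb : b < L.length) (hq : q < n) :
    vals (codeword 1 (1 : Perm (Fin n)) L ((b + 1) % M)) q =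
      vals (codeword 1 (1 : Perm (Fin n)) L b) (pushPos 1 L[b] q) := by
  rw [← vals_push _ (h.range _ (List.getElem_mem hb)) hq, ← codeword_succ]
  have := h.size
  rcases Nat.lt_or_ge (b + 1) M with h' | h'
  · rw [Nat.mod_eq_of_lt h']
  · obtain rfl : M = b + 1 := by omega
    rw [Nat.mod_self, codeword_zero, h.cyclic]

/-- Replacing each transition by a block of `M` transitions makes division by `M` locate the block
and the place in it. -/
theorem getElem?_flatMap {α β : Type*} {f : α → List β} {M : ℕ} (hf : ∀ a, (f a).length = M) :
    ∀ (l : List α) (g b : ℕ), b < M → (l.flatMap f)[g * M + b]? = l[g]?.bind fun a => (f a)[b]? := by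
  intro l
  induction l with
  | nil => intro g b _; simp
  | cons a l ih =>
    intro g b hb
    rw [List.flatMap_cons]
    cases g with
    | zero => rw [List.getElem?_append_left (by rw [hf]; omega)]; simp
    | succ g =>
      rw [List.getElem?_append_right (by rw [hf, Nat.add_mul]; omega), hf,
        show (g + 1) * M + b - M = g * M + b by rw [Nat.add_mul]; omega, ih g b hb]
      simp

/-- The element of the class `j` at position `v` of the initial order (both counted from `0`). -/
def label (k d j v : ℕ) : ℕ := d * ((v + 1) % k) + j

section Hat

variable (k d M : ℕ) (comp aux : List ℕ)

/-- The codewords of the levels, as vectors: the word of rank `R` of the level `e + 1` consists of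
labels up to position `k (d - e - 1)` and agrees with a word of the level `e` above. -/
def hatVec : ℕ → ℕ → ℕ → ℕ
  | 0, R, p =>
    if p < k * (d - 1) then label k d (p / k) (p % k)
    else label k d (d - 1) (vals (codeword 1 (1 : Perm (Fin k)) comp R) (p - k * (d - 1)))
  | e + 1, R, p =>
    if p < k * (d - (e + 1) - 1) then label k d (p / k) (p % k)
    else if p ≤ k * (d - (e + 1) - 1) + k then
      if vals (codeword 1 (1 : Perm (Fin (k + 1))) aux (R % M)) (p - k * (d - (e + 1) - 1)) < k then
        label k d (d - (e + 1) - 1)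
          (vals (codeword 1 (1 : Perm (Fin (k + 1))) aux (R % M)) (p - k * (d - (e + 1) - 1)))
      else hatVec e ((R + M - 1) / M) (k * (d - (e + 1) - 1) + k)
    else hatVec e ((R + M - 1) / M) p

theorem sigmaZero_val (i : Fin (k * d)) : (sigmaZero k d i).val = label k d (i.val / k) (i.val % k) := by
  have h := sigmaZero_apply k d i
  have hk : 0 < k := Nat.pos_of_mul_pos_right (Nat.zero_lt_of_lt i.isLt)
  rw [show i.val + 1 + (k - 1) = i.val + k by omega, Nat.add_div_right _ hk] at h
  rw [label, Nat.mod_add_mod]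
  omega

variable {k d M comp aux}

theorem length_levelSeq (haux : aux.length = M) (hM : 0 < M) (e : ℕ) :
    (levelSeq k d comp aux e).length = comp.length * M ^ e := by
  induction e with
  | zero => simp [levelSeq]
  | succ e ih =>
    have : ∀ j : ℕ, (j :: aux.tail.map fun i => k * (d - (e + 1) - 1) + i).length = M := fun j => by
      simp only [List.length_cons, List.length_map, List.length_tail]; omega
    rw [levelSeq, List.length_flatMap, List.map_congr_left (g := fun _ => M) fun a _ => this a,
      List.map_const', List.sum_replicate, ih, smul_eq_mul, pow_succ, mul_assoc]

/-- Every transition of a level starts strictly beyond its target index and stays in `[n]`; for an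
inherited one this means that it reaches past the whole window of the next level. -/
theorem levelSeq_range (hcomp : ∀ j ∈ comp, 1 < j ∧ j ≤ k) (haux : ∀ j ∈ aux, 1 < j ∧ j ≤ k + 1) :
    ∀ e < d, ∀ j ∈ levelSeq k d comp aux e, k * (d - e - 1) + 1 < j ∧ j ≤ k * d := by
  have hkd : ∀ e < d, k * (d - e - 1) + k = k * (d - e) := fun e he => by
    rw [← Nat.mul_succ]; congr 1; omega
  have hle : ∀ e, k * (d - e) ≤ k * d := fun e => Nat.mul_le_mul_left _ (by omega)
  intro e
  induction e with
  | zero =>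
    intro he j hj
    obtain ⟨r, hr, rfl⟩ := List.mem_map.1 hj
    have := hcomp r hr
    have := hkd 0 he
    simp only [Nat.sub_zero] at this ⊢
    omega
  | succ e ih =>
    intro he j hj
    have h₁ := hkd (e + 1) he
    have h₂ := hkd e (by omega)
    have h₃ := hle e
    have h₄ : d - (e + 1) = d - e - 1 := by omega
    rw [h₄] at h₁ ⊢
    rw [levelSeq, List.mem_flatMap] at hj
    obtain ⟨i, hi, hj⟩ := hj
    rw [h₄] at hj
    rcases List.mem_cons.1 hj with rfl | hj
    · have := ih (by omega) j hi
      omega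
    · obtain ⟨r, hr, rfl⟩ := List.mem_map.1 hj
      have := haux r (List.mem_of_mem_tail hr)
      omega

theorem hatVec_zero (hk : 0 < k) : ∀ e < d, ∀ p < k * d,
    hatVec k d M comp aux e 0 p = label k d (p / k) (p % k) := by
  intro e
  induction e with
  | zero =>
    intro he p hp
    rw [hatVec]
    split_ifs with h
    · rfl
    · have h₁ : k * (d - 1) + k = k * d := by rw [← Nat.mul_succ]; congr 1; omega
      have h₂ : p = k * (d - 1) + (p - k * (d - 1)) := by omega
      rw [codeword_zero, vals_one]
      generalize p - k * (d - 1) = q at h₂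
      subst h₂
      rw [Nat.mul_add_div hk, Nat.mul_add_mod, Nat.div_eq_of_lt (by omega), Nat.mod_eq_of_lt (by omega),
        Nat.add_zero]
  | succ e ih =>
    intro he p hp
    have h₁ : k * (d - (e + 1) - 1) + k = k * (d - e - 1) := by
      rw [← Nat.mul_succ]; congr 1; omega
    have h₀ : k * (d - e - 1) + k ≤ k * d := by
      rw [← Nat.mul_succ]; exact Nat.mul_le_mul_left _ (by omega)
    have hG : (0 + M - 1) / M = 0 := by
      rcases Nat.eq_zero_or_pos M with h | h
      · simp [h]
      · exact Nat.div_eq_of_lt (by omega)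
    rw [hatVec, Nat.zero_mod, codeword_zero, vals_one, hG]
    split_ifs with h₂ h₃ h₄
    · rfl
    · have h₅ : p = k * (d - (e + 1) - 1) + (p - k * (d - (e + 1) - 1)) := by omega
      generalize p - k * (d - (e + 1) - 1) = q at h₅ h₄
      subst h₅
      rw [Nat.mul_add_div hk, Nat.mul_add_mod, Nat.div_eq_of_lt h₄, Nat.mod_eq_of_lt h₄]
      rfl
    · rw [ih (by omega) _ (by omega), show k * (d - (e + 1) - 1) + k = p by omega]
    · exact ih (by omega) p hp

/-- The full length is a multiple of `M`, so the window is back at the start of the auxiliary code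
and the level above is at its own full length. -/
theorem hatVec_last (hM : 0 < M)
    (hcomp : codeword 1 (1 : Perm (Fin k)) comp comp.length = 1) (e p : ℕ) :
    hatVec k d M comp aux e (comp.length * M ^ e) p = hatVec k d M comp aux e 0 p := by
  induction e generalizing p with
  | zero => rw [pow_zero, mul_one, hatVec, hatVec, hcomp, codeword_zero]
  | succ e ih =>
    have h₁ : comp.length * M ^ (e + 1) % M = 0 := by rw [pow_succ, ← mul_assoc, Nat.mul_mod_left]
    have h₂ : (comp.length * M ^ (e + 1) + M - 1) / M = comp.length * M ^ e := by
      rw [pow_succ, ← mul_assoc, show comp.length * M ^ e * M + M - 1 = M - 1 + M * (comp.length * M ^ e) by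
        rw [Nat.mul_comm M]; omega, Nat.add_mul_div_left _ _ hM, Nat.div_eq_of_lt (by omega),
        Nat.zero_add]
    have h₃ : (0 + M - 1) / M = 0 := Nat.div_eq_of_lt (by omega)
    simp only [hatVec, h₁, h₂, h₃, ih, Nat.zero_mod]

/-- At a multiple of `M` the long push `t_{s+1↑J}` factors: the entry at `J` becomes the first entry
of the upper window, as the upper transition `t_{s+k+1↑J}` demands, and it is then carried to the
front of the lower window by `t_{↑k+1}`. At all other ranks only the auxiliary code moves, and the
symbol `k` (0-based) carries the entry of the upper word with it. -/
theorem hatVec_step (hk : 0 < k) (hcomp : IsPushCode k k.factorial comp) (haux : IsAuxCode (k + 1) M aux)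
    (hM : 0 < M) : ∀ e < d, ∀ R (hR : R < (levelSeq k d comp aux e).length), ∀ p < k * d,
    hatVec k d M comp aux e (R + 1) p =
      hatVec k d M comp aux e R (pushPos (k * (d - e - 1) + 1) (levelSeq k d comp aux e)[R] p) := by
  intro e
  induction e with
  | zero =>
    intro he R hR p hp
    have hR' : R < comp.length := by simpa [levelSeq] using hR
    have hj := hcomp.range _ (List.getElem_mem hR')
    have hkd : k * (d - 1) + k = k * d := by rw [← Nat.mul_succ]; congr 1; omega
    have e₁ : (levelSeq k d comp aux 0)[R] = k * (d - 1) + comp[R] := by simp [levelSeq]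
    rw [e₁, Nat.sub_zero]
    set s := k * (d - 1)
    set j := comp[R]
    rcases Nat.lt_or_ge p s with h | h
    · rw [show pushPos (s + 1) (s + j) p = p by unfold pushPos; split_ifs <;> omega]
      simp only [hatVec]
      rw [if_pos h, if_pos h]
    · have e₂ : pushPos (s + 1) (s + j) p = s + pushPos 1 j (p - s) := by
        unfold pushPos; split_ifs <;> omega
      rw [e₂]
      simp only [hatVec]
      rw [if_neg (by omega), if_neg (by omega), Nat.add_sub_cancel_left, codeword_succ _ _ _ hR',
        vals_push _ hj (by omega)]
  | succ e ih =>
    intro he R hR p hp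
    have h₁ : d - (e + 1) = d - e - 1 := by omega
    have h₂ : k * (d - (e + 1) - 1) + k = k * (d - e - 1) := by
      rw [← Nat.mul_succ]; congr 1; omega
    have h₃ : k * (d - e - 1) + k ≤ k * d := by
      rw [← Nat.mul_succ]; exact Nat.mul_le_mul_left _ (by omega)
    have hlen := length_levelSeq (k := k) (d := d) (comp := comp) haux.size hM e
    rw [length_levelSeq haux.size hM, pow_succ, ← mul_assoc, ← hlen] at hR
    have hd := Nat.div_add_mod' R M
    have hb := Nat.mod_lt R hM
    set g := R / M
    set b := R % M with hbdef
    have hg : g < (levelSeq k d comp aux e).length := by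
      by_contra hc
      have := Nat.mul_le_mul_right M (Nat.not_lt.1 hc)
      omega
    -- The next word has upper rank `g + 1` whatever `b` is; the current one has upper rank `g` for
    -- `b = 0` only.
    have hG : (R + 1 + M - 1) / M = g + 1 := by
      rw [← hd, show g * M + b + 1 + M - 1 = b + M * (g + 1) by
        rw [Nat.mul_add, Nat.mul_comm M]; omega, Nat.add_mul_div_left _ _ hM,
        Nat.div_eq_of_lt hb, Nat.zero_add]
    have hmod : (R + 1) % M = (b + 1) % M := by rw [hbdef, Nat.mod_add_mod]
    have hsz := haux.size
    have hget : ∀ (hR' : R < (levelSeq k d comp aux (e + 1)).length),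
        (levelSeq k d comp aux (e + 1))[R] =
          if b = 0 then (levelSeq k d comp aux e)[g] else
            k * (d - (e + 1) - 1) + aux[b]'(by omega) := by
      intro hR'
      have hf : ∀ j : ℕ, (j :: aux.tail.map fun i => k * (d - (e + 1) - 1) + i).length = M :=
        fun j => by
          simp only [List.length_cons, List.length_map, List.length_tail]; omega
      have := getElem?_flatMap hf (levelSeq k d comp aux e) g b hb
      rw [hd, List.getElem?_eq_getElem hg, Option.bind_some] at this
      have h' := (List.getElem?_eq_getElem hR').symm.trans this
      split_ifs with hb0
      · rw [hb0] at h'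
        simpa using h'
      · obtain ⟨b', hb'⟩ : ∃ b', b = b' + 1 := ⟨b - 1, by omega⟩
        simp only [hb'] at h' ⊢
        rw [List.getElem?_cons_succ, List.getElem?_map, List.getElem?_tail,
          List.getElem?_eq_getElem (by omega)] at h'
        simpa using h'
    rw [hget, h₁]
    set s := k * (d - e - 1 - 1) with hs
    rw [h₁, ← hs] at h₂
    have hrange := levelSeq_range (k := k) (d := d) (fun j hj => hcomp.range j hj)
      (fun j hj => haux.range j hj) e (by omega) _ (List.getElem_mem hg)
    have hih := ih (by omega) g hg
    split_ifs with hb0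
    · set J := (levelSeq k d comp aux e)[g]
      have hR0 : (R + M - 1) / M = g := by
        rw [← hd, hb0, show g * M + 0 + M - 1 = M - 1 + M * g by rw [Nat.mul_comm M]; omega,
          Nat.add_mul_div_left _ _ hM, Nat.div_eq_of_lt (by omega), Nat.zero_add]
      -- This is where the assumption that the auxiliary code begins with `t_{↑k+1}` enters.
      have hfirst : ∀ q < k + 1, vals (codeword 1 (1 : Perm (Fin (k + 1))) aux ((R + 1) % M)) q =
          pushPos 1 (k + 1) q := by
        intro q hq
        have h0 : 0 < aux.length := by omega
        have hhead : aux[0] = k + 1 := by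
          have := haux.first
          rw [List.head?_eq_getElem?, List.getElem?_eq_getElem h0] at this
          exact Option.some_injective _ this
        have := haux.vals_step h0 hq
        rw [hhead, codeword_zero, vals_one] at this
        rw [hmod, hb0]
        exact this
      -- At the start of a block the auxiliary codeword is the identity, so its last symbol stands
      -- for the upper entry at that very position and the upper word continues undisturbed.
      have hcur : ∀ p', hatVec k d M comp aux (e + 1) R p' =
          if p' < s + k then if p' < s then label k d (p' / k) (p' % k) else label k d (d - e - 1 - 1) (p' - s)
          else hatVec k d M comp aux e g p' := by
        intro p'
        rw [hatVec, h₁, ← hs, ← hbdef, hb0, codeword_zero, vals_one, hR0]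
        split_ifs <;> first | rfl | omega | skip
        rw [show s + k = p' by omega]
      rw [hcur, hatVec, hG, h₁, ← hs]
      rcases (by omega : p < s ∨ s ≤ p ∧ p ≤ s + k ∨ s + k < p) with h | h | h
      · rw [show pushPos (s + 1) J p = p by unfold pushPos; split_ifs <;> omega, if_pos h,
          if_pos (by omega), if_pos h]
      · rw [if_neg (by omega), if_pos h.2, hfirst _ (by omega)]
        rcases Nat.eq_or_lt_of_le h.1 with h' | h'
        · rw [show pushPos 1 (k + 1) (p - s) = k by unfold pushPos; split_ifs <;> omega,
            if_neg (by omega), show pushPos (s + 1) J p = J - 1 by unfold pushPos; split_ifs <;> omega,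
            if_neg (by omega), hih _ (by omega), ← h₂]
          rw [show pushPos (s + k + 1) J (s + k) = J - 1 by unfold pushPos; split_ifs <;> omega]
        · rw [show pushPos 1 (k + 1) (p - s) = p - s - 1 by unfold pushPos; split_ifs <;> omega,
            if_pos (by omega), show pushPos (s + 1) J p = p - 1 by unfold pushPos; split_ifs <;> omega,
            if_pos (by omega), if_neg (by omega), show p - s - 1 = p - 1 - s by omega]
      · rw [if_neg (by omega), if_neg (by omega), hih _ (by omega), ← h₂,
          show pushPos (s + k + 1) J p = pushPos (s + 1) J p by unfold pushPos; split_ifs <;> omega,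
          if_neg (by unfold pushPos; split_ifs <;> omega)]
    · have hb' : b < aux.length := by omega
      have hj := haux.range _ (List.getElem_mem hb')
      have hstep := fun q (hq : q < k + 1) => haux.vals_step hb' hq
      set j := aux[b]
      have hR0 : (R + M - 1) / M = g + 1 := by
        rw [← hd, show g * M + b + M - 1 = b - 1 + M * (g + 1) by
          rw [Nat.mul_add, Nat.mul_comm M]; omega, Nat.add_mul_div_left _ _ hM,
          Nat.div_eq_of_lt (by omega), Nat.zero_add]
      rw [hatVec, hatVec, hG, hR0, h₁, ← hs, hmod, ← hbdef]
      rcases (by omega : p < s ∨ s ≤ p ∧ p ≤ s + k ∨ s + k < p) with h | h | h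
      · rw [show pushPos (s + 1) (s + j) p = p by unfold pushPos; split_ifs <;> omega, if_pos h,
          if_pos h]
      · have e₁ : pushPos (s + 1) (s + j) p = s + pushPos 1 j (p - s) := by
          unfold pushPos; split_ifs <;> omega
        have e₂ : pushPos 1 j (p - s) ≤ k := by unfold pushPos; split_ifs <;> omega
        rw [e₁, if_neg (show ¬ p < s by omega), if_pos h.2,
          if_neg (show ¬ s + pushPos 1 j (p - s) < s by omega),
          if_pos (show s + pushPos 1 j (p - s) ≤ s + k by omega), Nat.add_sub_cancel_left, hstep _ (by omega)]
      · rw [show pushPos (s + 1) (s + j) p = p by unfold pushPos; split_ifs <;> omega,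
          if_neg (by omega), if_neg (by omega), if_neg (by omega), if_neg (by omega)]

/-- The lowest level is the one whose window starts at position 1, so its pushes are pushes to the
top. -/
theorem isVec_hatVec (hk : 0 < k) (hd : 0 < d) (hcomp : IsPushCode k k.factorial comp)
    (haux : IsAuxCode (k + 1) M aux) (hM : 0 < M) {R : ℕ}
    (hR : R ≤ (hatSeq k d comp aux).length) :
    IsVec (hatVec k d M comp aux (d - 1) R) (hatWord k d comp aux R) := by
  have h := levelSeq_range (k := k) (d := d) (fun j hj => hcomp.range j hj)
    (fun j hj => haux.range j hj) (d - 1) (by omega)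
  have hs := hatVec_step (d := d) hk hcomp haux hM (d - 1) (by omega)
  rw [show d - (d - 1) - 1 = 0 by omega, Nat.mul_zero, Nat.zero_add] at h hs
  refine isVec_codeword le_rfl h (fun p => ?_) hs R hR
  rw [hatVec_zero hk _ (by omega) _ p.isLt, sigmaZero_val]

end Hat

/-! ### The parts of the procedures -/

/-- The rule for `for` loops that update one register. -/
theorem Runs.fold {x y : ℕ} {hi e : Expr} {s : State} {b N : ℕ} (f : ℕ → ℕ) (hxy : x ≠ y)
    (h₀ : s.reg y = f 0) (hb : b ≤ N) (hhi : ∀ s', Frame [x, y] [] s s' → hi.eval s' = b)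
    (step : ∀ i s', Frame [x, y] [] s s' → s'.reg x = i + 1 → s'.reg y = f i →
      e.eval s' = f (i + 1)) :
    Runs (.forUp x 1 hi (.set y e)) s (N * (e.cost + hi.cost + 10) + hi.cost + 7)
      fun s' => s'.reg y = f b ∧ Frame [x, y] [] s s' := by
  refine (Runs.forUp_frame (T := e.cost + 1) (N := N) (a := 1) (b := b)
    (I := fun i s' => s'.reg y = f (i - 1)) rfl (by simpa [Cmd.regs] using hxy)
    (fun i s' v h => by rw [State.setReg_reg, if_neg hxy.symm, h]) h₀ (by omega) (by omega) hhi
    fun i s' h₁ _ hi' hf hI => ?_).mono ?_ fun s' h => h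
  · obtain ⟨i, rfl⟩ : ∃ i', i = i' + 1 := ⟨i - 1, by omega⟩
    refine Runs.set le_rfl ?_
    rw [State.setReg_reg, if_pos rfl]
    exact step i s' hf hi' hI
  · rw [show (1 : Expr).cost = 1 from rfl, show e.cost + 1 + hi.cost + 9 = e.cost + hi.cost + 10 by omega]
    omega

theorem sizes_runs {k d : ℕ} {s : State} (hK : s.reg rK = k) (hD : s.reg rD = d) :
    Runs sizes s (k * 60 + d * 20 + 200) fun s' =>
      (s'.reg rFact = k.factorial ∧ s'.reg rAux = auxSize (k + 1) ∧
        s'.reg rTotal = k.factorial * auxSize (k + 1) ^ (d - 1)) ∧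
      Frame sizes.regs sizes.arrs s s' := by
  refine Runs.frame ?_
  unfold sizes
  refine Runs.cons_run rfl (T₁ := 2) (T₂ := k * 60 + d * 20 + 198) (by decide) (by omega) ?_
  refine Runs.cons (T₁ := k * 14 + 8) (T₂ := k * 46 + d * 20 + 190)
    (Runs.fold (b := k) (N := k) (fun i => i.factorial) (by decide) (by simp) le_rfl
    (fun s' h => by simp [h.reg rK, hK])
    (fun i s' _ h₁ h₂ => by simp [h₁, h₂, Nat.factorial_succ, Nat.mul_comm])) (by omega) ?_
  rintro s₁ ⟨h₁, f₁⟩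
  replace f₁ : Frame [rI, rFact] [] s s₁ :=
    ⟨fun x hx => by rw [f₁.reg x hx]; simp at hx ⊢; simp [hx], fun a ha => f₁.arr a ha⟩
  refine Runs.cons_run rfl (T₁ := 2) (T₂ := k * 46 + d * 20 + 188) (by decide) (by omega) ?_
  refine Runs.cons (T₁ := k * 16 + 10) (T₂ := k * 30 + d * 20 + 170)
    (Runs.fold (b := k / 2) (N := k) (fun i => i.factorial) (by decide) (by simp) (by omega)
    (fun s' h => by simp [h.reg rK, f₁.reg rK, hK])
    (fun i s' _ h₁ h₂ => by simp [h₁, h₂, Nat.factorial_succ, Nat.mul_comm])) (by omega) ?_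
  rintro s₂ ⟨h₂, f₂⟩
  replace f₂ : Frame [rI, rHalf] [] s₁ s₂ :=
    ⟨fun x hx => by rw [f₂.reg x hx]; simp at hx ⊢; simp [hx], fun a ha => f₂.arr a ha⟩
  refine Runs.cons_run rfl (T₁ := 2) (T₂ := k * 30 + d * 20 + 168) (by decide) (by omega) ?_
  refine Runs.cons (T₁ := k * 14 + 8) (T₂ := k * 16 + d * 20 + 160)
    (Runs.fold (b := k) (N := k) (fun i => 2 ^ i) (by decide) (by simp) (by omega)
    (fun s' h => by simp [h.reg rK, f₁.reg rK, f₂.reg rK, hK])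
    (fun i s' _ h₁ h₂ => by simp [h₂, pow_succ])) (by omega) ?_
  rintro s₃ ⟨h₃, f₃⟩
  replace f₃ : Frame [rI, rPow] [] s₂ s₃ :=
    ⟨fun x hx => by rw [f₃.reg x hx]; simp at hx ⊢; simp [hx], fun a ha => f₃.arr a ha⟩
  have e₁ : s₃.reg rFact = k.factorial := by
    rw [f₃.reg _ (by decide), f₂.reg _ (by decide), h₁]
  have e₂ : s₃.reg rHalf = (k / 2).factorial := by rw [f₃.reg _ (by decide), h₂]
  have e₃ : s₃.reg rK = k := by
    rw [f₃.reg _ (by decide), f₂.reg _ (by decide), f₁.reg _ (by decide), hK]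
  have e₄ : s₃.reg rD = d := by
    rw [f₃.reg _ (by decide), f₂.reg _ (by decide), f₁.reg _ (by decide), hD]
  refine Runs.cons (T₁ := 60) (T₂ := d * 20 + 100) (Runs.straight rfl (by decide)
    (Q := fun s' => s'.reg rAux = auxSize (k + 1))
    ?_).frame (by omega) ?_
  · rcases Nat.mod_two_eq_zero_or_one k with h | h
    · have h' : (k + 1) % 2 = 1 := by omega
      simp [e₁, e₂, e₃, h₃, h, h', auxSize, Nat.factorial_succ, pow_two, Nat.mul_comm]
    · have h' : (k + 1) % 2 = 0 := by omega
      simp [e₁, e₃, h, h', auxSize, Nat.factorial_succ, Nat.mul_comm]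
  rintro s₄ ⟨h₄, f₄⟩
  refine Runs.cons_run rfl (T₁ := 2) (T₂ := d * 20 + 98) (by decide) (by omega) ?_
  refine Runs.cons (T₁ := d * 16 + 10) (T₂ := 1)
    (Runs.fold (b := d - 1) (N := d) (fun i => k.factorial * auxSize (k + 1) ^ i) (by decide)
      (by simp [f₄.reg rFact (by decide), e₁]) (by omega)
      (fun s' h => by simp [h.reg rD, f₄.reg rD (by decide), e₄])
      (fun i s' f h₁ h₂ => by simp [h₂, f.reg rAux, h₄, pow_succ, Nat.mul_assoc])) (by omega) ?_
  rintro s₅ ⟨h₅, f₅⟩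
  refine Runs.block_nil le_rfl ⟨?_, ?_, h₅⟩
  · rw [f₅.reg _ (by decide)]
    simp [f₄.reg rFact (by decide), e₁]
  · rw [f₅.reg _ (by decide)]
    simp [h₄]

/-- The function `α_j`. -/
def alphaVal (k d j v : ℕ) : ℕ :=
  if v % d = j % d then if d < v then (v - 1) / d else k else k + 1

/-- The residue modulo `d` identifies the class and the quotient the position. The element `j`
itself, not larger than `d`, comes last in the initial order, which is why that case gives `k`. -/
theorem alphaVal_label {k d i j v : ℕ} (hi : i < d) (hj : j < d) (hv : v < k) :
    alphaVal k d (j + 1) (label k d i v + 1) = if i = j then v + 1 else k + 1 := by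
  have hmod : (label k d i v + 1) % d = (j + 1) % d ↔ i = j := by
    rw [label, Nat.add_assoc, Nat.mul_add_mod]
    constructor
    · intro h
      have := Nat.ModEq.add_right_cancel' 1 (h : i + 1 ≡ j + 1 [MOD d])
      rwa [Nat.ModEq, Nat.mod_eq_of_lt hi, Nat.mod_eq_of_lt hj] at this
    · rintro rfl; rfl
  rw [alphaVal]
  simp only [hmod]
  split_ifs with h₁ h₂ <;> rw [label] at * <;> try rfl
  · rw [Nat.add_sub_cancel, Nat.mul_add_div (by omega), Nat.div_eq_of_lt hi, Nat.add_zero]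
    rcases Nat.eq_or_lt_of_le (show v + 1 ≤ k from hv) with h | h
    · rw [h, Nat.mod_self, Nat.mul_zero] at h₂; omega
    · exact Nat.mod_eq_of_lt h
  · rcases Nat.eq_or_lt_of_le (show v + 1 ≤ k from hv) with h | h
    · exact h.symm
    · rw [Nat.mod_eq_of_lt h, Nat.mul_succ] at h₂; omega

theorem alpha_run (s : State) :
    (alpha.run s).reg rV = alphaVal (s.reg rK) (s.reg rD) (s.reg rJ) (s.reg rV) := by
  simp only [alpha, Cmd.run, alphaVal]
  by_cases h : s.reg rV % s.reg rD = s.reg rJ % s.reg rD <;>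
    by_cases h' : s.reg rD < s.reg rV <;> simp [h, h']

/-- The known sum of `1, …, n` determines the one entry of the local permutation that is not read.
-/
theorem sum_vec {n : ℕ} {f : ℕ → ℕ} {π : Perm (Fin n)} (hf : IsVec f π) :
    ∑ p ∈ Finset.range n, (f p + 1) = n * (n + 1) / 2 := by
  have h₁ : ∑ p ∈ Finset.range n, (f p + 1) = ∑ p ∈ Finset.range n, (p + 1) := by
    rw [Finset.sum_range, Finset.sum_range, ← Equiv.sum_comp π fun p : Fin n => p.val + 1]
    exact Finset.sum_congr rfl fun p _ => by rw [hf p]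
  have h₂ := Finset.sum_range_succ' (fun p => p) n
  rw [h₁, ← Nat.add_zero (∑ p ∈ Finset.range n, (p + 1)), ← h₂, Finset.sum_range_id]
  rw [Nat.add_sub_cancel, Nat.mul_comm]

/-- The first entry of the window is not inspected, since lower levels may have replaced it; it is
recovered from the sum. Hence `hwin` speaks of positive offsets only. -/
theorem readWindow_runs {k d j n : ℕ} {s : State} {f : ℕ → ℕ} {π : Perm (Fin n)} (hf : IsVec f π)
    (hn : 0 < n) (hK : s.reg rK = k) (hD : s.reg rD = d) (hJ : s.reg rJ = j + 1)
    (hs : s.reg rSize = n)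
    (hwin : ∀ p, 0 < p → p < n → alphaVal k d (j + 1) (s.arr aSigma (k * j + p + 1)) = f p + 1) :
    Runs readWindow s (n * 60 + 40) fun s' => Holds (s'.arr aPi) π ∧
      Frame readWindow.regs readWindow.arrs s s' := by
  refine Runs.frame ?_
  unfold readWindow
  refine Runs.cons_run rfl (T₁ := 2) (T₂ := n * 60 + 38) (by decide) (by omega) ?_
  refine Runs.cons (T₁ := n * 60 + 10) (T₂ := 20) ((Runs.forUp_frame (T := 50) (N := n) (a := 2) (b := n)
    (I := fun i s' => (∀ p, 0 < p → p + 1 < i → s'.arr aPi (p + 1) = f p + 1) ∧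
      s'.reg rSum = ∑ p ∈ Finset.range (i - 2), (f (p + 1) + 1)) rfl (by decide)
    (fun i s' v h => ⟨h.1, by simp [h.2]⟩) ⟨fun p _ _ => by omega, by simp⟩ (by omega) (by omega)
    (fun s' h => by simp [h.reg rSize (by decide), hs])
    fun i s' h₁ h₂ hi hfr hI => ?_).mono (T' := n * 60 + 10) ?_ fun s' h => h) (by omega) ?_
  · have hK' : s'.reg rK = k := by rw [hfr.reg _ (by decide)]; simp [hK]
    have hD' : s'.reg rD = d := by rw [hfr.reg _ (by decide)]; simp [hD]
    have hJ' : s'.reg rJ = j + 1 := by rw [hfr.reg _ (by decide)]; simp [hJ]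
    obtain ⟨p, rfl⟩ : ∃ p, i = p + 2 := ⟨i - 2, by omega⟩
    have hw : alphaVal k d (j + 1) (s'.arr aSigma (k * j + (p + 2))) = f (p + 1) + 1 := by
      rw [hfr.arr _ (by decide)]
      exact hwin (p + 1) (by omega) (by omega)
    refine Runs.cons_run rfl (T₁ := 10) (T₂ := 40) (by decide) (by omega) ?_
    refine Runs.cons (T₁ := 30) (T₂ := 10) (Runs.straight rfl (by decide)
      (Q := fun s'' => s''.reg rV = f (p + 1) + 1) ?_).frame (by omega) ?_
    · rw [alpha_run]
      simp [hK', hD', hJ', hi, hw]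
    rintro s₁ ⟨h₁, f₁⟩
    refine Runs.straight rfl (by decide) ⟨fun q hq hq' => ?_, ?_⟩
    · have hi₁ : s₁.reg rR = p + 2 := by rw [f₁.reg _ (by decide)]; simp [hi]
      rcases Nat.eq_or_lt_of_le (show q ≤ p + 1 by omega) with h | h
      · subst h; simp [hi₁, h₁]
      · simp [hi₁, show q ≠ p + 1 by omega]
        rw [f₁.arr _ (by decide)]
        exact hI.1 q hq (by omega)
    · have : s₁.reg rSum = s'.reg rSum := by rw [f₁.reg _ (by decide)]; simp
      simp [this, hI.2, h₁, Finset.sum_range_succ]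
  · rw [show (Expr.reg rSize).cost = 1 from rfl, show (2 : Expr).cost = 1 from rfl]
    omega
  rintro s₂ ⟨⟨h₂, h₃⟩, f₂⟩
  have hs₂ : s₂.reg rSize = n := by rw [f₂.reg _ (by decide)]; simp [hs]
  refine Runs.straight rfl (by decide) ?_
  rw [holds_iff _ _ _ hf]
  intro p hp
  rcases Nat.eq_zero_or_pos p with rfl | h
  · have := sum_vec hf
    obtain ⟨n, rfl⟩ : ∃ m, n = m + 1 := ⟨n - 1, by omega⟩
    rw [Finset.sum_range_succ'] at this
    simp [hs₂, h₃]
    rw [← this]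
    simp
  · simp [show p ≠ 0 by omega]
    exact h₂ p h (by omega)

/-! ### The procedure `Rank` -/

section Hat

variable {k d M : ℕ} {comp aux : List ℕ}

/-- Writing the rank as `m + 1` replaces the ceiling by `m / M + 1`, so passing upwards just drops
the last digit of `m`. -/
theorem hatVec_succ (hM : 0 < M) (e m p : ℕ) : hatVec k d M comp aux (e + 1) (m + 1) p =
    if p < k * (d - (e + 1) - 1) then label k d (p / k) (p % k)
    else if p ≤ k * (d - (e + 1) - 1) + k then
      if vals (codeword 1 (1 : Perm (Fin (k + 1))) aux ((m + 1) % M))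
          (p - k * (d - (e + 1) - 1)) < k then
        label k d (d - (e + 1) - 1)
          (vals (codeword 1 (1 : Perm (Fin (k + 1))) aux ((m + 1) % M))
            (p - k * (d - (e + 1) - 1)))
      else hatVec k d M comp aux e (m / M + 1) (k * (d - (e + 1) - 1) + k)
    else hatVec k d M comp aux e (m / M + 1) p := by
  rw [hatVec, show m + 1 + M - 1 = m + M by omega, Nat.add_div_right _ hM]

theorem mul_window {e : ℕ} (he : e + 1 < d) :
    k * (d - (e + 1) - 1) + k = k * (d - e - 1) ∧ k * (d - e - 1) + k ≤ k * d := by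
  constructor
  · rw [← Nat.mul_succ]; congr 1; omega
  · rw [← Nat.mul_succ]; exact Nat.mul_le_mul_left _ (by omega)

theorem mul_last_window (hd : 0 < d) : k * (d - 1) + k = k * d := by
  rw [← Nat.mul_succ]; congr 1; omega

/-- From the start of a window on, only elements of its own class and of the classes of higher
windows occur. A foreign entry in a window therefore belongs to a different class. -/
theorem exists_label (hM : 0 < M) {e : ℕ} (he : e < d) (m : ℕ) {p : ℕ} (hp : k * (d - e - 1) ≤ p)
    (hp' : p < k * d) : ∃ i v, d - e - 1 ≤ i ∧ i < d ∧ v < k ∧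
      hatVec k d M comp aux e (m + 1) p = label k d i v := by
  induction e generalizing m p with
  | zero =>
    have := mul_last_window (k := k) he
    rw [Nat.sub_zero] at hp
    refine ⟨d - 1, _, by omega, by omega, vals_lt (codeword 1 (1 : Perm (Fin k)) comp (m + 1))
      (q := p - k * (d - 1)) (by omega), ?_⟩
    rw [hatVec, if_neg (by omega)]
  | succ e ih =>
    have := mul_window (k := k) he
    rw [hatVec_succ hM, if_neg (by omega)]
    split_ifs with h₁ h₂
    · exact ⟨d - (e + 1) - 1, _, le_rfl, by omega, h₂, rfl⟩
    · obtain ⟨i, v, h₃, h₄⟩ := ih (by omega) (m / M)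
        (p := k * (d - (e + 1) - 1) + k) (by omega) (by
          have : 0 < k := Nat.pos_of_ne_zero (by rintro rfl; simp at hp')
          omega)
      exact ⟨i, v, by omega, h₄⟩
    · obtain ⟨i, v, h₃, h₄⟩ := ih (by omega) (m / M) (p := p) (by omega) hp'
      exact ⟨i, v, by omega, h₄⟩

/-- Going down `t` further levels does not affect positions strictly beyond the start of the window;
only the rank is divided by `M ^ t`. -/
theorem hatVec_add (hM : 0 < M) {e t m p : ℕ} (het : e + t < d) (hp : k * (d - e - 1) < p) :
    hatVec k d M comp aux (e + t) (m + 1) p = hatVec k d M comp aux e (m / M ^ t + 1) p := by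
  induction t generalizing m with
  | zero => rw [pow_zero, Nat.div_one, Nat.add_zero]
  | succ t ih =>
    have h₁ := mul_window (k := k) (e := e + t) het
    have h₂ : k * (d - (e + t) - 1) ≤ k * (d - e - 1) := Nat.mul_le_mul_left _ (by omega)
    rw [← Nat.add_assoc, hatVec_succ hM, if_neg (by rw [Nat.add_assoc] at *; omega),
      if_neg (by rw [Nat.add_assoc] at *; omega), ih (by omega), Nat.div_div_eq_div_mul, pow_succ']

theorem alphaVal_last_window (hd : 0 < d) {R p : ℕ} (hp : p < k) :
    alphaVal k d (d - 1 + 1) (hatVec k d M comp aux 0 R (k * (d - 1) + p) + 1) =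
      vals (codeword 1 (1 : Perm (Fin k)) comp R) p + 1 := by
  rw [hatVec, if_neg (by omega), Nat.add_sub_cancel_left,
    alphaVal_label (by omega) (by omega) (vals_lt _ hp), if_pos rfl]

/-- Own elements are decoded by their label. The symbol `k + 1` stands for an entry of the level
above, whose class is different by `exists_label`, so `α_j` maps it back to `k + 1`. -/
theorem alphaVal_window (hM : 0 < M) {e m p : ℕ} (he : e + 1 < d) (hp : p < k + 1) (hk : 0 < k) :
    alphaVal k d (d - (e + 1) - 1 + 1)
      (hatVec k d M comp aux (e + 1) (m + 1) (k * (d - (e + 1) - 1) + p) + 1) =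
        vals (codeword 1 (1 : Perm (Fin (k + 1))) aux ((m + 1) % M)) p + 1 := by
  have := mul_window (k := k) he
  rw [hatVec_succ hM, if_neg (by omega), if_pos (by omega), Nat.add_sub_cancel_left]
  have hlt := vals_lt (codeword 1 (1 : Perm (Fin (k + 1))) aux ((m + 1) % M)) hp
  split_ifs with h
  · rw [alphaVal_label (by omega) (by omega) h, if_pos rfl]
  · obtain ⟨i, v, h₁, h₂, h₃, h₄⟩ := exists_label (k := k) (comp := comp) (aux := aux) hM
      (show e < d by omega) (m / M) (p := k * (d - (e + 1) - 1) + k) (by omega) (by omega)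
    rw [h₄, alphaVal_label h₂ (by omega) h₃, if_neg (by omega)]
    omega

/-- Every rank is a cyclic successor; rank 0 is treated as the full length. This brings all
codewords into the form `m + 1` that the digit expansion needs. -/
theorem hatVec_pred (hM : 0 < M) {K e R : ℕ} (hlen : comp.length = K) (hK : 0 < K)
    (hcomp : codeword 1 (1 : Perm (Fin k)) comp K = 1) (hR : R < K * M ^ e) (p : ℕ) :
    hatVec k d M comp aux e R p =
      hatVec k d M comp aux e ((R + K * M ^ e - 1) % (K * M ^ e) + 1) p := by
  rcases Nat.eq_zero_or_pos R with rfl | h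
  · subst hlen
    rw [Nat.mod_eq_of_lt (by omega), ← hatVec_last hM hcomp]
    congr 1
    omega
  · rw [show R + K * M ^ e - 1 = R - 1 + K * M ^ e by omega, Nat.add_mod_right,
      Nat.mod_eq_of_lt (by omega), Nat.sub_add_cancel h]

end Hat

theorem succ_mod_add_sub_one_mod {x M : ℕ} (hM : 0 < M) : ((x + 1) % M + M - 1) % M = x % M := by
  rw [← mod_shift (M := M) (a := 1) (r := x % M) hM (Nat.mod_lt _ hM), Nat.mod_add_mod]

/-- The states `s` and `s'` agree on the registers `R` and the arrays `A`. -/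
structure Agree (R A : List ℕ) (s s' : State) : Prop where
  reg : ∀ x ∈ R, s'.reg x = s.reg x
  arr : ∀ a ∈ A, s'.arr a = s.arr a

theorem Agree.trans {R A : List ℕ} {s s' s'' : State} (h : Agree R A s s') (h' : Agree R A s' s'') :
    Agree R A s s'' :=
  ⟨fun x hx => (h'.reg x hx).trans (h.reg x hx), fun a ha => (h'.arr a ha).trans (h.arr a ha)⟩

theorem Frame.agree {R A R' A' : List ℕ} {s s' : State} (h : Frame R' A' s s')
    (hR : ∀ x ∈ R, x ∉ R') (hA : ∀ a ∈ A, a ∉ A') : Agree R A s s' :=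
  ⟨fun x hx => h.reg x (hR x hx), fun a ha => h.arr a (hA a ha)⟩

theorem Preserved.agree {R A : List ℕ} {s s' : State} (h : Preserved s s')
    (hR : ∀ x ∈ R, x < 32 ∧ x ≠ rSize ∧ x ≠ rRank) (hA : ∀ a ∈ A, a < 8 ∧ a ≠ aPi) :
    Agree R A s s' :=
  ⟨fun x hx => h.1 x (hR x hx).1 (hR x hx).2.1 (hR x hx).2.2,
    fun a ha => h.2 a (hA a ha).1 (hA a ha).2⟩

theorem Agree.setReg {R A : List ℕ} {s s' : State} (h : Agree R A s s') {x : ℕ} (hx : x ∉ R)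
    (v : ℕ) : Agree R A s (s'.setReg x v) :=
  ⟨fun y hy => by rw [State.setReg_reg, if_neg fun h' : y = x => hx (h' ▸ hy), h.reg y hy], h.arr⟩

theorem Agree.run {R A : List ℕ} {s : State} {p : Cmd} (hp : p.loopFree = true)
    (hR : ∀ x ∈ R, x ∉ p.regs) (hA : ∀ a ∈ A, a ∉ p.arrs) : Agree R A s (p.run s) := by
  obtain ⟨s', t, h₁, -, rfl, h₂⟩ :=
    (Runs.straight (s := s) hp le_rfl (Q := fun s' => s' = p.run s) (.refl _)).frame
  exact h₂.agree hR hA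

namespace Ingredients.Valid

variable {F : Ingredients} {c k d : ℕ}

theorem auxSize_pos (h : F.Valid c) (hk : 2 ≤ k) : 0 < auxSize (k + 1) := by
  have := h.aux_code (k + 1) (by omega)
  rw [← this.size, List.length_pos_iff]
  intro hn
  have := this.first
  simp [hn] at this

theorem hatSize_eq (h : F.Valid c) (hk : 2 ≤ k) :
    F.hatSize k d = k.factorial * auxSize (k + 1) ^ (d - 1) := by
  rw [Ingredients.hatSize, hatSeq,
    length_levelSeq (h.aux_code (k + 1) (by omega)).size (h.auxSize_pos hk),
    (h.comp_code k hk).size]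

theorem isVec_word (h : F.Valid c) (hk : 2 ≤ k) (hd : 1 ≤ d) {R : ℕ} (hR : R < F.hatSize k d) :
    IsVec (hatVec k d (auxSize (k + 1)) (F.comp k) (F.aux (k + 1)) (d - 1)
      ((R + F.hatSize k d - 1) % F.hatSize k d + 1)) (F.word k d R) := by
  have h' := isVec_hatVec (d := d) (by omega) hd (h.comp_code k hk) (h.aux_code (k + 1) (by omega))
    (h.auxSize_pos hk) (R := R) hR.le
  rw [h.hatSize_eq hk] at hR ⊢
  intro p
  rw [← hatVec_pred (h.auxSize_pos hk) (h.comp_code k hk).size k.factorial_pos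
    (h.comp_code k hk).cyclic hR]
  exact h' p

theorem codeword_comp_mod (h : F.Valid c) (hk : 2 ≤ k) {m : ℕ} (hm : m < k.factorial) :
    codeword 1 (1 : Perm (Fin k)) (F.comp k) ((m + 1) % k.factorial) =
      codeword 1 (1 : Perm (Fin k)) (F.comp k) (m + 1) := by
  rcases Nat.eq_or_lt_of_le (show m + 1 ≤ k.factorial from hm) with h' | h'
  · rw [h', Nat.mod_self, (h.comp_code k hk).cyclic, codeword_zero]
  · rw [Nat.mod_eq_of_lt h']

/-- The windows yield the local ranks, each the cyclic successor of a digit of `m`. The loop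
reassembles `m` by Horner's rule from the top window downwards. -/
theorem rankWithin (h : F.Valid c) (hk : 2 ≤ k) (hd : 1 ≤ d) :
    F.RankWithin k d (d * (c * (k + 1) ^ 2 + k * 60 + 250) + c * k ^ 2 + k * 120 + d * 20 + 500) := by
  intro s R hR hK hD hσ
  have hM := h.auxSize_pos hk
  have hw := h.isVec_word hk hd hR
  rw [holds_iff _ _ _ hw] at hσ
  have hsize := h.hatSize_eq (d := d) hk
  set N := F.hatSize k d
  set M := auxSize (k + 1)
  set m := (R + N - 1) % N with hm
  have hmR : (m + 1) % N = R := by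
    rw [hm, Nat.mod_add_mod, show R + N - 1 + 1 = R + N by omega, Nat.add_mod_right,
      Nat.mod_eq_of_lt hR]
  have hmN : m < N := Nat.mod_lt _ (by omega)
  have hm₀ : m / M ^ (d - 1) < k.factorial := by
    rw [Nat.div_lt_iff_lt_mul (Nat.pow_pos hM), ← hsize]; exact hmN
  have hMlen : (F.aux (k + 1)).length = M := (h.aux_code (k + 1) (by omega)).size
  have hClen : (F.comp k).length = k.factorial := (h.comp_code k hk).size
  clear_value m N
  suffices hrun : Runs (rankProg F.rankComplete F.rankAux) s
      (d * (c * (k + 1) ^ 2 + k * 60 + 250) + c * k ^ 2 + k * 120 + d * 20 + 500)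
      fun s' => s'.reg rM = R from hrun
  have hlw := mul_last_window (k := k) hd
  unfold rankProg
  refine Runs.cons (sizes_runs hK hD) (T₂ := d * (c * (k + 1) ^ 2 + k * 60 + 250) + c * k ^ 2 +
    k * 60 + 300) (by omega) ?_
  rintro s₁ ⟨⟨hF₁, hA₁, hT₁⟩, f₁⟩
  rw [← hsize] at hT₁
  have hK₁ : s₁.reg rK = k := by rw [f₁.reg _ (by decide), hK]
  have hD₁ : s₁.reg rD = d := by rw [f₁.reg _ (by decide), hD]
  have hσ₁ : s₁.arr aSigma = s.arr aSigma := f₁.arr _ (by decide)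
  rw [← hσ₁] at hσ
  refine Runs.cons_run rfl (T₁ := 2) (T₂ := d * (c * (k + 1) ^ 2 + k * 60 + 250) + c * k ^ 2 +
    k * 60 + 298) (by decide) (by omega) ?_
  refine Runs.cons_run rfl (T₁ := 2) (T₂ := d * (c * (k + 1) ^ 2 + k * 60 + 250) + c * k ^ 2 +
    k * 60 + 296) (by decide) (by omega) ?_
  refine Runs.cons (T₂ := d * (c * (k + 1) ^ 2 + k * 60 + 250) + c * k ^ 2 + 256)
    (readWindow_runs (k := k) (d := d) (j := d - 1) (n := k)
      (isVec_vals (codeword 1 (1 : Perm (Fin k)) (F.comp k) (m / M ^ (d - 1) + 1)))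
      (by omega) (by simp [hK₁]) (by simp [hD₁]) (by simp [hD₁]; omega) (by simp [hK₁])
      fun p hp hp' => ?_) (by omega) ?_
  · simp only [Cmd.run, State.setReg_arr]
    rw [hσ _ (by omega)]
    have := hatVec_add (k := k) (d := d) (comp := F.comp k) (aux := F.aux (k + 1)) hM (e := 0)
      (t := d - 1) (m := m) (p := k * (d - 1) + p) (by omega) (by rw [Nat.sub_zero]; omega)
    rw [Nat.zero_add] at this
    rw [this, alphaVal_last_window hd hp']
  rintro s₂ ⟨h₂, f₂⟩
  have a₂ : Agree [rK, rD, rFact, rAux, rTotal] [aSigma] s₁ s₂ :=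
    ((Agree.run (p := .set rJ (.reg rD)) rfl (by decide) (by decide)).trans
      (Agree.run (p := .set rSize (.reg rK)) rfl (by decide) (by decide))).trans
        (f₂.agree (by decide) (by decide))
  rw [← h.codeword_comp_mod hk hm₀] at h₂
  refine Runs.cons (T₁ := c * k ^ 2) (T₂ := d * (c * (k + 1) ^ 2 + k * 60 + 250) + 256)
    (h.comp_rank k hk s₂ _ (by rw [hClen]; exact Nat.mod_lt _ k.factorial_pos)
      (by rw [f₂.reg _ (by decide)]; simp [hK₁]) h₂) (by omega) ?_
  rintro s₃ ⟨h₃, p₃⟩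
  have a₃ := a₂.trans (p₃.agree (by decide) (by decide))
  refine Runs.cons_run rfl (T₁ := 10) (T₂ := d * (c * (k + 1) ^ 2 + k * 60 + 250) + 246)
    (by decide) (by omega) ?_
  have a₄ := a₃.trans (Agree.run (p := .set rAcc ((.reg rRank + .reg rFact - 1) % .reg rFact)) rfl
    (by decide) (by decide))
  have hacc : (Cmd.run (.set rAcc ((.reg rRank + .reg rFact - 1) % .reg rFact)) s₃).reg rAcc =
      m / M ^ (d - 1) := by
    simp [h₃, a₃.reg rFact (by decide), hF₁]
    rw [succ_mod_add_sub_one_mod k.factorial_pos, Nat.mod_eq_of_lt hm₀]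
  generalize Cmd.run (.set rAcc ((.reg rRank + .reg rFact - 1) % .reg rFact)) s₃ = s₄ at a₄ hacc
  -- The invariant says that the accumulator holds the leading digits of `m` found so far. The body
  -- contains an unknown subroutine, so its syntax guarantees nothing and the needed registers are
  -- tracked through `Agree` instead.
  refine Runs.cons (T₂ := 30) ((Runs.forUp (T := c * (k + 1) ^ 2 + k * 60 + 200) (N := d) (a := 1)
    (b := d - 1)
    (I := fun i s' => Agree [rK, rD, rFact, rAux, rTotal] [aSigma] s₁ s' ∧
      s'.reg rAcc = m / M ^ (d - i)) rfl ⟨a₄.setReg (by decide) _, by simp [hacc]⟩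
    (by omega) (by omega) (fun i s' _ _ _ h => by simp [h.1.reg rD (by decide), hD₁])
    fun i s' hi₁ hi₂ hi hI => ?_).mono (T' := d * (c * (k + 1) ^ 2 + k * 60 + 250) + 200) ?_
      fun s' h => h) (by omega) ?_
  · obtain ⟨e, rfl⟩ : ∃ e, i = e + 1 := ⟨i - 1, by omega⟩
    obtain ⟨aI, hacc'⟩ := hI
    have hwin := mul_window (k := k) (d := d) (e := e) (by omega)
    refine Runs.cons_run rfl (T₁ := 4) (T₂ := c * (k + 1) ^ 2 + k * 60 + 194) (by decide) (by omega) ?_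
    refine Runs.cons_run rfl (T₁ := 4) (T₂ := c * (k + 1) ^ 2 + k * 60 + 190) (by decide) (by omega) ?_
    refine Runs.cons (T₂ := c * (k + 1) ^ 2 + 90)
      (readWindow_runs (k := k) (d := d) (j := d - (e + 1) - 1) (n := k + 1)
        (isVec_vals (codeword 1 (1 : Perm (Fin (k + 1))) (F.aux (k + 1))
          ((m / M ^ (d - (e + 1) - 1) + 1) % M)))
        (by omega) (by simp [aI.reg rK (by decide), hK₁]) (by simp [aI.reg rD (by decide), hD₁])
        (by simp [aI.reg rD (by decide), hD₁, hi]; omega) (by simp [aI.reg rK (by decide), hK₁])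
        fun p hp hp' => ?_) (by omega) ?_
    · simp only [Cmd.run, State.setReg_arr]
      rw [aI.arr _ (by decide), hσ _ (by omega)]
      have := hatVec_add (k := k) (d := d) (comp := F.comp k) (aux := F.aux (k + 1)) hM (e := e + 1)
        (t := d - (e + 1) - 1) (m := m) (p := k * (d - (e + 1) - 1) + p) (by omega) (by omega)
      rw [show e + 1 + (d - (e + 1) - 1) = d - 1 by omega] at this
      rw [this, alphaVal_window hM (by omega) hp' (by omega)]
    rintro t₁ ⟨g₁, f₁⟩
    have b₁ : Agree [rK, rD, rFact, rAux, rTotal, rAcc, rI] [aSigma] s' t₁ :=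
      ((Agree.run (p := .set rJ (.reg rD - .reg rI)) rfl (by decide) (by decide)).trans
        (Agree.run (p := .set rSize (.reg rK + 1)) rfl (by decide) (by decide))).trans
          (f₁.agree (by decide) (by decide))
    refine Runs.cons (T₁ := c * (k + 1) ^ 2) (T₂ := 90)
      (h.aux_rank (k + 1) (by omega) t₁ _ (by rw [hMlen]; exact Nat.mod_lt _ hM)
        (by rw [f₁.reg _ (by decide)]; simp [aI.reg rK (by decide), hK₁]) g₁) (by omega) ?_
    rintro t₂ ⟨g₂, p₂⟩
    have b₂ := b₁.trans (p₂.agree (by decide) (by decide))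
    refine (Runs.straight (s := t₂) rfl (by decide) (Q := fun t => t.reg rAcc = m / M ^ (d - (e + 1 + 1)))
      ?_).frame.imp ?_
    · have hAux : t₂.reg rAux = M := by
        rw [b₂.reg _ (by decide), aI.reg _ (by decide), hA₁]
      have hAcc : t₂.reg rAcc = m / M ^ (d - (e + 1)) := by rw [b₂.reg _ (by decide), hacc']
      simp [g₂, hAux, hAcc]
      rw [succ_mod_add_sub_one_mod hM, show d - (e + 1) = d - (e + 1) - 1 + 1 by omega,
        pow_succ, ← Nat.div_div_eq_div_mul, show d - (e + 1 + 1) = d - (e + 1) - 1 by omega,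
        Nat.add_sub_cancel, Nat.div_add_mod']
    · rintro t₃ ⟨g₃, f₃⟩
      refine ⟨?_, ?_, ?_⟩
      · rw [f₃.reg _ (by decide), b₂.reg _ (by decide), hi]
      · refine Agree.setReg ?_ (by decide) _
        refine aI.trans (Agree.trans ⟨fun x hx => b₂.reg x ?_, b₂.arr⟩
          (f₃.agree (by decide) (by decide)))
        revert x; decide
      · simp [g₃]
  · rw [show (Expr.reg rD - 1).cost = 3 from rfl, show (1 : Expr).cost = 1 from rfl]
    simp only [Nat.mul_add]
    omega
  rintro s₅ ⟨a₅, h₅⟩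
  rw [show d - (d - 1 + 1) = 0 by omega, pow_zero, Nat.div_one] at h₅
  refine Runs.straight rfl (by decide) ?_
  simp [h₅, a₅.reg rTotal (by decide), hT₁, hmR]

end Ingredients.Valid

/-! ### The procedure `Unrank` -/

/-- The rule for `for` loops that fill the positions `2, …, n` of a window. -/
theorem Runs.window {hi : Expr} {p : Cmd} {s : State} {T n : ℕ} (off : ℕ) (g : ℕ → ℕ) (hn : 0 < n)
    (hx : rR ∉ p.regs) (hhi : ∀ s', Frame (rR :: p.regs) p.arrs s s' → hi.eval s' = n)
    (step : ∀ q, 0 < q → q < n → ∀ s', s'.reg rR = q + 1 → Frame (rR :: p.regs) p.arrs s s' →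
      Runs p s' T fun s'' => s''.arr aSigma (off + q + 1) = g q ∧
        ∀ i, i ≠ off + q + 1 → s''.arr aSigma i = s'.arr aSigma i) :
    Runs (.forUp rR 2 hi p) s (n * (T + hi.cost + 9) + hi.cost + 7) fun s' =>
      ((∀ q, 0 < q → q < n → s'.arr aSigma (off + q + 1) = g q) ∧
        ∀ i, off + n < i → s'.arr aSigma i = s.arr aSigma i) ∧
      Frame (rR :: p.regs) p.arrs s s' := by
  refine (Runs.forUp_frame (T := T) (N := n) (a := 2) (b := n)
    (I := fun i s' => (∀ q, 0 < q → q + 1 < i → s'.arr aSigma (off + q + 1) = g q) ∧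
      ∀ i, off + n < i → s'.arr aSigma i = s.arr aSigma i) rfl hx (fun _ _ _ h => h)
    ⟨fun _ _ _ => by omega, fun _ _ => rfl⟩ (by omega) (by omega) hhi ?_).mono ?_
    fun s' h => ⟨⟨fun q hq hq' => h.1.1 q hq (by omega), h.1.2⟩, h.2⟩
  · intro i s' h₁ h₂ h₃ hf hI
    obtain ⟨q, rfl⟩ : ∃ q, i = q + 1 := ⟨i - 1, by omega⟩
    refine (step q (by omega) (by omega) s' h₃ hf).imp fun s'' h => ⟨fun r hr hr' => ?_, fun i hi => ?_⟩
    · rcases Nat.eq_or_lt_of_le (show r ≤ q by omega) with rfl | h'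
      · exact h.1
      · rw [h.2 _ (by omega), hI.1 r hr (by omega)]
    · rw [h.2 _ (by omega), hI.2 i hi]
  · rw [show (2 : Expr).cost = 1 from rfl]
    omega

/-- The final part of a round of `Unrank`: write the window from the codeword `π`. -/
def writeWindow : Cmd := .block [
  .forUp rR 2 (.reg rK + 1) (.block [
    .set rV (.get aPi (.reg rR)),
    .ite (.bin .eq (.reg rV) (.reg rK + 1))
      (.set rV (.reg rX))
      alphaInv,
    .put aSigma (.reg rK * (.reg rJ - 1) + .reg rR) (.reg rV)]),
  .set rV (.get aPi 1),
  .ite (.bin .eq (.reg rV) (.reg rK + 1))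
    .skip
    (.seq alphaInv (.set rX (.reg rV)))]

theorem writeWindow_runs {k d j : ℕ} {s : State} (g : ℕ → ℕ) (hK : s.reg rK = k)
    (hD : s.reg rD = d) (hJ : s.reg rJ = j + 1)
    (hg : ∀ p < k + 1, (if s.arr aPi (p + 1) = k + 1 then s.reg rX else
      d * (s.arr aPi (p + 1) % k) + (j + 1)) = g p) :
    Runs writeWindow s (k * 60 + 200) fun s' =>
      ((∀ p, 0 < p → p < k + 1 → s'.arr aSigma (k * j + p + 1) = g p) ∧
        (∀ i, k * j + (k + 1) < i → s'.arr aSigma i = s.arr aSigma i) ∧ s'.reg rX = g 0) ∧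
      Frame writeWindow.regs writeWindow.arrs s s' := by
  refine Runs.frame ?_
  unfold writeWindow
  refine Runs.cons (T₁ := (k + 1) * 60 + 10) (T₂ := 130) ((Runs.window (T := 48) (n := k + 1) (k * j) g
    (by omega) (by decide) (fun t hf => by simp [hf.reg rK (by decide), hK])
    fun q hq hq' t ht hf => Runs.straight rfl (by decide) ?_).mono (by
      rw [show (Expr.reg rK + 1).cost = 3 from rfl]) fun s' h => h) (by omega) ?_
  · have hK' : t.reg rK = k := by rw [hf.reg _ (by decide), hK]
    have hD' : t.reg rD = d := by rw [hf.reg _ (by decide), hD]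
    have hJ' : t.reg rJ = j + 1 := by rw [hf.reg _ (by decide), hJ]
    have hX' : t.reg rX = s.reg rX := hf.reg _ (by decide)
    have hP' : t.arr aPi = s.arr aPi := hf.arr _ (by decide)
    rw [← hg q hq']
    by_cases h : s.arr aPi (q + 1) = k + 1
    · refine ⟨?_, fun i hne => ?_⟩ <;> simp [hK', hJ', ht, hP', hX', h, Nat.add_assoc]
      exact fun h' => absurd h' hne
    · refine ⟨?_, fun i hne => ?_⟩ <;>
        simp [alphaInv, hK', hD', hJ', ht, hP', h, Nat.add_assoc]
      exact fun h' => absurd h' hne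
  rintro t ⟨⟨hnew, hold⟩, hf⟩
  refine Runs.straight rfl (by decide) ?_
  have hK' : t.reg rK = k := by rw [hf.reg _ (by decide), hK]
  have hD' : t.reg rD = d := by rw [hf.reg _ (by decide), hD]
  have hJ' : t.reg rJ = j + 1 := by rw [hf.reg _ (by decide), hJ]
  have hX' : t.reg rX = s.reg rX := hf.reg _ (by decide)
  have hP' : t.arr aPi = s.arr aPi := hf.arr _ (by decide)
  rw [← hg 0 (by omega)]
  by_cases h : s.arr aPi 1 = k + 1
  · refine ⟨fun p hp hp' => ?_, fun i hi => ?_, ?_⟩ <;> simp [hK', hP', hX', h]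
    · exact hnew p hp hp'
    · exact hold i hi
  · refine ⟨fun p hp hp' => ?_, fun i hi => ?_, ?_⟩ <;> simp [alphaInv, hK', hD', hJ', hP', h]
    · exact hnew p hp hp'
    · exact hold i hi

namespace Ingredients.Valid

variable {F : Ingredients} {c k d : ℕ}

-- The digits of `m` are split off from the lowest window upwards, and the word is then written from
-- the highest window downwards, with `rX` carrying the entry at the first position of the last
-- window treated.
set_option maxHeartbeats 1000000 in
theorem unrankWithin (h : F.Valid c) (hk : 2 ≤ k) (hd : 1 ≤ d) :
    F.UnrankWithin k d (d * (c * (k + 1) ^ 2 + k * 60 + 300) + c * k ^ 2 + k * 120 + d * 60 + 700) := by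
  intro s R hR hK hD hRm
  have hM := h.auxSize_pos hk
  have hw := h.isVec_word hk hd hR
  have hsize := h.hatSize_eq (d := d) hk
  set N := F.hatSize k d
  set M := auxSize (k + 1)
  set m := (R + N - 1) % N with hm
  have hmN : m < N := Nat.mod_lt _ (by omega)
  have hm₀ : m / M ^ (d - 1) < k.factorial := by
    rw [Nat.div_lt_iff_lt_mul (Nat.pow_pos hM), ← hsize]; exact hmN
  have hMlen : (F.aux (k + 1)).length = M := (h.aux_code (k + 1) (by omega)).size
  have hClen : (F.comp k).length = k.factorial := (h.comp_code k hk).size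
  have hlw := mul_last_window (k := k) hd
  have hvec := (holds_iff · _ _ hw)
  clear_value N m
  suffices hrun : Runs (unrankProg F.unrankComplete F.unrankAux) s
      (d * (c * (k + 1) ^ 2 + k * 60 + 300) + c * k ^ 2 + k * 120 + d * 60 + 700)
      fun s' => ∀ p < k * d, s'.arr aSigma (p + 1) =
        hatVec k d M (F.comp k) (F.aux (k + 1)) (d - 1) (m + 1) p + 1 from
    hrun.imp fun s' hs' => (hvec _).2 hs'
  unfold unrankProg
  refine Runs.cons (sizes_runs hK hD) (T₂ := d * (c * (k + 1) ^ 2 + k * 60 + 300) + c * k ^ 2 +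
    k * 60 + d * 40 + 500) (by omega) ?_
  rintro s₁ ⟨⟨hF₁, hA₁, hT₁⟩, f₁⟩
  rw [← hsize] at hT₁
  have hK₁ : s₁.reg rK = k := by rw [f₁.reg _ (by decide), hK]
  have hD₁ : s₁.reg rD = d := by rw [f₁.reg _ (by decide), hD]
  have hm₁ : s₁.reg rM = R := by rw [f₁.reg _ (by decide), hRm]
  refine Runs.cons_run rfl (T₁ := 10) (T₂ := d * (c * (k + 1) ^ 2 + k * 60 + 300) + c * k ^ 2 +
    k * 60 + d * 40 + 490) (by decide) (by omega) ?_
  have a₂ : Agree [rK, rD, rFact, rAux] [] s₁ _ := Agree.run (s := s₁)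
    (p := .set rAcc ((.reg rM + .reg rTotal - 1) % .reg rTotal)) rfl (by decide) (by decide)
  have hacc : (Cmd.run (.set rAcc ((.reg rM + .reg rTotal - 1) % .reg rTotal)) s₁).reg rAcc = m := by
    simp [hm₁, hT₁, hm]
  generalize Cmd.run (.set rAcc ((.reg rM + .reg rTotal - 1) % .reg rTotal)) s₁ = s₂ at a₂ hacc
  refine Runs.cons (T₁ := d * 40 + 20) (T₂ := d * (c * (k + 1) ^ 2 + k * 60 + 300) + c * k ^ 2 +
    k * 60 + 470) ((Runs.forUp_frame (T := 20) (N := d) (a := 1) (b := d - 1)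
    (I := fun i s' => (∀ j, 0 < j → j < i → s'.arr aR j = (m / M ^ (j - 1) + 1) % M) ∧
      s'.reg rAcc = m / M ^ (i - 1)) rfl (by decide) (fun i s' v h => ⟨h.1, by simp [h.2]⟩)
    ⟨fun _ _ _ => by omega, by simp [hacc]⟩ (by omega) (by omega)
    (fun s' h => by simp [h.reg rD (by decide), a₂.reg rD (by decide), hD₁])
    fun i s' h₁ h₂ hi hf hI => ?_).mono ?_ fun s' h => h) (by omega) ?_
  · have hAux : s'.reg rAux = M := by
      rw [hf.reg _ (by decide), a₂.reg _ (by decide), hA₁]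
    refine Runs.straight rfl (by decide) ⟨fun j hj hj' => ?_, ?_⟩
    · rcases Nat.eq_or_lt_of_le (show j ≤ i by omega) with rfl | h'
      · simp [hi, hI.2, hAux]
      · simp [hi, show j ≠ i by omega, hI.1 j hj h']
    · obtain ⟨i, rfl⟩ : ∃ i', i = i' + 1 := ⟨i - 1, by omega⟩
      simp [hI.2, hAux, Nat.div_div_eq_div_mul, pow_succ]
  · rw [show (Expr.reg rD - 1).cost = 3 from rfl, show (1 : Expr).cost = 1 from rfl]
    omega
  rintro s₃ ⟨⟨hR₃, hacc₃⟩, f₃⟩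
  rw [Nat.add_sub_cancel] at hacc₃
  have a₃ := a₂.trans (f₃.agree (R := [rK, rD, rFact, rAux]) (A := []) (by decide) (by decide))
  refine Runs.cons (T₁ := 10) (T₂ := d * (c * (k + 1) ^ 2 + k * 60 + 300) + c * k ^ 2 +
    k * 60 + 460) (Runs.straight rfl (by decide) (Q := fun s' =>
      s'.arr aR d = (m / M ^ (d - 1) + 1) % k.factorial ∧
      ∀ j, 0 < j → j < d → s'.arr aR j = (m / M ^ (j - 1) + 1) % M) ⟨?_, fun j hj hj' => ?_⟩).frame
    (by omega) ?_
  · simp [a₃.reg rD (by decide), hD₁, a₃.reg rFact (by decide), hF₁, hacc₃]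
  · simp [a₃.reg rD (by decide), hD₁, show j ≠ d by omega]
    exact hR₃ j hj (by omega)
  rintro s₄ ⟨⟨hRd, hRj⟩, f₄⟩
  have a₄ := a₃.trans (f₄.agree (R := [rK, rD, rFact, rAux]) (A := []) (by decide) (by decide))
  refine Runs.cons_run rfl (T₁ := 2) (T₂ := d * (c * (k + 1) ^ 2 + k * 60 + 300) + c * k ^ 2 +
    k * 60 + 458) (by decide) (by omega) ?_
  refine Runs.cons_run rfl (T₁ := 2) (T₂ := d * (c * (k + 1) ^ 2 + k * 60 + 300) + c * k ^ 2 +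
    k * 60 + 456) (by decide) (by omega) ?_
  refine Runs.cons (T₁ := 4) (T₂ := d * (c * (k + 1) ^ 2 + k * 60 + 300) + c * k ^ 2 +
    k * 60 + 452) (Runs.straight rfl (by decide) (Q := fun s' =>
      s'.reg rRank = (m / M ^ (d - 1) + 1) % k.factorial ∧ s'.reg rSize = k ∧ s'.reg rJ = d ∧
      Agree [rK, rD] [aR] s₄ s') ?_) (by omega) ?_
  · refine ⟨by simp [a₄.reg rD (by decide), hD₁, hRd], by simp [a₄.reg rK (by decide), hK₁],
      by simp [a₄.reg rD (by decide), hD₁], ?_⟩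
    exact ((Agree.run rfl (by decide) (by decide)).trans (Agree.run rfl (by decide) (by decide))).trans
      (Agree.run rfl (by decide) (by decide))
  rintro s₅ ⟨hrank₅, hsize₅, hJ₅, a₅⟩
  have hK₄ : s₄.reg rK = k := by rw [a₄.reg _ (by decide), hK₁]
  have hD₄ : s₄.reg rD = d := by rw [a₄.reg _ (by decide), hD₁]
  refine Runs.cons (T₁ := c * k ^ 2) (T₂ := d * (c * (k + 1) ^ 2 + k * 60 + 300) + k * 60 + 452)
    (h.comp_unrank k hk s₅ _ (by rw [hClen]; exact Nat.mod_lt _ k.factorial_pos) hsize₅ hrank₅)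
    (by omega) ?_
  rintro s₆ ⟨h₆, p₆⟩
  rw [h.codeword_comp_mod hk hm₀, holds_iff _ _ _ (isVec_vals _)] at h₆
  have a₆ := a₅.trans (p₆.agree (by decide) (by decide))
  have hJ₆ : s₆.reg rJ = d - 1 + 1 := by
    rw [p₆.1 _ (by decide) (by decide) (by decide), hJ₅]; omega
  have hfirst : ∀ p < k, d * ((s₆.arr aPi (p + 1)) % k) + (d - 1 + 1) =
      hatVec k d M (F.comp k) (F.aux (k + 1)) 0 (m / M ^ (d - 1) + 1) (k * (d - 1) + p) + 1 := by
    intro p hp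
    rw [h₆ p hp, hatVec, if_neg (by omega), Nat.add_sub_cancel_left]
    rfl
  refine Runs.cons (T₁ := k * 50 + 10) (T₂ := d * (c * (k + 1) ^ 2 + k * 60 + 300) + 440)
    ((Runs.window (T := 40) (n := k) (k * (d - 1)) (fun p =>
      hatVec k d M (F.comp k) (F.aux (k + 1)) 0 (m / M ^ (d - 1) + 1) (k * (d - 1) + p) + 1)
      (by omega) (by decide) (fun s' hf => by
        simp [hf.reg rK (by decide), a₆.reg rK (by decide), hK₄])
      fun q hq hq' s' hi hf => Runs.straight rfl (by decide) ?_).mono (by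
        rw [show (Expr.reg rK).cost = 1 from rfl]; omega) fun s' h => h) (by omega) ?_
  · have hK' : s'.reg rK = k := by rw [hf.reg _ (by decide), a₆.reg _ (by decide), hK₄]
    have hD' : s'.reg rD = d := by rw [hf.reg _ (by decide), a₆.reg _ (by decide), hD₄]
    have hJ' : s'.reg rJ = d - 1 + 1 := by rw [hf.reg _ (by decide), hJ₆]
    have hP' : s'.arr aPi = s₆.arr aPi := hf.arr _ (by decide)
    refine ⟨?_, fun i hne => ?_⟩
    · rw [← hfirst q hq']
      simp [alphaInv, hK', hD', hJ', hi, hP', Nat.add_assoc]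
    · simp [alphaInv, hK', hD', hi]
      intro h'
      omega
  rintro s₇ ⟨⟨h₇, -⟩, f₇⟩
  have a₇ := a₆.trans (f₇.agree (by decide) (by decide))
  refine Runs.cons_run rfl (T₁ := 3) (T₂ := d * (c * (k + 1) ^ 2 + k * 60 + 300) + 437)
    (by decide) (by omega) ?_
  refine Runs.cons_run rfl (T₁ := 10) (T₂ := d * (c * (k + 1) ^ 2 + k * 60 + 300) + 427)
    (by decide) (by omega) ?_
  refine Runs.cons (T₁ := 2) (T₂ := d * (c * (k + 1) ^ 2 + k * 60 + 300) + 425)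
    (Runs.straight rfl (by decide) (Q := fun s' =>
      s'.reg rX = hatVec k d M (F.comp k) (F.aux (k + 1)) 0 (m / M ^ (d - 1) + 1) (k * (d - 1)) + 1 ∧
      Agree [rK, rD] [aR, aSigma] s₇ s') ?_) (by omega) ?_
  · have hK' : s₇.reg rK = k := by rw [a₇.reg _ (by decide), hK₄]
    have hD' : s₇.reg rD = d := by rw [a₇.reg _ (by decide), hD₄]
    have hJ' : s₇.reg rJ = d - 1 + 1 := by rw [f₇.reg _ (by decide), hJ₆]
    have hP' : s₇.arr aPi = s₆.arr aPi := f₇.arr _ (by decide)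
    have := hfirst 0 (by omega)
    refine ⟨?_, ((Agree.run rfl (by decide) (by decide)).trans
      (Agree.run rfl (by decide) (by decide))).trans (Agree.run rfl (by decide) (by decide))⟩
    rw [Nat.add_zero (k * (d - 1))] at this
    rw [← this]
    simp [alphaInv, hK', hD', hJ', hP']
  rintro s₈ ⟨hX₈, a₈⟩
  have hσ₈ : s₈.arr aSigma = s₇.arr aSigma := a₈.arr _ (by decide)
  have a₈ : Agree [rK, rD] [aR] s₄ s₈ := a₇.trans ⟨a₈.reg, fun a ha => a₈.arr a (by revert a; decide)⟩
  -- What is written beyond the start of a window is final, as an entry of the word on the lowest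
  -- level.
  have hadd : ∀ e < d, ∀ p, k * (d - e - 1) < p →
      hatVec k d M (F.comp k) (F.aux (k + 1)) (d - 1) (m + 1) p =
        hatVec k d M (F.comp k) (F.aux (k + 1)) e (m / M ^ (d - e - 1) + 1) p := by
    intro e he p hp
    have := hatVec_add (d := d) (comp := F.comp k) (aux := F.aux (k + 1)) hM (e := e)
      (t := d - e - 1) (m := m) (by omega) hp
    rwa [show e + (d - e - 1) = d - 1 by omega] at this
  -- Invariant: all cells beyond the start of the last window treated have their final values, and
  -- the entry at that start, still subject to change by lower levels, waits in `rX`.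
  refine Runs.cons (T₁ := d * (c * (k + 1) ^ 2 + k * 60 + 300) + 20) (T₂ := 30)
    ((Runs.forUp (T := c * (k + 1) ^ 2 + k * 60 + 250) (N := d) (a := 1) (b := d - 1)
    (I := fun i s' => Agree [rK, rD] [aR] s₄ s' ∧
      (∀ p, k * (d - i) < p → p < k * d → s'.arr aSigma (p + 1) =
        hatVec k d M (F.comp k) (F.aux (k + 1)) (d - 1) (m + 1) p + 1) ∧
      s'.reg rX = hatVec k d M (F.comp k) (F.aux (k + 1)) (i - 1) (m / M ^ (d - i) + 1)
        (k * (d - i)) + 1) rfl ⟨a₈.setReg (by decide) _, fun p hp hp' => ?_, ?_⟩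
    (by omega) (by omega) (fun i s' _ _ _ h => by simp [h.1.reg rD (by decide), hD₄])
    fun i s' hi₁ hi₂ hi hI => ?_).mono ?_ fun s' h => h) (by omega) ?_
  · rw [hadd 0 (by omega) p (by rwa [Nat.sub_zero])]
    have := h₇ (p - k * (d - 1)) (by omega) (by omega)
    rw [show k * (d - 1) + (p - k * (d - 1)) = p by omega] at this
    rw [State.setReg_arr, hσ₈, this, Nat.sub_zero]
  · rw [State.setReg_reg, if_neg (by decide), hX₈]
  · obtain ⟨e, rfl⟩ : ∃ e, i = e + 1 := ⟨i - 1, by omega⟩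
    obtain ⟨aI, hσI, hXI⟩ := hI
    have hwin := mul_window (k := k) (d := d) (e := e) (by omega)
    have hKI : s'.reg rK = k := by rw [aI.reg _ (by decide), hK₄]
    have hDI : s'.reg rD = d := by rw [aI.reg _ (by decide), hD₄]
    refine Runs.cons_run rfl (T₁ := 4) (T₂ := c * (k + 1) ^ 2 + k * 60 + 246) (by decide) (by omega) ?_
    refine Runs.cons_run rfl (T₁ := 4) (T₂ := c * (k + 1) ^ 2 + k * 60 + 242) (by decide) (by omega) ?_
    refine Runs.cons (T₁ := 4) (T₂ := c * (k + 1) ^ 2 + k * 60 + 238)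
      (Runs.straight rfl (by decide) (Q := fun t =>
        t.reg rRank = (m / M ^ (d - (e + 1) - 1) + 1) % M ∧ t.reg rSize = k + 1 ∧
        t.reg rJ = d - (e + 1) - 1 + 1 ∧ Agree [rK, rD, rX, rI] [aR, aSigma] s' t) ?_) (by omega) ?_
    · refine ⟨?_, by simp [hKI], by simp [hDI, hi]; omega, ?_⟩
      · simp [hDI, hi, aI.arr aR (by decide), hRj (d - (e + 1)) (by omega) (by omega)]
      · exact ((Agree.run rfl (by decide) (by decide)).trans
          (Agree.run rfl (by decide) (by decide))).trans (Agree.run rfl (by decide) (by decide))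
    rintro t₁ ⟨hr₁, hs₁, hJ₁, b₁⟩
    refine Runs.cons (T₁ := c * (k + 1) ^ 2) (T₂ := k * 60 + 238)
      (h.aux_unrank (k + 1) (by omega) t₁ _ (by rw [hMlen]; exact Nat.mod_lt _ hM) hs₁ hr₁)
      (by omega) ?_
    rintro t₂ ⟨h₂, p₂⟩
    rw [holds_iff _ _ _ (isVec_vals _)] at h₂
    have b₂ := b₁.trans (p₂.agree (by decide) (by decide))
    have hJ₂ : t₂.reg rJ = d - (e + 1) - 1 + 1 := by
      rw [p₂.1 _ (by decide) (by decide) (by decide), hJ₁]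
    have hK₂ : t₂.reg rK = k := by rw [b₂.reg _ (by decide), hKI]
    have hD₂ : t₂.reg rD = d := by rw [b₂.reg _ (by decide), hDI]
    have hX₂ : t₂.reg rX = hatVec k d M (F.comp k) (F.aux (k + 1)) e (m / M ^ (d - (e + 1)) + 1)
        (k * (d - (e + 1))) + 1 := by rw [b₂.reg _ (by decide), hXI, Nat.add_sub_cancel]
    have hval : ∀ p < k + 1, (if t₂.arr aPi (p + 1) = k + 1 then t₂.reg rX else
        d * ((t₂.arr aPi (p + 1)) % k) + (d - (e + 1) - 1 + 1)) =
          hatVec k d M (F.comp k) (F.aux (k + 1)) (e + 1) (m / M ^ (d - (e + 1) - 1) + 1)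
            (k * (d - (e + 1) - 1) + p) + 1 := by
      intro p hp
      have hlt := vals_lt (codeword 1 (1 : Perm (Fin (k + 1))) (F.aux (k + 1))
        ((m / M ^ (d - (e + 1) - 1) + 1) % M)) hp
      rw [h₂ p hp, hatVec_succ hM,
        if_neg (show ¬ k * (d - (e + 1) - 1) + p < k * (d - (e + 1) - 1) by omega),
        if_pos (show k * (d - (e + 1) - 1) + p ≤ k * (d - (e + 1) - 1) + k by omega),
        Nat.add_sub_cancel_left]
      split_ifs with h' h'' h''
      · omega
      · rw [hX₂, hwin.1, Nat.div_div_eq_div_mul, ← pow_succ,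
          show d - (e + 1) - 1 + 1 = d - (e + 1) by omega, show d - (e + 1) = d - e - 1 by omega]
      · rfl
      · omega
    refine ((writeWindow_runs _ hK₂ hD₂ hJ₂ hval).mono (T' := k * 60 + 238) (by omega)
      fun _ h => h).imp ?_
    rintro t₃ ⟨⟨hnew, hold, hX₃⟩, f₃⟩
    have b₃ : Agree [rK, rD, rI] [aR] s' t₃ :=
      Agree.trans ⟨fun x hx => b₂.reg x (by revert x; decide), fun a ha => b₂.arr a (by revert a; decide)⟩
        (f₃.agree (by decide) (by decide))
    refine ⟨?_, ?_, fun p hp hp' => ?_, ?_⟩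
    · rw [b₃.reg _ (by decide), hi]
    · refine Agree.setReg ?_ (by decide) _
      exact aI.trans ⟨fun x hx => b₃.reg x (by revert x; decide), b₃.arr⟩
    · rw [State.setReg_arr]
      rw [show d - (e + 1 + 1) = d - (e + 1) - 1 by omega] at hp
      -- Cells past the new window keep their old final values; cells inside it, except the first,
      -- have just been written.
      rcases Nat.lt_or_ge (k * (d - (e + 1) - 1) + k) p with h' | h'
      · rw [hold _ (by omega), b₂.arr _ (by decide), hσI p (by
          rw [show d - (e + 1) = d - e - 1 by omega]; omega) hp']
      · rw [hadd (e + 1) (by omega) p hp]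
        have := hnew (p - k * (d - (e + 1) - 1)) (by omega) (by omega)
        rwa [show k * (d - (e + 1) - 1) + (p - k * (d - (e + 1) - 1)) = p by omega] at this
    · rw [State.setReg_reg, if_neg (by decide), hX₃]
      rfl
  · rw [show (Expr.reg rD - 1).cost = 3 from rfl, show (1 : Expr).cost = 1 from rfl]
    simp only [Nat.mul_add]
    omega
  rintro s₉ ⟨-, hσ₉, hX₉⟩
  rw [show d - (d - 1 + 1) = 0 by omega, pow_zero, Nat.div_one, Nat.mul_zero, Nat.add_sub_cancel] at hX₉
  rw [show d - (d - 1 + 1) = 0 by omega, Nat.mul_zero] at hσ₉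
  refine Runs.straight rfl (by decide) fun p hp => ?_
  rcases Nat.eq_zero_or_pos p with rfl | h'
  · simp [hX₉]
  · simp [show p ≠ 0 by omega, hσ₉ p h' hp]

end Ingredients.Valid

end RankMod

/-! ### Uniform constants and the theorem -/

namespace RankMod

theorem Ingredients.RankWithin.mono {F : Ingredients} {k d T T' : ℕ} (h : F.RankWithin k d T)
    (hT : T ≤ T') : F.RankWithin k d T' := fun s m h₁ h₂ h₃ h₄ => by
  obtain ⟨s', t, a, b, c⟩ := h s m h₁ h₂ h₃ h₄
  exact ⟨s', t, a, b.trans hT, c⟩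

theorem Ingredients.UnrankWithin.mono {F : Ingredients} {k d T T' : ℕ} (h : F.UnrankWithin k d T)
    (hT : T ≤ T') : F.UnrankWithin k d T' := fun s m h₁ h₂ h₃ h₄ => by
  obtain ⟨s', t, a, b, c⟩ := h s m h₁ h₂ h₃ h₄
  exact ⟨s', t, a, b.trans hT, c⟩

/-- The subroutines contribute `c (k+1)² d + c k² ≤ 5 c k² d`, using the crude `(k+1)² ≤ 4 k²`; the
bookkeeping terms are absorbed in `2000 k² d` because `k`, `d` and `1` are all at most `k² d`. -/
theorem Ingredients.Valid.within {F : Ingredients} {c k d : ℕ} (h : F.Valid c) (hk : 2 ≤ k)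
    (hd : 1 ≤ d) : F.RankWithin k d ((5 * c + 2000) * (k ^ 2 * d)) ∧
      F.UnrankWithin k d ((5 * c + 2000) * (k ^ 2 * d)) := by
  have key : d * (c * (k + 1) ^ 2 + k * 60 + 300) + c * k ^ 2 + k * 120 + d * 60 + 700 ≤
      (5 * c + 2000) * (k ^ 2 * d) := by
    have h₁ : (k + 1) ^ 2 ≤ 4 * k ^ 2 := by nlinarith
    have h₂ : k ≤ k ^ 2 := Nat.le_self_pow two_ne_zero k
    have h₃ : 1 ≤ k ^ 2 := Nat.pow_pos (by omega)
    have h₄ : d * (c * (k + 1) ^ 2 + k * 60 + 300) ≤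
        d * (c * (4 * k ^ 2) + k ^ 2 * 60 + 300 * k ^ 2) :=
      Nat.mul_le_mul_left _ (add_le_add (add_le_add (Nat.mul_le_mul_left _ h₁) (by omega)) (by omega))
    have h₅ : k ^ 2 ≤ k ^ 2 * d := Nat.le_mul_of_pos_right _ hd
    have h₆ : d ≤ k ^ 2 * d := Nat.le_mul_of_pos_left _ h₃
    have h₇ : c * k ^ 2 ≤ c * (k ^ 2 * d) := Nat.mul_le_mul_left _ h₅
    nlinarith
  have key' : d * (c * (k + 1) ^ 2 + k * 60 + 250) + c * k ^ 2 + k * 120 + d * 20 + 500 ≤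
      (5 * c + 2000) * (k ^ 2 * d) := by
    refine le_trans ?_ key
    gcongr <;> norm_num
  exact ⟨(h.rankWithin hk hd).mono key', (h.unrankWithin hk hd).mono key⟩

end RankMod

theorem mainTheorem9 :
    (∃ (F : RankMod.Ingredients) (c : ℕ), F.Valid c) ∧
    ∀ c : ℕ,
      (∃ C : ℕ, ∀ F : RankMod.Ingredients, F.Valid c → ∀ k d : ℕ, 2 ≤ k → 1 ≤ d →
        F.RankWithin k d (C * (k ^ 2 * d)) ∧ F.UnrankWithin k d (C * (k ^ 2 * d))) ∧
      (∀ ε : ℝ, 0 < ε → ∃ C : ℕ, ∀ F : RankMod.Ingredients, F.Valid c →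
        ∀ k d n : ℕ, 2 ≤ k → 1 ≤ d → n = k * d → ε * (n : ℝ) ≤ (d : ℝ) →
          F.RankWithin k d (C * n) ∧ F.UnrankWithin k d (C * n)) := by
  refine ⟨⟨_, _, RankMod.towerIngredients_valid⟩, fun c =>
    ⟨⟨_, fun F h k d hk hd => h.within hk hd⟩, fun ε hε => ?_⟩⟩
  refine ⟨(5 * c + 2000) * ⌈ε⁻¹⌉₊, ?_⟩
  rintro F h k d _ hk hd rfl hkd
  -- Cancelling `d` from `ε k d ≤ d` bounds `k`, so one factor of `k² d = k · n` becomes a constant.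
  have hkε : k ≤ ⌈ε⁻¹⌉₊ := by
    have hd' : (0 : ℝ) < d := Nat.cast_pos.2 hd
    rw [Nat.cast_mul, ← mul_assoc] at hkd
    have h₁ : ε * k ≤ 1 := le_of_mul_le_mul_right (by rwa [one_mul]) hd'
    have h₂ : (k : ℝ) ≤ ε⁻¹ := by
      rw [← one_div, le_div_iff₀ hε, mul_comm]
      exact h₁
    exact_mod_cast h₂.trans (Nat.le_ceil _)
  have key : (5 * c + 2000) * (k ^ 2 * d) ≤ (5 * c + 2000) * ⌈ε⁻¹⌉₊ * (k * d) := by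
    rw [mul_assoc, pow_two, mul_assoc k k d]
    exact Nat.mul_le_mul_left _ (Nat.mul_le_mul_right _ hkε)
  exact ⟨(h.within hk hd).1.mono key, (h.within hk hd).2.mono key⟩
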